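/- Let $m\ge 0$ be an integer (the paper's $d/2$) and $0\le\rho\le 1$. Write $w=(y,\eta)\in\mathbf R^{2m}$ and $z=(x,\xi)\in\mathbf R^{2m}$, $|z_j|^2=x_j^2+\xi_j^2$. A family of smooth real functions $a_k(y,\eta)$ on $\mathbf R^{2m}$ is called bounded in $S^0_{\rho,0}$ if $|\partial_y^\alpha\partial_\eta^\gamma a_k(y,\eta)|\le C_{\alpha\gamma}(1+|\eta|^2)^{-\rho|\gamma|/2}$ with $C_{\alpha\gamma}$ independent of $k$ ($\rho=1$ is the Kohn–Nirenberg class of order $0$). $\mathsf{Op}^w_\hbar$ denotes the semiclassical Weyl quantization $$\mathsf{Op}^w_\hbar(a)u(x)=\frac1{(2\pi\hbar)^N}\int e^{\frac i\hbar\langle x-x',\xi\rangle}a\Big(\frac{x+x'}2,\xi\Big)u(x')\,dx'\,d\xi$$ (oscillatory integral, on $\mathbf R^N$); it is also used for operator-valued symbols. Let $\hat\beta_1,\dots,\hat\beta_m:\mathbf R^{2m}_w\to\mathbf R$ be bounded in $S^0_{\rho,0}$ and bounded from below by a positive constant. Let $f^\star(w,I_1,\dots,I_m,\hbar)$ be a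 smooth real function on $\mathbf R^{2m}\times\mathbf R^m\times\mathbf R$ which vanishes for $(I,\hbar)$ outside a compact set and such that the functions $f^\star(\cdot,I,\hbar)$ are bounded in $S^0_{\rho,0}$ uniformly in $(I,\hbar)$. Let $\mathcal I_\hbar^{(j)}=-\hbar^2\partial_{x_j}^2+x_j^2$ on $L^2(\mathbf R^m_x)$, and let $$\mathcal N_\hbar=\mathsf{Op}^w_\hbar\Big(\sum_{j=1}^m\hat\beta_j(w)|z_j|^2\Big)+\mathsf{Op}^w_\hbar f^\star(w,\mathcal I_\hbar^{(1)},\dots,\mathcal I_\hbar^{(m)},\hbar)$$ on $L^2(\mathbf R^m_y\times\mathbf R^m_x)$, where the second term is the Weyl quantization in $w$ of the operator-valued symbol $w\mapsto f^\star(w,\mathcal I_\hbar^{(1)},\dots,\mathcal I_\hbar^{(m)},\hbar)$ given by the joint functional calculus. All these operators are defined on Schwartz functions and then closed in $L^2$. For $k\ge0$ let $h_k$ be the $k$-th normalized semiclassical Hermite function, $$h_k(t)=(k!\sqrt{\pi\hbar})^{-1/2}\,\mathrm{He}_k\big(\sqrt{2/\hbar}\,t\big)e^{-t^2/(2\hbar)},$$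 with $\mathrm{He}_k$ the probabilists' Hermite polynomial. For $n\in\mathbf N^m$ put $$F^{(n)}(w)=\hbar\sum_{j=1}^m\hat\beta_j(w)(2n_j+1)+f^\star\big(w,\hbar(2n_1+1),\dots,\hbar(2n_m+1),\hbar\big),\qquad \mathcal N_\hbar^{(n)}=\mathsf{Op}^w_\hbar(F^{(n)})\ \text{ on } L^2(\mathbf R^m_y).$$ Then there is $\hbar_0>0$ such that, for each $n\in\mathbf N^m$, the symbols $F^{(n)}$, $\hbar\in(0,\hbar_0]$, are bounded in $S^0_{\rho,0}$ uniformly in $\hbar$, and for every $\hbar\in(0,\hbar_0]$: 1. $-\hbar^2h_k''+t^2h_k=\hbar(2k+1)h_k$ for all $k\ge 0$; the $\mathcal I^{(j)}_\hbar$ are essentially self-adjoint on the Schwartz space, and their joint eigenvectors span a dense subspace; 2. $\mathcal N_\hbar$ and all the $\mathcal N_\hbar^{(n)}$ map Schwartz functions into $L^2$ and are essentially self-adjoint on the Schwartz space; 3. for every $n\in\mathbf N^m$ and every $u\in\mathcal S(\mathbf R^m_y)$, $$\mathcal N_\hbar(u\otimes h_{n_1}\otimes\dots\otimes h_{n_m})=\mathcal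 N_\hbar^{(n)}(u)\otimes h_{n_1}\otimes\dots\otimes h_{n_m};$$ 4. $\mathsf{sp}(\mathcal N_\hbar)=\bigcup_{n\in\mathbf N^m}\mathsf{sp}(\mathcal N_\hbar^{(n)})$; 5. for every $\mu\in\mathbf C$, the multiplicity (in $\mathbf N\cup\{\infty\}$, zero if $\mu$ is not an eigenvalue) of $\mu$ as an eigenvalue of $\mathcal N_\hbar$ is the sum over $n$ of its multiplicities as an eigenvalue of $\mathcal N_\hbar^{(n)}$. -/

import Mathlib

open MeasureTheory
open scoped ContDiff SchwartzMap

noncomputable section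

namespace BirkhoffNF

/-! ### Unbounded operators -/

section Operators

variable {H : Type*} [NormedAddCommGroup H] [InnerProductSpace ℂ H] [CompleteSpace H]

/-- The closed operator whose graph is the closure of the linear span of `G`, where `G` is a set of
pairs `(u, A u)` that prescribes an operator `A` on a space of test vectors `u`. -/
def closedOperator (G : Set (H × H)) : H →ₗ.[ℂ] H :=
  (Submodule.span ℂ G).topologicalClosure.toLinearPMap

/-- The pairs in `G` prescribe an essentially self-adjoint operator on the test vectors `D`: every
element of `D` has an image, the closure of `G` is the graph of the operator `closedOperator G`,
and this operator is self-adjoint. -/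
def IsEssentiallySelfAdjoint (D : Set H) (G : Set (H × H)) : Prop :=
  Prod.fst '' G = D ∧ ((closedOperator G).graph : Set (H × H)) = closure G ∧
    IsSelfAdjoint (closedOperator G)

/-- The resolvent set of an unbounded operator: `T - μ` maps the domain of `T` bijectively onto the
whole space, with a bounded inverse `R`. -/
def opResolventSet (T : H →ₗ.[ℂ] H) : Set ℂ :=
  {μ | ∃ R : H →L[ℂ] H, (∀ h, ∃ hR : R h ∈ T.domain, T ⟨R h, hR⟩ - μ • R h = h) ∧
    ∀ v : T.domain, R (T v - μ • (v : H)) = v}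

/-- The spectrum of an unbounded operator. -/
def opSpectrum (T : H →ₗ.[ℂ] H) : Set ℂ := (opResolventSet T)ᶜ

/-- The eigenspace `ker (T - μ)`. -/
def eigenspace (T : H →ₗ.[ℂ] H) (μ : ℂ) : Submodule ℂ H :=
  (LinearMap.ker (T.toFun - μ • T.domain.subtype)).map T.domain.subtype

/-- The multiplicity of `μ` as an eigenvalue of `T` (`0` if `μ` is not an eigenvalue), in
`ℕ ∪ {∞}`. -/
def eigenMultiplicity (T : H →ₗ.[ℂ] H) (μ : ℂ) : ℕ∞ :=
  Cardinal.toENat (Module.rank ℂ (eigenspace T μ))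

variable {ι : Type*}

/-- The joint eigenspace of a family of operators, `{v | T j v = l j • v for all j}`. -/
def jointEigenspace (T : ι → H →ₗ.[ℂ] H) (l : ι → ℝ) : Submodule ℂ H :=
  ⨅ j, eigenspace (T j) (l j : ℂ)

/-- The joint eigenspaces span a dense subspace (the family has pure point joint spectrum). -/
def HasPurePointSpectrum (T : ι → H →ₗ.[ℂ] H) : Prop :=
  (⨆ l : ι → ℝ, jointEigenspace T l).topologicalClosure = ⊤

/-- The functional calculus `g (T₁, …, T_m) = ∑ g(l) P_l` of commuting self-adjoint operators with
pure point joint spectrum, where `l` runs through the joint eigenvalues and `P_l` is the orthogonal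
projection onto the joint eigenspace (which is closed when the `T j` are closed). -/
def functionalCalculus (T : ι → H →ₗ.[ℂ] H) (g : (ι → ℝ) → ℝ) (v : H) : H :=
  ∑' l : ι → ℝ, (g l : ℂ) • (jointEigenspace T l).topologicalClosure.starProjection v

end Operators

/-! ### Function spaces -/

/-- The Euclidean space `ℝᵐ`. -/
abbrev E (m : ℕ) : Type := EuclideanSpace ℝ (Fin m)

/-- The Hilbert space `L²(V)` of complex functions. -/
abbrev L2 (V : Type*) [MeasureSpace V] : Type _ := Lp ℂ 2 (volume : Measure V)

open Classical in
/-- The class in `L²(V)` of a square integrable function. -/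
def toL2 {V : Type*} [MeasureSpace V] (g : V → ℂ) : L2 V :=
  if h : MemLp g 2 (volume : Measure V) then h.toLp g else 0

/-- The tensor product `(u ⊗ v)(y, x) = u(y) v(x)` in `L²(ℝᵐ × ℝᵐ)`. -/
def tensor {m : ℕ} (u v : L2 (E m)) : L2 (E m × E m) :=
  toL2 fun p => u p.1 * v p.2

/-- The classes in `L²(V)` of the Schwartz functions. -/
def schwartzClasses (V : Type*) [NormedAddCommGroup V] [NormedSpace ℝ V] [MeasureSpace V] :
    Set (L2 V) :=
  {g | ∃ u : 𝓢(V, ℂ), g =ᵐ[volume] u}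

/-! ### Symbols and Weyl quantization -/

/-- The family `a` of real functions of `w = (y, η)` is bounded in the symbol class `S⁰_{ρ,0}`:
all `a k` are smooth and
`|∂_y^α ∂_η^γ a_k(y, η)| ≤ C_{αγ} (1 + |η|²)^{-ρ|γ|/2}` with `C_{αγ}` independent of `k`. -/
def IsSymbolFamily {m : ℕ} {κ : Type*} (ρ : ℝ) (a : κ → E m × E m → ℝ) : Prop :=
  (∀ k, ContDiff ℝ ∞ (a k)) ∧
  ∀ p q : ℕ, ∃ C : ℝ, ∀ (k : κ) (α : Fin p → Fin m) (γ : Fin q → Fin m) (y η : E m),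
    |iteratedFDeriv ℝ (p + q) (a k) (y, η)
      (Fin.append (fun s => ((EuclideanSpace.single (α s) (1 : ℝ) : E m), (0 : E m)))
        (fun t => ((0 : E m), (EuclideanSpace.single (γ t) (1 : ℝ) : E m))))|
      ≤ C * (1 + ‖η‖ ^ 2) ^ (-(ρ * q / 2))

/-- The semiclassical Weyl quantization on the space `V` with the duality pairing `pair`, applied to
a function `u` with values in a Hilbert space `F`, of a symbol `A` with values in the operators
on `F`:
`(2πħ)^{-dim V} ∫ (∫ e^{i⟨x - x', ξ⟩/ħ} A((x + x')/2, ξ) u(x') dx') dξ`.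
For the symbols and the Schwartz functions considered here the inner integral decays rapidly
in `ξ`, so that the iterated integral is the oscillatory integral. -/
def weyl {V F : Type*} [NormedAddCommGroup V] [NormedSpace ℝ V] [MeasureSpace V]
    [NormedAddCommGroup F] [NormedSpace ℂ F] (pair : V → V → ℝ) (ħ : ℝ)
    (A : V → V → F → F) (u : V → F) (x : V) : F :=
  (((2 * Real.pi * ħ) ^ Module.finrank ℝ V)⁻¹ : ℂ) •
    ∫ ξ : V, ∫ x' : V, Complex.exp (Complex.I * ((pair (x - x') ξ / ħ : ℝ) : ℂ)) •
      A ((1 / 2 : ℝ) • (x + x')) ξ (u x')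

/-- The standard pairing on `ℝᵐ`. -/
def pairE {m : ℕ} (x ξ : E m) : ℝ := inner ℝ x ξ

/-- The standard pairing on `ℝᵐ × ℝᵐ = ℝ²ᵐ`. -/
def pairEE {m : ℕ} (x ξ : E m × E m) : ℝ := inner ℝ x.1 ξ.1 + inner ℝ x.2 ξ.2

/-- The pairs `(u, Op^w_ħ(a) u)` in `L²(ℝᵐ)`, `u` a Schwartz function. -/
def weylGraph {m : ℕ} (ħ : ℝ) (a : E m × E m → ℝ) : Set (L2 (E m) × L2 (E m)) :=
  {P | ∃ u : 𝓢(E m, ℂ), P.1 =ᵐ[volume] u ∧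
    P.2 =ᵐ[volume] weyl pairE ħ (fun y η (v : ℂ) => (a (y, η) : ℂ) • v) u}

/-- The pseudodifferential operator `Op^w_ħ(a)` on `L²(ℝᵐ)`. -/
def weylOperator {m : ℕ} (ħ : ℝ) (a : E m × E m → ℝ) : L2 (E m) →ₗ.[ℂ] L2 (E m) :=
  closedOperator (weylGraph ħ a)

/-! ### Harmonic oscillators and Hermite functions -/

/-- The pairs `(u, -ħ² ∂²u/∂x_j² + x_j² u)` in `L²(ℝᵐ)`, `u` a Schwartz function. -/
def oscillatorGraph {m : ℕ} (ħ : ℝ) (j : Fin m) : Set (L2 (E m) × L2 (E m)) :=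
  {P | ∃ u : 𝓢(E m, ℂ), P.1 =ᵐ[volume] u ∧
    P.2 =ᵐ[volume] fun x =>
      -(ħ : ℂ) ^ 2 * iteratedDeriv 2 (fun t : ℝ => u (x + t • EuclideanSpace.single j (1 : ℝ))) 0
        + (x j : ℂ) ^ 2 * u x}

/-- The harmonic oscillator in the `j`-th variable, as a closed operator on `L²(ℝᵐ)`. -/
def oscillator {m : ℕ} (ħ : ℝ) (j : Fin m) : L2 (E m) →ₗ.[ℂ] L2 (E m) :=
  closedOperator (oscillatorGraph ħ j)

/-- The `k`-th normalized semiclassical Hermite function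
`(k! √(πħ))^{-1/2} He_k(√(2/ħ) t) e^{-t²/(2ħ)}`; `Polynomial.hermite` is the probabilists' Hermite
polynomial `He_k`. -/
def hermiteFun (ħ : ℝ) (k : ℕ) (t : ℝ) : ℝ :=
  (Real.sqrt (k.factorial * Real.sqrt (Real.pi * ħ)))⁻¹ *
    Polynomial.aeval (Real.sqrt (2 / ħ) * t) (Polynomial.hermite k) *
    Real.exp (-t ^ 2 / (2 * ħ))

/-- `h_n(x) = h_{n_1}(x_1) ⋯ h_{n_m}(x_m)` in `L²(ℝᵐ)`. -/
def hermiteProd {m : ℕ} (ħ : ℝ) (n : Fin m → ℕ) : L2 (E m) :=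
  toL2 fun x => ((∏ j, hermiteFun ħ (n j) (x j) : ℝ) : ℂ)

/-! ### The normal form -/

/-- `Op^w_ħ(∑_j β_j(w) |z_j|²) ψ`, the Weyl quantization being taken in all the variables; points
of the configuration space are written `(y, x)` and their dual variables `(η, ξ)`. -/
def modelAction {m : ℕ} (β : Fin m → E m × E m → ℝ) (ħ : ℝ) (ψ : E m × E m → ℂ) :
    E m × E m → ℂ :=
  weyl pairEE ħ
    (fun q p (v : ℂ) => ((∑ j, β j (q.1, p.1) * (q.2 j ^ 2 + p.2 j ^ 2) : ℝ) : ℂ) • v) ψ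

/-- `Op^w_ħ f(w, I⁽¹⁾, …, I⁽ᵐ⁾, ħ) ψ`: the Weyl quantization in `w = (y, η)` of the symbol
`w ↦ f(w, I⁽¹⁾, …, I⁽ᵐ⁾, ħ)` with values in the operators on `L²(ℝᵐ_x)`, applied to
`y ↦ ψ(y, ·)`. -/
def perturbationAction {m : ℕ} (f : E m × E m → (Fin m → ℝ) → ℝ → ℝ) (ħ : ℝ)
    (ψ : E m × E m → ℂ) : E m → L2 (E m) :=
  weyl pairE ħ
    (fun y η (v : L2 (E m)) => functionalCalculus (oscillator ħ) (fun l => f (y, η) l ħ) v)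
    (fun y => toL2 fun x => ψ (y, x))

/-- The pairs `(ψ, N_ħ ψ)` in `L²(ℝᵐ_y × ℝᵐ_x)`, `ψ` a Schwartz function. -/
def normalFormGraph {m : ℕ} (β : Fin m → E m × E m → ℝ)
    (f : E m × E m → (Fin m → ℝ) → ℝ → ℝ) (ħ : ℝ) : Set (L2 (E m × E m) × L2 (E m × E m)) :=
  {P | ∃ ψ : 𝓢(E m × E m, ℂ), P.1 =ᵐ[volume] ψ ∧
    ∀ᵐ y : E m, ∀ᵐ x : E m,
      P.2 (y, x) = modelAction β ħ ψ (y, x) + perturbationAction f ħ ψ y x}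

/-- The normal form `N_ħ = Op^w_ħ(∑_j β_j(w) |z_j|²) + Op^w_ħ f(w, I⁽¹⁾, …, I⁽ᵐ⁾, ħ)`. -/
def normalForm {m : ℕ} (β : Fin m → E m × E m → ℝ)
    (f : E m × E m → (Fin m → ℝ) → ℝ → ℝ) (ħ : ℝ) : L2 (E m × E m) →ₗ.[ℂ] L2 (E m × E m) :=
  closedOperator (normalFormGraph β f ħ)

/-- The symbol `F⁽ⁿ⁾(w) = ħ ∑_j β_j(w)(2n_j + 1) + f(w, ħ(2n + 1), ħ)`. -/
def reducedSymbol {m : ℕ} (β : Fin m → E m × E m → ℝ)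
    (f : E m × E m → (Fin m → ℝ) → ℝ → ℝ) (n : Fin m → ℕ) (ħ : ℝ) (w : E m × E m) : ℝ :=
  ħ * ∑ j, β j w * (2 * n j + 1) + f w (fun j => ħ * (2 * n j + 1)) ħ

end BirkhoffNF

end

open BirkhoffNF

open MeasureTheory
open scoped ContDiff SchwartzMap

noncomputable section

namespace BirkhoffNF

/-! ### Orthogonal sums of bounded self-adjoint operators -/

section DiagonalOperators

open scoped InnerProductSpace

variable {ι K H : Type} [NormedAddCommGroup K] [InnerProductSpace ℂ K] [CompleteSpace K]
  [NormedAddCommGroup H] [InnerProductSpace ℂ H] [CompleteSpace H]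

/-- The component of a vector along the `n`-th summand. -/
def component (J : ι → K →ₗᵢ[ℂ] H) (n : ι) : H →L[ℂ] K :=
  ContinuousLinearMap.adjoint (J n).toContinuousLinearMap

lemma inner_component_right (J : ι → K →ₗᵢ[ℂ] H) (n : ι) (u : K) (ψ : H) :
    ⟪u, component J n ψ⟫_ℂ = ⟪J n u, ψ⟫_ℂ :=
  ContinuousLinearMap.adjoint_inner_right _ _ _

lemma component_self (J : ι → K →ₗᵢ[ℂ] H) (n : ι) (u : K) : component J n (J n u) = u := by
  refine ext_inner_left ℂ fun v => ?_
  rw [inner_component_right, LinearIsometry.inner_map_map]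

lemma component_of_ne {J : ι → K →ₗᵢ[ℂ] H} (hJ : OrthogonalFamily ℂ (fun _ => K) J) {n k : ι}
    (h : n ≠ k) (u : K) : component J n (J k u) = 0 := by
  refine ext_inner_left ℂ fun v => ?_
  rw [inner_component_right, inner_zero_right]
  exact hJ h v u

/-- The summands are orthogonal and total. -/
structure IsOrthogonalSum (J : ι → K →ₗᵢ[ℂ] H) : Prop where
  orthogonal : OrthogonalFamily ℂ (fun _ => K) J
  total : ∀ ψ, (∀ n, component J n ψ = 0) → ψ = 0

variable {J : ι → K →ₗᵢ[ℂ] H}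

lemma IsOrthogonalSum.ext (hJ : IsOrthogonalSum J) {ψ φ : H}
    (h : ∀ n, component J n ψ = component J n φ) : ψ = φ :=
  sub_eq_zero.1 (hJ.total _ fun n => by rw [map_sub, h, sub_self])

lemma IsOrthogonalSum.isHilbertSum (hJ : IsOrthogonalSum J) :
    IsHilbertSum ℂ (fun _ => K) J := by
  refine IsHilbertSum.mk hJ.orthogonal ?_
  rw [top_le_iff, Submodule.topologicalClosure_eq_top_iff, Submodule.eq_bot_iff]
  intro ψ hψ
  refine hJ.total ψ fun n => ext_inner_left ℂ fun u => ?_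
  rw [inner_component_right, inner_zero_right]
  exact hψ _ (Submodule.mem_iSup_of_mem n ⟨u, rfl⟩)

lemma IsOrthogonalSum.equiv_apply (hJ : IsOrthogonalSum J) (ψ : H) (n : ι) :
    hJ.isHilbertSum.linearIsometryEquiv ψ n = component J n ψ := by
  classical
  refine ext_inner_left ℂ fun u => ?_
  have h := lp.inner_single_left (𝕜 := ℂ) n u (hJ.isHilbertSum.linearIsometryEquiv ψ)
  rw [← LinearIsometryEquiv.inner_map_map hJ.isHilbertSum.linearIsometryEquiv.symm,
    IsHilbertSum.linearIsometryEquiv_symm_apply_single,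
    LinearIsometryEquiv.symm_apply_apply] at h
  rw [inner_component_right]
  exact h.symm

lemma IsOrthogonalSum.hasSum (hJ : IsOrthogonalSum J) (ψ : H) :
    HasSum (fun n => J n (component J n ψ)) ψ := by
  have h := hJ.isHilbertSum.hasSum_linearIsometryEquiv_symm (hJ.isHilbertSum.linearIsometryEquiv ψ)
  simpa only [LinearIsometryEquiv.symm_apply_apply, hJ.equiv_apply] using h

lemma IsOrthogonalSum.hasSum_inner (hJ : IsOrthogonalSum J) (ψ φ : H) :
    HasSum (fun n => ⟪component J n ψ, component J n φ⟫_ℂ) ⟪ψ, φ⟫_ℂ := by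
  have h := lp.hasSum_inner (𝕜 := ℂ) (hJ.isHilbertSum.linearIsometryEquiv ψ)
    (hJ.isHilbertSum.linearIsometryEquiv φ)
  simpa only [LinearIsometryEquiv.inner_map_map, hJ.equiv_apply] using h

lemma IsOrthogonalSum.hasSum_norm_sq (hJ : IsOrthogonalSum J) (ψ : H) :
    HasSum (fun n => ‖component J n ψ‖ ^ 2) (‖ψ‖ ^ 2) := by
  have h := Complex.hasSum_re (hJ.hasSum_inner ψ ψ)
  simpa only [inner_self_eq_norm_sq_to_K, ← Complex.ofReal_pow, Complex.ofReal_re,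
    Complex.coe_algebraMap] using h

/-- Bounded families of operators act on an orthogonal sum. -/
lemma IsOrthogonalSum.exists_diagonal (hJ : IsOrthogonalSum J) (R : ι → K →L[ℂ] K) (C : ℝ)
    (hC : ∀ n, ‖R n‖ ≤ C) :
    ∃ D : H →L[ℂ] H, ∀ ψ n, component J n (D ψ) = R n (component J n ψ) := by
  have hb : ∀ ψ n, ‖R n (component J n ψ)‖ ^ 2 ≤ C ^ 2 * ‖component J n ψ‖ ^ 2 := fun ψ n => by
    rw [← mul_pow]
    gcongr
    exact (R n).le_of_opNorm_le (hC n) _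
  have hmem : ∀ ψ, Memℓp (fun n => R n (component J n ψ)) 2 := fun ψ => by
    refine memℓp_gen ?_
    simp only [ENNReal.toReal_ofNat, Real.rpow_ofNat]
    exact Summable.of_nonneg_of_le (fun n => by positivity) (hb ψ)
      ((hJ.hasSum_norm_sq ψ).summable.mul_left _)
  have hex : ∀ ψ, ∃ φ, ∀ n, component J n φ = R n (component J n ψ) := fun ψ =>
    ⟨hJ.isHilbertSum.linearIsometryEquiv.symm ⟨_, hmem ψ⟩, fun n => by
      rw [← hJ.equiv_apply, LinearIsometryEquiv.apply_symm_apply]⟩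
  choose D hD using hex
  let DL : H →ₗ[ℂ] H :=
    { toFun := D
      map_add' := fun x y => hJ.ext fun n => by simp only [hD, map_add]
      map_smul' := fun c x => hJ.ext fun n => by simp only [hD, map_smul, RingHom.id_apply] }
  refine ⟨DL.mkContinuous |C| fun ψ => ?_, hD⟩
  rw [← pow_le_pow_iff_left₀ (norm_nonneg _) (by positivity) two_ne_zero, mul_pow, sq_abs]
  refine hasSum_le (fun n => ?_) (hJ.hasSum_norm_sq (DL ψ))
    ((hJ.hasSum_norm_sq ψ).mul_left (C ^ 2))
  exact (congrArg (fun x => ‖x‖ ^ 2) (hD ψ n)).trans_le (hb ψ n)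

/-- The graph of the orthogonal sum of the operators `A n`, on its maximal domain. -/
def diagonalGraph (J : ι → K →ₗᵢ[ℂ] H) (A : ι → K →L[ℂ] K) : Submodule ℂ (H × H) where
  carrier := {p | ∀ n, component J n p.2 = A n (component J n p.1)}
  add_mem' := fun ha hb n => by
    simp only [Prod.snd_add, Prod.fst_add, map_add, ha n, hb n]
  zero_mem' := fun n => by simp
  smul_mem' := fun c p hp n => by
    simp only [Prod.smul_snd, Prod.smul_fst, map_smul, hp n]

lemma mem_diagonalGraph {A : ι → K →L[ℂ] K} {p : H × H} :
    p ∈ diagonalGraph J A ↔ ∀ n, component J n p.2 = A n (component J n p.1) := Iff.rfl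

lemma isClosed_diagonalGraph (A : ι → K →L[ℂ] K) :
    IsClosed (diagonalGraph J A : Set (H × H)) := by
  have : (diagonalGraph J A : Set (H × H))
      = ⋂ n, {p | component J n p.2 = A n (component J n p.1)} := by
    ext p
    simp [mem_diagonalGraph]
  rw [this]
  exact isClosed_iInter fun n => isClosed_eq (by fun_prop) (by fun_prop)

lemma IsOrthogonalSum.mk_mem_diagonalGraph (hJ : IsOrthogonalSum J) (A : ι → K →L[ℂ] K) (n : ι)
    (u : K) : (J n u, J n (A n u)) ∈ diagonalGraph J A := fun k => by
  by_cases h : k = n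
  · subst h
    simp only [component_self]
  · simp only [component_of_ne hJ.orthogonal h, map_zero]

lemma IsOrthogonalSum.eq_of_mem (hJ : IsOrthogonalSum J) {A : ι → K →L[ℂ] K} {ψ φ φ' : H}
    (h : (ψ, φ) ∈ diagonalGraph J A) (h' : (ψ, φ') ∈ diagonalGraph J A) : φ = φ' :=
  hJ.ext fun n => (h n).trans (h' n).symm

lemma IsOrthogonalSum.adjoint_diagonalGraph (hJ : IsOrthogonalSum J) {A : ι → K →L[ℂ] K}
    (hA : ∀ n, IsSelfAdjoint (A n)) : (diagonalGraph J A).adjoint = diagonalGraph J A := by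
  have hs : ∀ n u v, ⟪A n u, v⟫_ℂ = ⟪u, A n v⟫_ℂ := fun n u v =>
    (ContinuousLinearMap.isSelfAdjoint_iff_isSymmetric.1 (hA n)) u v
  ext ⟨ψ, φ⟩
  rw [Submodule.mem_adjoint_iff]
  constructor
  · intro h n
    refine ext_inner_left ℂ fun u => ?_
    have h1 := sub_eq_zero.1 (h _ _ (hJ.mk_mem_diagonalGraph A n u))
    rw [inner_component_right, ← h1, ← inner_component_right, hs]
  · intro h a b hab
    refine sub_eq_zero.2 ((hJ.hasSum_inner b ψ).unique ?_)
    convert hJ.hasSum_inner a φ using 2 with n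
    rw [hab n, h n, hs]

/-- A prescribed operator that is contained in an orthogonal sum of bounded self-adjoint operators
and contains a core of each summand is essentially self-adjoint. -/
lemma IsOrthogonalSum.essentiallySelfAdjoint (hJ : IsOrthogonalSum J) {A : ι → K →L[ℂ] K}
    (hA : ∀ n, IsSelfAdjoint (A n)) {G : Set (H × H)} (D : Submodule ℂ H)
    (hG : G ⊆ diagonalGraph J A) (hD : Prod.fst '' G = D) {D₀ : Set K} (hD₀ : Dense D₀)
    (hcore : ∀ n, ∀ u ∈ D₀, (J n u, J n (A n u)) ∈ G) :
    IsEssentiallySelfAdjoint (D : Set H) G ∧ (closedOperator G).graph = diagonalGraph J A := by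
  have hGS : G = (diagonalGraph J A ⊓ D.comap (LinearMap.fst ℂ H H) : Submodule ℂ (H × H)) := by
    ext ⟨ψ, φ⟩
    constructor
    · intro h
      refine ⟨hG h, ?_⟩
      have : ψ ∈ (D : Set H) := hD ▸ ⟨_, h, rfl⟩
      exact this
    · rintro ⟨h1, h2⟩
      have h2' : ψ ∈ Prod.fst '' G := hD ▸ h2
      obtain ⟨⟨ψ', φ'⟩, h3, rfl⟩ := h2'
      rwa [hJ.eq_of_mem h1 (hG h3)]
  have hspan : (Submodule.span ℂ G : Set (H × H)) = G := by
    rw [hGS, Submodule.span_eq]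
  have hcl : closure G = diagonalGraph J A := by
    refine (closure_minimal hG (isClosed_diagonalGraph A)).antisymm ?_
    have hclG : ∀ n u, (J n u, J n (A n u)) ∈ (Submodule.span ℂ G).topologicalClosure := by
      intro n u
      have hc : Continuous fun u => ((J n u, J n (A n u)) : H × H) := by fun_prop
      have := (hc.range_subset_closure_image_dense hD₀) ⟨u, rfl⟩
      rw [← SetLike.mem_coe, Submodule.topologicalClosure_coe, hspan]
      exact closure_mono (by rintro _ ⟨v, hv, rfl⟩; exact hcore n v hv) this
    rintro ⟨ψ, φ⟩ h
    have hsum : HasSum (fun n => ((J n (component J n ψ), J n (component J n φ)) : H × H))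
        (ψ, φ) := (hJ.hasSum ψ).prodMk (hJ.hasSum φ)
    have hmem : (ψ, φ) ∈ (Submodule.span ℂ G).topologicalClosure := by
      refine (Submodule.span ℂ G).isClosed_topologicalClosure.mem_of_tendsto hsum
        (Filter.Eventually.of_forall fun s => Submodule.sum_mem _ fun n _ => ?_)
      rw [h n]
      exact hclG n _
    rwa [← SetLike.mem_coe, Submodule.topologicalClosure_coe, hspan] at hmem
  have hcl' : (Submodule.span ℂ G).topologicalClosure = diagonalGraph J A :=
    SetLike.coe_injective (by rw [Submodule.topologicalClosure_coe, hspan, hcl])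
  have hgraph : (closedOperator G).graph = diagonalGraph J A := by
    rw [closedOperator, hcl']
    refine Submodule.toLinearPMap_graph_eq _ ?_
    rintro ⟨ψ, φ⟩ h h0
    simp only at h0
    subst h0
    exact hJ.eq_of_mem h (diagonalGraph J A).zero_mem
  have hdense : Dense ((closedOperator G).domain : Set H) := by
    rw [Submodule.dense_iff_topologicalClosure_eq_top, Submodule.topologicalClosure_eq_top_iff,
      Submodule.eq_bot_iff]
    intro ψ hψ
    refine hJ.total ψ fun n => ext_inner_left ℂ fun u => ?_
    rw [inner_component_right, inner_zero_right]
    exact hψ _ (LinearPMap.mem_domain_iff.2 ⟨_, hgraph ▸ hJ.mk_mem_diagonalGraph A n u⟩)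
  refine ⟨⟨hD, by rw [hgraph, hcl], ?_⟩, hgraph⟩
  rw [LinearPMap.isSelfAdjoint_def]
  refine LinearPMap.eq_of_eq_graph ?_
  rw [LinearPMap.adjoint_graph_eq_graph_adjoint hdense, hgraph, hJ.adjoint_diagonalGraph hA]

omit [CompleteSpace H] in
lemma mem_opResolventSet_iff {T : H →ₗ.[ℂ] H} {μ : ℂ} :
    μ ∈ opResolventSet T ↔ ∃ R : H →L[ℂ] H, (∀ h, (R h, h + μ • R h) ∈ T.graph) ∧
      ∀ ψ φ, (ψ, φ) ∈ T.graph → R (φ - μ • ψ) = ψ := by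
  refine exists_congr fun R => and_congr (forall_congr' fun h => ?_) ⟨fun H ψ φ h => ?_, fun H v => ?_⟩
  · rw [LinearPMap.mem_graph_iff]
    constructor
    · rintro ⟨hR, h1⟩
      exact ⟨⟨R h, hR⟩, rfl, sub_eq_iff_eq_add.1 h1⟩
    · rintro ⟨⟨y, hy⟩, h1, h2⟩
      simp only at h1 h2
      subst h1
      exact ⟨hy, by rw [h2]; abel_nf⟩
  · obtain ⟨y, h1, h2⟩ := LinearPMap.mem_graph_iff _ |>.1 h
    simp only at h1 h2
    rw [← h1, ← h2]
    exact H y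
  · exact H _ _ (T.mem_graph v)

omit [CompleteSpace H] in
lemma mem_eigenspace_iff {T : H →ₗ.[ℂ] H} {μ : ℂ} {v : H} :
    v ∈ eigenspace T μ ↔ (v, μ • v) ∈ T.graph := by
  rw [eigenspace, Submodule.mem_map, LinearPMap.mem_graph_iff]
  refine exists_congr fun y => ?_
  rw [LinearMap.mem_ker, LinearMap.sub_apply, sub_eq_zero]
  constructor
  · rintro ⟨h1, rfl⟩
    exact ⟨rfl, h1⟩
  · rintro ⟨h1, h2⟩
    simp only at h1 h2
    subst h1
    exact ⟨h2, rfl⟩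

/-- If the summands `A n` tend to `+∞`, the spectrum of the orthogonal sum is the union of the
spectra of the summands. -/
lemma IsOrthogonalSum.opSpectrum_eq (hJ : IsOrthogonalSum J) {A : ι → K →L[ℂ] K}
    (hlim : ∀ M : ℝ, ∀ᶠ n in Filter.cofinite, ∀ u, M * ‖u‖ ^ 2 ≤ (⟪A n u, u⟫_ℂ).re)
    {T : H →ₗ.[ℂ] H} (hT : T.graph = diagonalGraph J A) {S : ι → K →ₗ.[ℂ] K}
    (hS : ∀ n p, p ∈ (S n).graph ↔ p.2 = A n p.1) :
    opSpectrum T = ⋃ n, opSpectrum (S n) := by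
  simp only [opSpectrum, ← Set.compl_iInter]
  congr 1
  ext μ
  simp only [Set.mem_iInter, mem_opResolventSet_iff, hT, hS]
  constructor
  · rintro ⟨R, h1, h2⟩ n
    refine ⟨(component J n).comp (R.comp (J n).toContinuousLinearMap), fun h => ?_, ?_⟩
    · have := h1 (J n h) n
      simp only [map_add, map_smul, component_self] at this
      exact this
    · rintro ψ _ rfl
      have := h2 _ _ (hJ.mk_mem_diagonalGraph A n ψ)
      rw [← map_smul, ← map_sub] at this
      change component J n (R (J n (A n ψ - μ • ψ))) = ψ
      rw [this, component_self]
  · intro h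
    choose R h1 h2 using h
    have h3 : ∀ᶠ n in Filter.cofinite, ‖R n‖ ≤ 1 := by
      filter_upwards [hlim (‖μ‖ + 1)] with n hn
      refine ContinuousLinearMap.opNorm_le_bound _ zero_le_one fun h => ?_
      rw [one_mul]
      have e : A n (R n h) = h + μ • R n h := (h1 n h).symm
      have k1 := hn (R n h)
      rw [e, inner_add_left, inner_smul_left, Complex.add_re] at k1
      have k2 : (⟪h, R n h⟫_ℂ).re ≤ ‖h‖ * ‖R n h‖ :=
        (Complex.re_le_norm _).trans (norm_inner_le_norm _ _)
      have k3 : ((starRingEnd ℂ) μ * ⟪R n h, R n h⟫_ℂ).re ≤ ‖μ‖ * ‖R n h‖ ^ 2 := by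
        refine (Complex.re_le_norm _).trans ?_
        rw [norm_mul, RCLike.norm_conj, inner_self_eq_norm_sq_to_K]
        simp
      by_contra! hc
      have : 0 < ‖R n h‖ := (norm_nonneg h).trans_lt hc
      nlinarith
    obtain ⟨C, hC⟩ : ∃ C, ∀ n, ‖R n‖ ≤ C := by
      have hfin : Set.Finite {n | ¬ ‖R n‖ ≤ 1} := h3
      refine ⟨1 + ∑ n ∈ hfin.toFinset, ‖R n‖, fun n => ?_⟩
      have hpos : 0 ≤ ∑ n ∈ hfin.toFinset, ‖R n‖ := Finset.sum_nonneg fun _ _ => norm_nonneg _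
      by_cases hn : ‖R n‖ ≤ 1
      · linarith
      · have := Finset.single_le_sum (f := fun n => ‖R n‖) (fun _ _ => norm_nonneg _)
          (hfin.mem_toFinset.2 hn)
        linarith
    obtain ⟨D, hD⟩ := hJ.exists_diagonal R C hC
    refine ⟨D, fun h n => ?_, fun ψ φ h => hJ.ext fun n => ?_⟩
    · simp only [map_add, map_smul, hD]
      exact h1 n _
    · rw [hD, map_sub, map_smul]
      exact h2 n _ _ (h n)

lemma cardinalSum_eq_sum {α : Type} [Fintype α] (g : α → Cardinal.{0}) :
    Cardinal.sum g = ∑ i, g i := by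
  revert g
  refine Fintype.induction_empty_option (P := fun α _ => ∀ g : α → Cardinal.{0},
    Cardinal.sum g = ∑ i, g i) (fun α β _ e h g => ?_) (fun g => ?_) (fun α _ h g => ?_) α
  · let := Fintype.ofEquiv β e.symm
    rw [← e.sum_comp, ← h]
    exact Cardinal.mk_congr ((Equiv.sigmaCongrLeft (β := fun b => (g b).out) e).symm)
  · simp [Cardinal.sum]
  · rw [Fintype.sum_option, ← h]
    have e : (Σ o : Option α, (g o).out) ≃ (g none).out ⊕ Σ a : α, (g (some a)).out :=
      { toFun := fun s => match s with
          | ⟨none, x⟩ => Sum.inl x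
          | ⟨some a, x⟩ => Sum.inr ⟨a, x⟩
        invFun := fun s => match s with
          | Sum.inl x => ⟨none, x⟩
          | Sum.inr y => ⟨some y.1, y.2⟩
        left_inv := by rintro ⟨_ | a, x⟩ <;> rfl
        right_inv := by rintro (x | ⟨a, x⟩) <;> rfl }
    have := Cardinal.mk_congr e
    rw [Cardinal.mk_sum, Cardinal.lift_id, Cardinal.lift_id, Cardinal.mk_out] at this
    exact this

/-- If the summands `A n` tend to `+∞`, the multiplicity of an eigenvalue of the orthogonal sum is
the sum of its multiplicities for the summands. -/
lemma IsOrthogonalSum.eigenMultiplicity_eq (hJ : IsOrthogonalSum J) {A : ι → K →L[ℂ] K}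
    (hlim : ∀ M : ℝ, ∀ᶠ n in Filter.cofinite, ∀ u, M * ‖u‖ ^ 2 ≤ (⟪A n u, u⟫_ℂ).re)
    {T : H →ₗ.[ℂ] H} (hT : T.graph = diagonalGraph J A) {S : ι → K →ₗ.[ℂ] K}
    (hS : ∀ n p, p ∈ (S n).graph ↔ p.2 = A n p.1) (μ : ℂ) :
    eigenMultiplicity T μ = ∑' n, eigenMultiplicity (S n) μ := by
  classical
  have hfin : Set.Finite {n | ¬ ∀ u, (‖μ‖ + 1) * ‖u‖ ^ 2 ≤ (⟪A n u, u⟫_ℂ).re} := hlim (‖μ‖ + 1)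
  set F := hfin.toFinset
  have hker : ∀ n, n ∉ F → ∀ u, A n u = μ • u → u = 0 := by
    intro n hn u hu
    have hn' : ∀ u, (‖μ‖ + 1) * ‖u‖ ^ 2 ≤ (⟪A n u, u⟫_ℂ).re := by
      by_contra hc
      exact hn (hfin.mem_toFinset.2 hc)
    have k1 := hn' u
    have k3 : (⟪A n u, u⟫_ℂ).re ≤ ‖μ‖ * ‖u‖ ^ 2 := by
      refine (Complex.re_le_norm _).trans ?_
      rw [hu, inner_smul_left, norm_mul, RCLike.norm_conj, inner_self_eq_norm_sq_to_K]
      simp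
    have : ‖u‖ ^ 2 ≤ 0 := by linarith
    simpa using this
  have hmemS : ∀ n u, u ∈ eigenspace (S n) μ ↔ A n u = μ • u := fun n u => by
    rw [mem_eigenspace_iff, hS, eq_comm]
  have hmemT : ∀ v, v ∈ eigenspace T μ ↔ ∀ n, A n (component J n v) = μ • component J n v := by
    intro v
    rw [mem_eigenspace_iff, hT, mem_diagonalGraph]
    simp only [map_smul]
    exact forall_congr' fun n => eq_comm
  let Φ : eigenspace T μ →ₗ[ℂ] ∀ n : F, eigenspace (S n) μ :=
    LinearMap.pi fun n => LinearMap.codRestrict _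
      ((component J n).toLinearMap.comp (eigenspace T μ).subtype)
      fun v => (hmemS _ _).2 ((hmemT _).1 v.2 n)
  have hΦ : Function.Bijective Φ := by
    constructor
    · rw [← LinearMap.ker_eq_bot, Submodule.eq_bot_iff]
      intro v hv
      refine Subtype.ext (hJ.total _ fun n => ?_)
      by_cases hn : n ∈ F
      · exact congrArg Subtype.val (congrFun (LinearMap.mem_ker.1 hv) ⟨n, hn⟩)
      · exact hker n hn _ ((hmemT _).1 v.2 n)
    · intro w
      have hc : ∀ k, component J k (∑ n : F, J n (w n : K))
          = if h : k ∈ F then (w ⟨k, h⟩ : K) else 0 := by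
        intro k
        rw [map_sum]
        split_ifs with h
        · rw [Finset.sum_eq_single ⟨k, h⟩, component_self]
          · exact fun b _ hb => component_of_ne hJ.orthogonal
              (fun h' => hb (Subtype.ext h'.symm)) _
          · exact fun h' => absurd (Finset.mem_univ _) h'
        · exact Finset.sum_eq_zero fun b _ => component_of_ne hJ.orthogonal
            (fun h' : k = b => h (by rw [h']; exact b.2)) _
      refine ⟨⟨∑ n : F, J n (w n : K), (hmemT _).2 fun k => ?_⟩, ?_⟩
      · rw [hc]
        split_ifs with h
        · exact (hmemS _ _).1 (w ⟨k, h⟩).2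
        · simp
      · funext n
        refine Subtype.ext ?_
        change component J n (∑ n : F, J n (w n : K)) = w n
        rw [hc, dif_pos n.2]
  have hzero : ∀ n, n ∉ F → eigenMultiplicity (S n) μ = 0 := by
    intro n hn
    have : eigenspace (S n) μ = ⊥ :=
      (Submodule.eq_bot_iff _).2 fun u hu => hker n hn u ((hmemS n u).1 hu)
    rw [eigenMultiplicity, this, rank_bot, map_zero]
  rw [tsum_eq_sum (s := F) fun n hn => hzero n hn, eigenMultiplicity,
    (LinearEquiv.ofBijective Φ hΦ).rank_eq, rank_pi, cardinalSum_eq_sum, map_sum]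
  exact Finset.sum_coe_sort F fun n => eigenMultiplicity (S n) μ

end DiagonalOperators

/-! ### Schwartz functions -/

section SchwartzTools

variable {V W : Type} [NormedAddCommGroup V] [NormedSpace ℝ V]
  [NormedAddCommGroup W] [NormedSpace ℝ W]

lemma norm_iteratedFDeriv_comp_clm_le {F : Type} [NormedAddCommGroup F] [NormedSpace ℝ F]
    {a : W → F} (ha : ContDiff ℝ ∞ a) (w : W) (A : V →L[ℝ] W) (k : ℕ) (x : V) :
    ‖iteratedFDeriv ℝ k (fun y => a (w + A y)) x‖
      ≤ ‖iteratedFDeriv ℝ k a (w + A x)‖ * ‖A‖ ^ k := by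
  have h1 : (fun y => a (w + A y)) = (fun y => a (w + y)) ∘ A := rfl
  have h2 : ContDiff ℝ ∞ fun y => a (w + y) := by fun_prop
  rw [h1, A.iteratedFDeriv_comp_right h2 x (i := k) (mod_cast le_top)]
  refine (ContinuousMultilinearMap.norm_compContinuousLinearMap_le _ _).trans ?_
  rw [iteratedFDeriv_comp_add_left]
  simp

lemma exists_one_add_norm_pow_mul_norm_iteratedFDeriv_le {F : Type} [NormedAddCommGroup F] [NormedSpace ℝ F]
    (u : 𝓢(V, F)) (k n : ℕ) :
    ∃ C, 0 ≤ C ∧ ∀ x, (1 + ‖x‖) ^ k * ‖iteratedFDeriv ℝ n u x‖ ≤ C := by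
  refine ⟨_, by positivity, fun x => SchwartzMap.one_add_le_sup_seminorm_apply (𝕜 := ℝ)
    (m := (k, n)) le_rfl le_rfl u x⟩

/-- The tensor product of two Schwartz functions. -/
def schwartzTensor (u : 𝓢(V, ℂ)) (v : 𝓢(W, ℂ)) : 𝓢(V × W, ℂ) where
  toFun p := u p.1 * v p.2
  smooth' := by
    have h1 := u.smooth ⊤
    have h2 := v.smooth ⊤
    exact (h1.comp contDiff_fst).mul (h2.comp contDiff_snd)
  decay' := by
    intro k n
    have h1 : ContDiff ℝ ∞ u := u.smooth ⊤
    have h2 : ContDiff ℝ ∞ v := v.smooth ⊤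
    choose C hC0 hC using fun i => exists_one_add_norm_pow_mul_norm_iteratedFDeriv_le u k i
    choose D hD0 hD using fun i => exists_one_add_norm_pow_mul_norm_iteratedFDeriv_le v k i
    refine ⟨∑ i ∈ Finset.range (n + 1), (n.choose i : ℝ) * C i * D (n - i), fun p => ?_⟩
    have hb := norm_iteratedFDeriv_mul_le (h1.comp contDiff_fst) (h2.comp contDiff_snd) p
      (n := n) (mod_cast le_top)
    have e1 : ∀ i, ‖iteratedFDeriv ℝ i (u ∘ Prod.fst) p‖ ≤ ‖iteratedFDeriv ℝ i u p.1‖ := by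
      intro i
      have := norm_iteratedFDeriv_comp_clm_le h1 0 (ContinuousLinearMap.fst ℝ V W) i p
      simp only [zero_add, ContinuousLinearMap.coe_fst'] at this
      exact this.trans (mul_le_of_le_one_right (norm_nonneg _)
        (pow_le_one₀ (norm_nonneg _) (ContinuousLinearMap.norm_fst_le ℝ V W)))
    have e2 : ∀ i, ‖iteratedFDeriv ℝ i (v ∘ Prod.snd) p‖ ≤ ‖iteratedFDeriv ℝ i v p.2‖ := by
      intro i
      have := norm_iteratedFDeriv_comp_clm_le h2 0 (ContinuousLinearMap.snd ℝ V W) i p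
      simp only [zero_add, ContinuousLinearMap.coe_snd'] at this
      exact this.trans (mul_le_of_le_one_right (norm_nonneg _)
        (pow_le_one₀ (norm_nonneg _) (ContinuousLinearMap.norm_snd_le ℝ V W)))
    have hp : ‖p‖ ^ k ≤ (1 + ‖p.1‖) ^ k * (1 + ‖p.2‖) ^ k := by
      rw [← mul_pow]
      gcongr
      rw [Prod.norm_def]
      refine max_le ?_ ?_ <;> nlinarith [norm_nonneg p.1, norm_nonneg p.2]
    calc ‖p‖ ^ k * ‖iteratedFDeriv ℝ n (fun p : V × W => u p.1 * v p.2) p‖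
        ≤ ((1 + ‖p.1‖) ^ k * (1 + ‖p.2‖) ^ k) * ∑ i ∈ Finset.range (n + 1), (n.choose i : ℝ) *
            ‖iteratedFDeriv ℝ i u p.1‖ * ‖iteratedFDeriv ℝ (n - i) v p.2‖ := by
          refine mul_le_mul hp (hb.trans (Finset.sum_le_sum fun i _ => ?_)) (norm_nonneg _)
            (by positivity)
          gcongr
          · exact e1 i
          · exact e2 _
      _ ≤ _ := by
          rw [Finset.mul_sum]
          refine Finset.sum_le_sum fun i _ => ?_
          calc _ = (n.choose i : ℝ) * ((1 + ‖p.1‖) ^ k * ‖iteratedFDeriv ℝ i u p.1‖) *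
              ((1 + ‖p.2‖) ^ k * ‖iteratedFDeriv ℝ (n - i) v p.2‖) := by ring
            _ ≤ _ := by
              have := hC0 i
              gcongr
              · exact hC i _
              · exact hD _ _

@[simp] lemma schwartzTensor_apply (u : 𝓢(V, ℂ)) (v : 𝓢(W, ℂ)) (p : V × W) :
    schwartzTensor u v p = u p.1 * v p.2 := rfl

/-- The complex conjugate of a Schwartz function. -/
def schwartzConj (u : 𝓢(V, ℂ)) : 𝓢(V, ℂ) :=
  SchwartzMap.postcompCLM (𝕜 := ℝ) (Complex.conjCLE : ℂ →L[ℝ] ℂ) u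

@[simp] lemma schwartzConj_apply (u : 𝓢(V, ℂ)) (x : V) :
    schwartzConj u x = (starRingEnd ℂ) (u x) := rfl

end SchwartzTools

section Gaussian

variable {V : Type} [NormedAddCommGroup V] [InnerProductSpace ℝ V]

/-- The Gaussian `exp (-c ‖x‖²)` as a Schwartz function. -/
def schwartzGaussian (V : Type) [NormedAddCommGroup V] [InnerProductSpace ℝ V] (c : ℝ)
    (hc : 0 < c) : 𝓢(V, ℂ) where
  toFun x := (Real.exp (-c * ‖x‖ ^ 2) : ℂ)
  smooth' := by
    have : ContDiff ℝ ∞ fun x : V => Real.exp (-c * ‖x‖ ^ 2) := by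
      have := contDiff_norm_sq ℝ (E := V) (n := ∞)
      fun_prop
    exact Complex.ofRealCLM.contDiff.comp this
  decay' := by
    intro k n
    have hq : Function.HasTemperateGrowth fun x : V => -c * ‖x‖ ^ 2 := by
      fun_prop
    obtain ⟨l, D, hD0, hD⟩ := hq.norm_iteratedFDeriv_le_uniform n
    have hbound : ∀ x : V, ‖iteratedFDeriv ℝ n (fun x : V => Real.exp (-c * ‖x‖ ^ 2)) x‖
        ≤ n.factorial * Real.exp (-c * ‖x‖ ^ 2) * ((1 + D) * (1 + ‖x‖) ^ l) ^ n := by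
      intro x
      refine norm_iteratedFDeriv_comp_le (g := Real.exp) (f := fun x : V => -c * ‖x‖ ^ 2)
        (N := ∞) Real.contDiff_exp hq.1 (mod_cast le_top) x (fun i _ => ?_) (fun i h1 h2 => ?_)
      · rw [norm_iteratedFDeriv_eq_norm_iteratedDeriv, iteratedDeriv_eq_iterate,
          Real.iter_deriv_exp, Real.norm_eq_abs, Real.abs_exp]
      · refine (hD i h2 x).trans ?_
        have h3 : (1 : ℝ) ≤ (1 + D) * (1 + ‖x‖) ^ l :=
          one_le_mul_of_one_le_of_one_le (by linarith)
            (one_le_pow₀ (by linarith [norm_nonneg x]))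
        refine le_trans ?_ (le_self_pow₀ h3 (by omega))
        gcongr
        linarith
    obtain ⟨B, hB⟩ : ∃ B : ℝ, ∀ t : ℝ, 0 ≤ t → 
        t ^ k * (1 + t) ^ (l * n) * Real.exp (-c * t ^ 2) ≤ B := by
      refine ⟨(k + l * n).factorial * Real.exp (1 + 1 / (4 * c)), fun t ht => ?_⟩
      have h1 : t ^ k * (1 + t) ^ (l * n) ≤ (1 + t) ^ (k + l * n) := by
        rw [pow_add]
        gcongr
        linarith
      have h2 := Real.pow_div_factorial_le_exp (1 + t) (by linarith) (k + l * n)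
      rw [div_le_iff₀ (by positivity)] at h2
      calc _ ≤ Real.exp (1 + t) * (k + l * n).factorial * Real.exp (-c * t ^ 2) := by
            exact mul_le_mul_of_nonneg_right (h1.trans h2) (Real.exp_pos _).le
        _ = (k + l * n).factorial * Real.exp (1 + t + -c * t ^ 2) := by
            rw [Real.exp_add (1 + t)]
            ring
        _ ≤ _ := by
            refine mul_le_mul_of_nonneg_left (Real.exp_le_exp.2 ?_) (by positivity)
            have : t - c * t ^ 2 ≤ 1 / (4 * c) := by
              rw [le_div_iff₀ (by positivity)]
              nlinarith [sq_nonneg (2 * c * t - 1)]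
            linarith
    refine ⟨n.factorial * (1 + D) ^ n * B, fun x => ?_⟩
    have e : iteratedFDeriv ℝ n (fun x : V => (Real.exp (-c * ‖x‖ ^ 2) : ℂ)) x
        = iteratedFDeriv ℝ n (Complex.ofRealLI ∘ fun x : V => Real.exp (-c * ‖x‖ ^ 2)) x := rfl
    have hs : ContDiff ℝ ∞ fun x : V => Real.exp (-c * ‖x‖ ^ 2) := Real.contDiff_exp.comp hq.1
    rw [e, LinearIsometry.norm_iteratedFDeriv_comp_left _ hs.contDiffAt (mod_cast le_top)]
    calc _ ≤ ‖x‖ ^ k * (n.factorial * Real.exp (-c * ‖x‖ ^ 2) * ((1 + D) * (1 + ‖x‖) ^ l) ^ n) := by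
          gcongr
          exact hbound x
      _ = n.factorial * (1 + D) ^ n * (‖x‖ ^ k * (1 + ‖x‖) ^ (l * n) * Real.exp (-c * ‖x‖ ^ 2)) := by
          rw [mul_pow, ← pow_mul]
          ring
      _ ≤ _ := by
          gcongr
          exact hB _ (norm_nonneg x)

@[simp] lemma schwartzGaussian_apply (c : ℝ) (hc : 0 < c) (x : V) :
    schwartzGaussian V c hc x = (Real.exp (-c * ‖x‖ ^ 2) : ℂ) := rfl

end Gaussian

/-! ### Functions with bounded derivatives, and decay of Fourier integrals -/

section Decay

variable {V W : Type} [NormedAddCommGroup V] [NormedSpace ℝ V]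
  [NormedAddCommGroup W] [NormedSpace ℝ W]

/-- `a` is smooth and its derivatives up to order `N` are bounded by `M`. -/
def BddDeriv (N : ℕ) (M : ℝ) (a : V → ℂ) : Prop :=
  ContDiff ℝ ∞ a ∧ ∀ k ≤ N, ∀ x, ‖iteratedFDeriv ℝ k a x‖ ≤ M

lemma BddDeriv.norm_le {N : ℕ} {M : ℝ} {a : V → ℂ} (h : BddDeriv N M a) (x : V) : ‖a x‖ ≤ M := by
  simpa using h.2 0 (Nat.zero_le _) x

lemma BddDeriv.nonneg {N : ℕ} {M : ℝ} {a : V → ℂ} (h : BddDeriv N M a) : 0 ≤ M :=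
  (norm_nonneg _).trans (h.norm_le 0)

lemma BddDeriv.continuous {N : ℕ} {M : ℝ} {a : V → ℂ} (h : BddDeriv N M a) : Continuous a :=
  h.1.continuous

lemma BddDeriv.comp_affine {N : ℕ} {M : ℝ} {a : W → ℂ} (h : BddDeriv N M a) (w : W)
    (A : V →L[ℝ] W) (hA : ‖A‖ ≤ 1) : BddDeriv N M fun y => a (w + A y) := by
  refine ⟨h.1.comp (by fun_prop), fun k hk x => ?_⟩
  refine (norm_iteratedFDeriv_comp_clm_le h.1 w A k x).trans ?_
  exact (mul_le_of_le_one_right (norm_nonneg _) (pow_le_one₀ (norm_nonneg _) hA)).trans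
    (h.2 k hk _)

variable [FiniteDimensional ℝ V] [MeasurableSpace V] [BorelSpace V]

/-- The derivatives of the product of a function with bounded derivatives and a Schwartz function
are integrable, with uniform bounds. -/
lemma exists_integral_iteratedFDeriv_mul_le (μ : Measure V) [μ.IsAddHaarMeasure] (φ : 𝓢(V, ℂ))
    (N : ℕ) : ∃ C, 0 ≤ C ∧ ∀ (M : ℝ) (a : V → ℂ), BddDeriv N M a → ∀ k ≤ N,
      Integrable (iteratedFDeriv ℝ k fun x => a x * φ x) μ ∧
      ∫ x, ‖iteratedFDeriv ℝ k (fun x => a x * φ x) x‖ ∂μ ≤ C * M := by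
  have hInt : ∀ i, Integrable (fun x => ‖iteratedFDeriv ℝ i φ x‖) μ := fun i => by
    simpa using φ.integrable_pow_mul_iteratedFDeriv μ 0 i
  set I : ℕ → ℝ := fun i => ∫ x, ‖iteratedFDeriv ℝ i φ x‖ ∂μ
  have hI : ∀ i, 0 ≤ I i := fun i => integral_nonneg fun _ => norm_nonneg _
  refine ⟨∑ k ∈ Finset.range (N + 1), ∑ i ∈ Finset.range (k + 1), (k.choose i : ℝ) * I (k - i),
    Finset.sum_nonneg fun k _ => Finset.sum_nonneg fun i _ => by have := hI (k - i); positivity,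
    fun M a ha k hk => ?_⟩
  have hφ : ContDiff ℝ ∞ φ := φ.smooth ⊤
  have hM := ha.nonneg
  have hb : ∀ x, ‖iteratedFDeriv ℝ k (fun x => a x * φ x) x‖
      ≤ ∑ i ∈ Finset.range (k + 1), (k.choose i : ℝ) * M * ‖iteratedFDeriv ℝ (k - i) φ x‖ := by
    intro x
    refine (norm_iteratedFDeriv_mul_le ha.1 hφ x (n := k) (mod_cast le_top)).trans
      (Finset.sum_le_sum fun i hi => ?_)
    gcongr
    exact ha.2 i ((Nat.lt_succ_iff.1 (Finset.mem_range.1 hi)).trans hk) x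
  have hbi : Integrable (fun x => ∑ i ∈ Finset.range (k + 1),
      (k.choose i : ℝ) * M * ‖iteratedFDeriv ℝ (k - i) φ x‖) μ :=
    integrable_finsetSum _ fun i _ => (hInt _).const_mul _
  have hcont : Continuous (iteratedFDeriv ℝ k fun x => a x * φ x) :=
    (ha.1.mul hφ).continuous_iteratedFDeriv (mod_cast le_top)
  refine ⟨hbi.mono' hcont.aestronglyMeasurable (Filter.Eventually.of_forall hb), ?_⟩
  refine (integral_mono_of_nonneg (Filter.Eventually.of_forall fun _ => norm_nonneg _) hbi
    (Filter.Eventually.of_forall hb)).trans ?_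
  rw [integral_finsetSum _ fun i _ => (hInt _).const_mul _]
  simp only [integral_const_mul]
  calc _ = (∑ i ∈ Finset.range (k + 1), (k.choose i : ℝ) * I (k - i)) * M := by
        rw [Finset.sum_mul]
        exact Finset.sum_congr rfl fun i _ => by ring
    _ ≤ _ := by
        gcongr
        exact Finset.single_le_sum (f := fun k => ∑ i ∈ Finset.range (k + 1),
          (k.choose i : ℝ) * I (k - i)) (fun k _ => Finset.sum_nonneg fun i _ => by
            have := hI (k - i); positivity) (Finset.mem_range.2 (Nat.lt_succ_iff.2 hk))

/-- A bilinear pairing of `V` with itself bounded from below. -/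
def IsPerfect (L : V →L[ℝ] V →L[ℝ] ℝ) : Prop :=
  ∀ ξ, ∃ v, ‖v‖ ≤ 1 ∧ ‖ξ‖ ≤ |L v ξ|

lemma norm_fourierIntegral_le (μ : Measure V) [μ.IsAddHaarMeasure] {L : V →L[ℝ] V →L[ℝ] ℝ}
    (hL : IsPerfect L) {N : ℕ} {M : ℝ} {g : V → ℂ} (hg : ContDiff ℝ ∞ g)
    (hi : ∀ k ≤ N, Integrable (iteratedFDeriv ℝ k g) μ)
    (hM : ∀ k ≤ N, ∫ x, ‖iteratedFDeriv ℝ k g x‖ ∂μ ≤ M) (ξ : V) :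
    ‖∫ x, (Real.fourierChar (-(L x ξ)) : ℂ) * g x ∂μ‖ * (1 + ‖ξ‖) ^ N
      ≤ 2 ^ N * (1 + 2 ^ N * (N + 1)) * M := by
  set f := VectorFourier.fourierIntegral Real.fourierChar μ L.toLinearMap₁₂ g with hf
  have e : ∫ x, (Real.fourierChar (-(L x ξ)) : ℂ) * g x ∂μ = f ξ := by
    simp only [hf, VectorFourier.fourierIntegral, Circle.smul_def, smul_eq_mul]
    rfl
  rw [e]
  have h0 : ‖f ξ‖ ≤ M := by
    refine (VectorFourier.norm_fourierIntegral_le_integral_norm _ _ _ _ _).trans ?_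
    simpa using hM 0 (Nat.zero_le _)
  have hM0 : 0 ≤ M := (norm_nonneg _).trans h0
  obtain ⟨v, hv1, hv2⟩ := hL ξ
  have h1 := VectorFourier.pow_mul_norm_iteratedFDeriv_fourierIntegral_le (μ := μ) (K := 0)
    (N := (N : ℕ∞)) (k := 0) (n := N) L (hg.of_le (mod_cast le_top))
    (fun k n hk hn => by
      obtain rfl : k = 0 := by simpa using hk
      simpa using (hi n (by exact_mod_cast hn)).norm) le_rfl le_rfl v ξ
  have h2 : ‖ξ‖ ^ N * ‖f ξ‖ ≤ 2 ^ N * (N + 1) * M := by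
    calc ‖ξ‖ ^ N * ‖f ξ‖ ≤ |L v ξ| ^ N * ‖iteratedFDeriv ℝ 0 f ξ‖ := by
          rw [norm_iteratedFDeriv_zero]
          gcongr
      _ ≤ _ := h1
      _ ≤ 1 * 1 * 2 ^ N * ∑ p ∈ Finset.range (0 + 1) ×ˢ Finset.range (N + 1), M := by
          gcongr with p hp
          · exact pow_le_one₀ (norm_nonneg _) hv1
          · simp
          · simp
          · simp only [Finset.mem_product, Finset.mem_range] at hp
            have hp1 : p.1 = 0 := by omega
            simpa [hp1] using hM p.2 (by omega)
      _ = _ := by simp; ring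
  have h3 : (1 + ‖ξ‖) ^ N ≤ 2 ^ N * (1 + ‖ξ‖ ^ N) := by
    rcases le_total ‖ξ‖ 1 with h | h
    · calc (1 + ‖ξ‖) ^ N ≤ 2 ^ N := by gcongr; linarith
        _ ≤ _ := le_mul_of_one_le_right (by positivity) (by linarith [pow_nonneg (norm_nonneg ξ) N])
    · calc (1 + ‖ξ‖) ^ N ≤ (2 * ‖ξ‖) ^ N := by gcongr; linarith
        _ = 2 ^ N * ‖ξ‖ ^ N := mul_pow _ _ _
        _ ≤ _ := by gcongr; linarith
  calc ‖f ξ‖ * (1 + ‖ξ‖) ^ N ≤ ‖f ξ‖ * (2 ^ N * (1 + ‖ξ‖ ^ N)) := by gcongr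
    _ = 2 ^ N * (‖f ξ‖ + ‖ξ‖ ^ N * ‖f ξ‖) := by ring
    _ ≤ 2 ^ N * (M + 2 ^ N * (N + 1) * M) := by gcongr
    _ = _ := by ring

/-- Fourier integrals of `a φ`, with `φ` a Schwartz function and `a` with bounded derivatives, decay
uniformly in `a`. -/
lemma exists_norm_fourierIntegral_mul_le (μ : Measure V) [μ.IsAddHaarMeasure]
    {L : V →L[ℝ] V →L[ℝ] ℝ} (hL : IsPerfect L) (φ : 𝓢(V, ℂ)) (N : ℕ) :
    ∃ C, 0 ≤ C ∧ ∀ (M : ℝ) (a : V → ℂ), BddDeriv N M a → ∀ ξ,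
      ‖∫ x, (Real.fourierChar (-(L x ξ)) : ℂ) * (a x * φ x) ∂μ‖ * (1 + ‖ξ‖) ^ N ≤ C * M := by
  obtain ⟨C, hC0, hC⟩ := exists_integral_iteratedFDeriv_mul_le μ φ N
  refine ⟨2 ^ N * (1 + 2 ^ N * (N + 1)) * C, by positivity, fun M a ha ξ => ?_⟩
  rw [mul_assoc]
  exact norm_fourierIntegral_le μ hL (ha.1.mul (φ.smooth ⊤)) (fun k hk => (hC M a ha k hk).1)
    (fun k hk => (hC M a ha k hk).2) ξ

omit [FiniteDimensional ℝ V] [MeasurableSpace V] [BorelSpace V] in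
lemma isPerfect_innerSL {E : Type} [NormedAddCommGroup E] [InnerProductSpace ℝ E] :
    IsPerfect (innerSL ℝ : E →L[ℝ] E →L[ℝ] ℝ) := by
  intro ξ
  by_cases h : ξ = 0
  · exact ⟨0, by simp, by simp [h]⟩
  · have h' : ‖ξ‖ ≠ 0 := norm_ne_zero_iff.2 h
    refine ⟨‖ξ‖⁻¹ • ξ, ?_, ?_⟩
    · rw [norm_smul, norm_inv, norm_norm, inv_mul_cancel₀ h']
    · rw [innerSL_apply_apply, real_inner_smul_left, real_inner_self_eq_norm_sq, sq,
        inv_mul_cancel_left₀ h', abs_norm]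

/-- The pairing of `E × E` with itself. -/
def prodPairing (E : Type) [NormedAddCommGroup E] [InnerProductSpace ℝ E] :
    (E × E) →L[ℝ] (E × E) →L[ℝ] ℝ :=
  (innerSL ℝ : E →L[ℝ] E →L[ℝ] ℝ).bilinearComp (ContinuousLinearMap.fst ℝ E E)
      (ContinuousLinearMap.fst ℝ E E)
    + (innerSL ℝ : E →L[ℝ] E →L[ℝ] ℝ).bilinearComp (ContinuousLinearMap.snd ℝ E E)
      (ContinuousLinearMap.snd ℝ E E)

@[simp] lemma prodPairing_apply {E : Type} [NormedAddCommGroup E] [InnerProductSpace ℝ E]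
    (x ξ : E × E) : prodPairing E x ξ = inner ℝ x.1 ξ.1 + inner ℝ x.2 ξ.2 := rfl

lemma isPerfect_prodPairing {E : Type} [NormedAddCommGroup E] [InnerProductSpace ℝ E] :
    IsPerfect (prodPairing E) := by
  rintro ⟨ξ, η⟩
  rcases le_total ‖η‖ ‖ξ‖ with h | h
  · obtain ⟨v, h1, h2⟩ := isPerfect_innerSL ξ
    exact ⟨(v, 0), by simpa using h1, by simpa [h] using (show ‖ξ‖ ≤ |inner ℝ v ξ| from h2)⟩
  · obtain ⟨v, h1, h2⟩ := isPerfect_innerSL η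
    exact ⟨(0, v), by simpa using h1, by simpa [h] using (show ‖η‖ ≤ |inner ℝ v η| from h2)⟩

end Decay

instance isAddHaarMeasure_volume_prod {V W : Type} [NormedAddCommGroup V] [InnerProductSpace ℝ V]
    [FiniteDimensional ℝ V] [MeasurableSpace V] [BorelSpace V] [NormedAddCommGroup W]
    [InnerProductSpace ℝ W] [FiniteDimensional ℝ W] [MeasurableSpace W] [BorelSpace W] :
    (volume : Measure (V × W)).IsAddHaarMeasure :=
  inferInstanceAs ((volume : Measure V).prod (volume : Measure W)).IsAddHaarMeasure

/-! ### Fourier inversion on a product -/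

section ProdInversion

variable {V : Type} [NormedAddCommGroup V] [InnerProductSpace ℝ V] [FiniteDimensional ℝ V]
  [MeasurableSpace V] [BorelSpace V]

open Real in
lemma fourier_inversion_prod {b : V × V → ℂ} (hb : Continuous b) (hi : Integrable b)
    (hi' : Integrable fun ζ : V × V => ∫ w, (fourierChar (-(prodPairing V w ζ)) : ℂ) * b w)
    (w : V × V) :
    b w = ∫ ζ : V × V, (fourierChar (prodPairing V ζ w) : ℂ) *
      ∫ w', (fourierChar (-(prodPairing V w' ζ)) : ℂ) * b w' := by
  have hmp := WithLp.volume_preserving_ofLp V V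
  have hme : MeasurableEmbedding (WithLp.ofLp : WithLp 2 (V × V) → V × V) :=
    (MeasurableEquiv.toLp 2 (V × V)).symm.measurableEmbedding
  set f : WithLp 2 (V × V) → ℂ := fun x => b x.ofLp with hf
  have hF : ∀ ζ : WithLp 2 (V × V), FourierTransform.fourier f ζ
      = ∫ w, (fourierChar (-(prodPairing V w ζ.ofLp)) : ℂ) * b w := by
    intro ζ
    rw [Real.fourier_eq, ← hmp.integral_comp hme]
    simp only [hf, Circle.smul_def, smul_eq_mul, prodPairing_apply, WithLp.prod_inner_apply]
  have h1 : Integrable f := (hmp.integrable_comp_emb hme).2 hi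
  have h2 : Integrable (FourierTransform.fourier f) := by
    rw [show FourierTransform.fourier f = (fun ζ => ∫ w, (fourierChar (-(prodPairing V w ζ)) : ℂ) * b w)
      ∘ WithLp.ofLp from funext hF]
    exact (hmp.integrable_comp_emb hme).2 hi'
  have h3 := Continuous.fourierInv_fourier_eq (f := f)
    (hb.comp (WithLp.prod_continuous_ofLp 2 V V)) h1 h2
  have h4 := congrFun h3 (WithLp.toLp 2 w)
  rw [Real.fourierInv_eq] at h4
  simp only [hF] at h4
  rw [← hmp.integral_comp hme]
  simp only [hf, Circle.smul_def, smul_eq_mul, prodPairing_apply, WithLp.prod_inner_apply] at h4 ⊢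
  exact h4.symm

end ProdInversion

/-! ### The change of variables `(X, t) ↦ (X + t/2, X - t/2)` -/

section Midpoint

variable {V : Type} [NormedAddCommGroup V] [InnerProductSpace ℝ V] [FiniteDimensional ℝ V]
  [MeasurableSpace V] [BorelSpace V]

/-- The map `(X, t) ↦ (X + t/2, X - t/2)`. -/
def midpointEquiv (V : Type) [NormedAddCommGroup V] [InnerProductSpace ℝ V] :
    (V × V) ≃L[ℝ] (V × V) where
  toFun p := (p.1 + (1 / 2 : ℝ) • p.2, p.1 - (1 / 2 : ℝ) • p.2)
  invFun p := ((1 / 2 : ℝ) • (p.1 + p.2), p.1 - p.2)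
  map_add' p q := by ext <;> simp <;> abel
  map_smul' c p := by ext <;> simp [smul_add, smul_sub, smul_comm c]
  left_inv p := by
    ext
    · simp only; module
    · simp only; module
  right_inv p := by
    ext
    · simp only; module
    · simp only; module
  continuous_toFun := by fun_prop
  continuous_invFun := by fun_prop

omit [FiniteDimensional ℝ V] [MeasurableSpace V] [BorelSpace V] in
lemma midpointEquiv_apply (p : V × V) :
    midpointEquiv V p = (p.1 + (1 / 2 : ℝ) • p.2, p.1 - (1 / 2 : ℝ) • p.2) := rfl

lemma measurePreserving_midpointEquiv : MeasurePreserving (midpointEquiv V) := by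
  have h1 : MeasurePreserving (fun p : V × V => (p.1, p.2 + (1 / 2 : ℝ) • p.1))
      (volume.prod volume) (volume.prod volume) :=
    (MeasurePreserving.id _).skew_product (g := fun t X => X + (1 / 2 : ℝ) • t)
      (by fun_prop) (Filter.Eventually.of_forall fun t => map_add_right_eq_self _ _)
  have h2 : MeasurePreserving (fun p : V × V => (p.1, p.1 - p.2))
      (volume.prod volume) (volume.prod volume) :=
    (MeasurePreserving.id _).skew_product (g := fun x t => x - t)
      (by fun_prop) (Filter.Eventually.of_forall fun x =>
        (Measure.measurePreserving_sub_left volume x).map_eq)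
  have h3 := h2.comp (Measure.measurePreserving_swap.comp (h1.comp Measure.measurePreserving_swap))
  have h4 : (midpointEquiv V : V × V → V × V) = (fun p : V × V => (p.1, p.1 - p.2)) ∘ Prod.swap ∘
      (fun p : V × V => (p.1, p.2 + (1 / 2 : ℝ) • p.1)) ∘ Prod.swap := by
    ext p
    · simp [midpointEquiv_apply]
    · simp only [midpointEquiv_apply, Function.comp_apply, Prod.fst_swap, Prod.snd_swap]
      module
  rw [h4]
  exact h3

lemma integral_midpoint {F : V × V → ℂ} (hF : Integrable F) :
    ∫ X : V, ∫ t : V, F (X + (1 / 2 : ℝ) • t, X - (1 / 2 : ℝ) • t) = ∫ x, ∫ y, F (x, y) := by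
  have hme : MeasurableEmbedding (midpointEquiv V) :=
    (midpointEquiv V).toHomeomorph.measurableEmbedding
  have h1 : Integrable (fun p => F (midpointEquiv V p)) :=
    (measurePreserving_midpointEquiv.integrable_comp_emb hme).2 hF
  have h2 := measurePreserving_midpointEquiv.integral_comp hme F
  rw [Measure.volume_eq_prod] at h1 h2 hF
  rw [integral_prod _ h1, integral_prod _ hF] at h2
  exact h2

end Midpoint

/-! ### Weyl quantization of symbols with bounded derivatives -/

section Weyl

variable {V : Type} [NormedAddCommGroup V] [InnerProductSpace ℝ V] [FiniteDimensional ℝ V]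
  [MeasurableSpace V] [BorelSpace V]

open Real (fourierChar)

lemma integrable_inv_one_add_norm_pow {E : Type} [NormedAddCommGroup E] [NormedSpace ℝ E]
    [FiniteDimensional ℝ E] [MeasurableSpace E] [BorelSpace E] (μ : Measure E)
    [μ.IsAddHaarMeasure] {N : ℕ} (hN : Module.finrank ℝ E < N) :
    Integrable (fun ξ : E => ((1 + ‖ξ‖) ^ N)⁻¹) μ := by
  have := integrable_one_add_norm (E := E) (μ := μ) (r := N) (by exact_mod_cast hN)
  refine this.congr (Filter.Eventually.of_forall fun ξ => ?_)
  simp only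
  rw [Real.rpow_neg (by positivity), Real.rpow_natCast]

/-- The inner integral in the Weyl quantization with Planck constant `2πħ = 1`. -/
def weylInner (a : V × V → ℂ) (u : V → ℂ) (x ξ : V) : ℂ :=
  ∫ y, (fourierChar (inner ℝ (x - y) ξ) : ℂ) * (a ((1 / 2 : ℝ) • (x + y), ξ) * u y)

/-- The Weyl quantization with Planck constant `2πħ = 1`. -/
def weylOp (a : V × V → ℂ) (u : V → ℂ) (x : V) : ℂ := ∫ ξ, weylInner a u x ξ

omit [FiniteDimensional ℝ V] [MeasurableSpace V] [BorelSpace V] in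
lemma BddDeriv.comp_midpoint {N : ℕ} {M : ℝ} {a : V × V → ℂ} (ha : BddDeriv N M a) (x ξ : V) :
    BddDeriv N M fun y => a ((1 / 2 : ℝ) • (x + y), ξ) := by
  have hA : ‖(ContinuousLinearMap.inl ℝ V V).comp ((1 / 2 : ℝ) • ContinuousLinearMap.id ℝ V)‖
      ≤ 1 := by
    refine ContinuousLinearMap.opNorm_le_bound _ zero_le_one fun y => ?_
    simp only [ContinuousLinearMap.comp_apply, smul_apply,
      ContinuousLinearMap.id_apply, ContinuousLinearMap.inl_apply, Prod.norm_mk, norm_zero]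
    rw [norm_smul, max_eq_left (by positivity)]
    norm_num
    linarith [norm_nonneg y]
  convert ha.comp_affine ((1 / 2 : ℝ) • x, ξ) _ hA using 3 with y
  simp [smul_add]

lemma exists_norm_weylInner_le (u : 𝓢(V, ℂ)) (N : ℕ) :
    ∃ C, 0 ≤ C ∧ ∀ (M : ℝ) (a : V × V → ℂ), BddDeriv N M a → ∀ x ξ,
      ‖weylInner a u x ξ‖ ≤ C * M * ((1 + ‖ξ‖) ^ N)⁻¹ := by
  obtain ⟨C, hC0, hC⟩ := exists_norm_fourierIntegral_mul_le volume (isPerfect_innerSL (E := V)) u N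
  refine ⟨C, hC0, fun M a ha x ξ => ?_⟩
  have h := hC M _ (ha.comp_midpoint x ξ) ξ
  have e : weylInner a u x ξ = (fourierChar (inner ℝ x ξ) : ℂ) *
      ∫ y, (fourierChar (-(innerSL ℝ y ξ)) : ℂ) * (a ((1 / 2 : ℝ) • (x + y), ξ) * u y) := by
    rw [weylInner, ← integral_const_mul]
    congr 1
    ext y
    rw [inner_sub_left, sub_eq_add_neg, AddChar.map_add_eq_mul, Circle.coe_mul, innerSL_apply_apply,
      mul_assoc]
  rw [e, norm_mul, Circle.norm_coe, one_mul, ← div_eq_mul_inv, le_div_iff₀ (by positivity)]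
  exact h

lemma continuous_weylInner {N : ℕ} {M : ℝ} {a : V × V → ℂ} (ha : BddDeriv N M a) (u : 𝓢(V, ℂ)) :
    Continuous fun p : V × V => weylInner a u p.1 p.2 := by
  have hac := ha.continuous
  refine continuous_of_dominated (bound := fun y => M * ‖u y‖) (fun p => ?_) (fun p => ?_)
    (u.integrable.norm.const_mul M) (Filter.Eventually.of_forall fun y => ?_)
  · exact Continuous.aestronglyMeasurable (by fun_prop)
  · refine Filter.Eventually.of_forall fun y => ?_
    rw [norm_mul, Circle.norm_coe, one_mul, norm_mul]
    gcongr
    exact ha.norm_le _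
  · fun_prop

lemma integrable_weylInner {N : ℕ} {M : ℝ} {a : V × V → ℂ} (ha : BddDeriv N M a)
    (hN : Module.finrank ℝ V < N) (u : 𝓢(V, ℂ)) (x : V) :
    Integrable fun ξ => weylInner a u x ξ := by
  obtain ⟨C, -, hC⟩ := exists_norm_weylInner_le u N
  exact ((integrable_inv_one_add_norm_pow volume hN).const_mul (C * M)).mono'
    ((continuous_weylInner ha u).comp (by fun_prop : Continuous fun ξ : V => (x, ξ))).aestronglyMeasurable
    (Filter.Eventually.of_forall fun ξ => hC M a ha x ξ)

lemma continuous_weylOp {N : ℕ} {M : ℝ} {a : V × V → ℂ} (ha : BddDeriv N M a)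
    (hN : Module.finrank ℝ V < N) (u : 𝓢(V, ℂ)) : Continuous (weylOp a u) := by
  obtain ⟨C, -, hC⟩ := exists_norm_weylInner_le u N
  refine continuous_of_dominated (fun x => (integrable_weylInner ha hN u x).aestronglyMeasurable)
    (fun x => Filter.Eventually.of_forall fun ξ => hC M a ha x ξ)
    ((integrable_inv_one_add_norm_pow volume hN).const_mul (C * M))
    (Filter.Eventually.of_forall fun ξ =>
      (continuous_weylInner ha u).comp (by fun_prop : Continuous fun x : V => (x, ξ)))

lemma exists_norm_weylOp_le {N : ℕ} {M : ℝ} {a : V × V → ℂ} (ha : BddDeriv N M a)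
    (hN : Module.finrank ℝ V < N) (u : 𝓢(V, ℂ)) : ∃ B, ∀ x, ‖weylOp a u x‖ ≤ B := by
  obtain ⟨C, -, hC⟩ := exists_norm_weylInner_le u N
  exact ⟨_, fun x => norm_integral_le_of_norm_le
    ((integrable_inv_one_add_norm_pow volume hN).const_mul (C * M))
    (Filter.Eventually.of_forall fun ξ => hC M a ha x ξ)⟩

/-- `(X, t) ↦ conj v(X + t/2) u(X - t/2)`. -/
def wignerKernel (u v : 𝓢(V, ℂ)) : 𝓢(V × V, ℂ) :=
  SchwartzMap.compCLMOfContinuousLinearEquiv ℝ (midpointEquiv V)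
    (schwartzTensor (schwartzConj v) u)

omit [FiniteDimensional ℝ V] [MeasurableSpace V] [BorelSpace V] in
lemma wignerKernel_apply (u v : 𝓢(V, ℂ)) (X t : V) : wignerKernel u v (X, t)
    = (starRingEnd ℂ) (v (X + (1 / 2 : ℝ) • t)) * u (X - (1 / 2 : ℝ) • t) := rfl

/-- The Wigner transform. -/
def wigner (u v : 𝓢(V, ℂ)) (w : V × V) : ℂ :=
  ∫ t, (fourierChar (inner ℝ t w.2) : ℂ) * wignerKernel u v (w.1, t)

omit [FiniteDimensional ℝ V] [MeasurableSpace V] [BorelSpace V] in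
/-- Separated decay of a Schwartz function of two variables. -/
lemma exists_norm_iteratedFDeriv_snd_le {U : Type} [NormedAddCommGroup U] [NormedSpace ℝ U]
    (Φ : 𝓢(U × V, ℂ)) (K n : ℕ) : ∃ C, 0 ≤ C ∧ ∀ X t,
      ‖iteratedFDeriv ℝ n (fun t => Φ (X, t)) t‖ ≤ C * ((1 + ‖X‖) ^ K)⁻¹ * ((1 + ‖t‖) ^ K)⁻¹ := by
  obtain ⟨C, hC0, hC⟩ := exists_one_add_norm_pow_mul_norm_iteratedFDeriv_le Φ (K + K) n
  refine ⟨C, hC0, fun X t => ?_⟩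
  have h1 := norm_iteratedFDeriv_comp_clm_le (Φ.smooth ⊤) (X, 0) (ContinuousLinearMap.inr ℝ U V) n t
  simp only [ContinuousLinearMap.inr_apply, Prod.mk_add_mk, add_zero, zero_add] at h1
  have h2 : ‖iteratedFDeriv ℝ n (fun t => Φ (X, t)) t‖ ≤ ‖iteratedFDeriv ℝ n Φ (X, t)‖ :=
    h1.trans (mul_le_of_le_one_right (norm_nonneg _)
      (pow_le_one₀ (norm_nonneg _) (ContinuousLinearMap.norm_inr_le_one ℝ U V)))
  have h3 : (1 + ‖X‖) ^ K * (1 + ‖t‖) ^ K ≤ (1 + ‖(X, t)‖) ^ (K + K) := by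
    rw [pow_add]
    gcongr
    · exact norm_fst_le (X, t)
    · exact norm_snd_le (X, t)
  rw [mul_assoc, ← mul_inv, ← div_eq_mul_inv, le_div_iff₀ (by positivity), mul_comm]
  exact (mul_le_mul h3 h2 (norm_nonneg _) (by positivity)).trans (hC _)

/-- Decay of the partial Fourier transform of a Schwartz function of two variables. -/
lemma exists_norm_partialFourier_le {U : Type} [NormedAddCommGroup U] [NormedSpace ℝ U]
    (Φ : 𝓢(U × V, ℂ)) (N : ℕ) : ∃ C, 0 ≤ C ∧ ∀ X ξ,
      ‖∫ t, (fourierChar (-(inner ℝ t ξ)) : ℂ) * Φ (X, t)‖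
        ≤ C * ((1 + ‖X‖) ^ N)⁻¹ * ((1 + ‖ξ‖) ^ N)⁻¹ := by
  set K := N + Module.finrank ℝ V + 1
  have hK : Module.finrank ℝ V < K := by omega
  choose C hC0 hC using fun n => exists_norm_iteratedFDeriv_snd_le Φ K n
  set I := ∫ t : V, ((1 + ‖t‖) ^ K)⁻¹
  have hI : 0 ≤ I := integral_nonneg fun t => by positivity
  set S := ∑ n ∈ Finset.range (N + 1), C n
  have hS : ∀ n ≤ N, C n ≤ S := fun n hn => Finset.single_le_sum (f := C) (fun n _ => hC0 n)
    (Finset.mem_range.2 (Nat.lt_succ_iff.2 hn))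
  have hS0 : 0 ≤ S := (hC0 0).trans (hS 0 (Nat.zero_le _))
  refine ⟨2 ^ N * (1 + 2 ^ N * (N + 1)) * (S * I), by positivity, fun X ξ => ?_⟩
  have hsm : ContDiff ℝ ∞ fun t => Φ (X, t) := (Φ.smooth ⊤).comp (by fun_prop)
  have hInt := (integrable_inv_one_add_norm_pow (volume : Measure V) hK).const_mul
    (S * ((1 + ‖X‖) ^ N)⁻¹)
  have hb : ∀ n ≤ N, ∀ t, ‖iteratedFDeriv ℝ n (fun t => Φ (X, t)) t‖
      ≤ S * ((1 + ‖X‖) ^ N)⁻¹ * ((1 + ‖t‖) ^ K)⁻¹ := by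
    intro n hn t
    refine (hC n X t).trans ?_
    gcongr
    · exact hS n hn
    · linarith [norm_nonneg X]
    · omega
  have h := norm_fourierIntegral_le volume (isPerfect_innerSL (E := V)) (N := N)
    (M := S * ((1 + ‖X‖) ^ N)⁻¹ * I) hsm
    (fun n hn => hInt.mono' (hsm.continuous_iteratedFDeriv (mod_cast le_top)).aestronglyMeasurable
      (Filter.Eventually.of_forall (hb n hn)))
    (fun n hn => (integral_mono_of_nonneg (Filter.Eventually.of_forall fun _ => norm_nonneg _) hInt
      (Filter.Eventually.of_forall (hb n hn))).trans_eq (integral_const_mul _ _)) ξ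
  rw [← div_eq_mul_inv, le_div_iff₀ (by positivity)]
  refine (le_of_eq_of_le ?_ h).trans_eq (by ring)
  rfl

lemma exists_norm_wigner_le (u v : 𝓢(V, ℂ)) (N : ℕ) : ∃ C, 0 ≤ C ∧ ∀ w : V × V,
    ‖wigner u v w‖ ≤ C * (((1 + ‖w.1‖) ^ N)⁻¹ * ((1 + ‖w.2‖) ^ N)⁻¹) := by
  obtain ⟨C, hC0, hC⟩ := exists_norm_partialFourier_le (wignerKernel u v) N
  refine ⟨C, hC0, fun w => ?_⟩
  have := hC w.1 (-w.2)
  simp only [inner_neg_right, neg_neg, norm_neg, mul_assoc] at this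
  exact this

lemma integrable_schwartz_snd {U : Type} [NormedAddCommGroup U] [NormedSpace ℝ U]
    (Φ : 𝓢(U × V, ℂ)) (X : U) : Integrable fun t => Φ (X, t) := by
  obtain ⟨C, hC0, hC⟩ := exists_norm_iteratedFDeriv_snd_le Φ (Module.finrank ℝ V + 1) 0
  have hc : Continuous fun t => Φ (X, t) := Φ.continuous.comp (by fun_prop)
  refine ((integrable_inv_one_add_norm_pow (volume : Measure V)
    (Nat.lt_succ_self _)).const_mul (C * ((1 + ‖X‖) ^ (Module.finrank ℝ V + 1))⁻¹)).mono'
    hc.aestronglyMeasurable (Filter.Eventually.of_forall fun t => ?_)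
  simpa using hC X t

lemma continuous_wigner (u v : 𝓢(V, ℂ)) : Continuous (wigner u v) := by
  obtain ⟨C, hC0, hC⟩ := exists_norm_iteratedFDeriv_snd_le (wignerKernel u v)
    (Module.finrank ℝ V + 1) 0
  have hc := (wignerKernel u v).continuous
  refine continuous_of_dominated (bound := fun t => C * ((1 + ‖t‖) ^ (Module.finrank ℝ V + 1))⁻¹)
    (fun w => Continuous.aestronglyMeasurable (by fun_prop))
    (fun w => Filter.Eventually.of_forall fun t => ?_)
    ((integrable_inv_one_add_norm_pow (volume : Measure V) (Nat.lt_succ_self _)).const_mul C)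
    (Filter.Eventually.of_forall fun t => by fun_prop)
  rw [norm_mul, Circle.norm_coe, one_mul]
  have h := hC w.1 t
  rw [norm_iteratedFDeriv_zero] at h
  refine h.trans ?_
  gcongr
  refine mul_le_of_le_one_right hC0 (inv_le_one_of_one_le₀ (one_le_pow₀ ?_))
  linarith [norm_nonneg w.1]

lemma integrable_wigner (u v : 𝓢(V, ℂ)) : Integrable (wigner u v) := by
  obtain ⟨C, hC0, hC⟩ := exists_norm_wigner_le u v (Module.finrank ℝ V + 1)
  have h := integrable_inv_one_add_norm_pow (volume : Measure V)
    (Nat.lt_succ_self (Module.finrank ℝ V))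
  exact ((h.mul_prod h).const_mul C).mono' (continuous_wigner u v).aestronglyMeasurable
    (Filter.Eventually.of_forall hC)

/-- The matrix elements of a Weyl operator are integrals of the symbol against the Wigner
transform. -/
lemma integral_conj_mul_weylOp {N : ℕ} {M : ℝ} {a : V × V → ℂ} (ha : BddDeriv N M a)
    (hN : Module.finrank ℝ V < N) (u v : 𝓢(V, ℂ)) :
    ∫ x, (starRingEnd ℂ) (v x) * weylOp a u x = ∫ w, a w * wigner u v w := by
  obtain ⟨C, hC0, hC⟩ := exists_norm_weylInner_le u N
  have hac := ha.continuous
  have hvc := v.continuous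
  have huc := u.continuous
  have hwc := continuous_weylInner ha u
  have hint1 : Integrable (fun p : V × V => (starRingEnd ℂ) (v p.1) * weylInner a u p.1 p.2)
      (volume.prod volume) := by
    have h := (v.integrable (μ := volume)).norm.mul_prod
      ((integrable_inv_one_add_norm_pow volume hN).const_mul (C * M))
    refine h.mono' (Continuous.aestronglyMeasurable ?_) (Filter.Eventually.of_forall fun p => ?_)
    · exact (Complex.continuous_conj.comp (hvc.comp continuous_fst)).mul hwc
    · rw [norm_mul, RCLike.norm_conj]
      gcongr
      exact hC M a ha _ _
  have hint2 : Integrable (fun w => a w * wigner u v w) (volume.prod volume) :=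
    (integrable_wigner u v).bdd_mul (c := M) hac.aestronglyMeasurable
      (Filter.Eventually.of_forall fun w => ha.norm_le w)
  calc ∫ x, (starRingEnd ℂ) (v x) * weylOp a u x
      = ∫ x, ∫ ξ, (starRingEnd ℂ) (v x) * weylInner a u x ξ := by
        simp only [weylOp, integral_const_mul]
    _ = ∫ ξ, ∫ x, (starRingEnd ℂ) (v x) * weylInner a u x ξ := integral_integral_swap hint1
    _ = ∫ ξ, ∫ X, a (X, ξ) * wigner u v (X, ξ) := by
        congr 1
        ext ξ
        set F : V × V → ℂ := fun p => ((fourierChar (inner ℝ (p.1 - p.2) ξ) : ℂ) *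
          a ((1 / 2 : ℝ) • (p.1 + p.2), ξ)) * schwartzTensor (schwartzConj v) u p with hF
        have hFi : Integrable F := by
          refine (schwartzTensor (schwartzConj v) u).integrable.bdd_mul (c := M)
            (Continuous.aestronglyMeasurable (by fun_prop)) (Filter.Eventually.of_forall fun p => ?_)
          rw [norm_mul, Circle.norm_coe, one_mul]
          exact ha.norm_le _
        calc ∫ x, (starRingEnd ℂ) (v x) * weylInner a u x ξ = ∫ x, ∫ y, F (x, y) := by
              congr 1
              ext x
              rw [weylInner, ← integral_const_mul]
              congr 1
              ext y
              simp only [hF, schwartzTensor_apply, schwartzConj_apply]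
              ring
          _ = ∫ X : V, ∫ t : V, F (X + (1 / 2 : ℝ) • t, X - (1 / 2 : ℝ) • t) :=
              (integral_midpoint hFi).symm
          _ = _ := by
              congr 1
              ext X
              rw [wigner, ← integral_const_mul]
              congr 1
              ext t
              have e1 : X + (1 / 2 : ℝ) • t - (X - (1 / 2 : ℝ) • t) = t := by module
              have e2 : (1 / 2 : ℝ) • (X + (1 / 2 : ℝ) • t + (X - (1 / 2 : ℝ) • t)) = X := by module
              simp only [hF, schwartzTensor_apply, schwartzConj_apply, e1, e2, wignerKernel_apply]
              ring
    _ = ∫ w, a w * wigner u v w := (integral_prod_symm _ hint2).symm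

lemma conj_wigner (u v : 𝓢(V, ℂ)) (w : V × V) :
    (starRingEnd ℂ) (wigner u v w) = wigner v u w := by
  rw [wigner, ← integral_conj, ← integral_neg_eq_self, wigner]
  congr 1
  ext t
  rw [map_mul, wignerKernel_apply, wignerKernel_apply, inner_neg_left, ← Circle.coe_inv_eq_conj,
    ← AddChar.map_neg_eq_inv, neg_neg, map_mul, smul_neg, ← sub_eq_add_neg, sub_neg_eq_add,
    Complex.conj_conj, mul_comm (v _)]

end Weyl

/-! ### The Gaussian short-time Fourier transform -/

section Stft

variable {V : Type} [NormedAddCommGroup V] [InnerProductSpace ℝ V] [FiniteDimensional ℝ V]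
  [MeasurableSpace V] [BorelSpace V]

open Real (fourierChar)

/-- The Gaussian `exp (-π ‖x‖²)`. -/
def window (V : Type) [NormedAddCommGroup V] [InnerProductSpace ℝ V] : 𝓢(V, ℂ) :=
  schwartzGaussian V Real.pi Real.pi_pos

/-- The Gaussian `exp (-2π ‖w‖²)` on the phase space. -/
def phaseWindow (V : Type) [NormedAddCommGroup V] [InnerProductSpace ℝ V] : 𝓢(V × V, ℂ) :=
  schwartzTensor (schwartzGaussian V (2 * Real.pi) Real.two_pi_pos)
    (schwartzGaussian V (2 * Real.pi) Real.two_pi_pos)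

/-- The Gaussian short-time Fourier transform. -/
def stft (u : 𝓢(V, ℂ)) (z : V × V) : ℂ :=
  ∫ y, (fourierChar (-(inner ℝ y z.2)) : ℂ) * (window V (y - z.1) * u y)

omit [FiniteDimensional ℝ V] [MeasurableSpace V] [BorelSpace V] in
lemma norm_window_le (x : V) : ‖window V x‖ ≤ 1 := by
  rw [window, schwartzGaussian_apply, Complex.norm_real, Real.norm_eq_abs, Real.abs_exp,
    Real.exp_le_one_iff]
  have := Real.pi_pos
  have : 0 ≤ Real.pi * ‖x‖ ^ 2 := by positivity
  linarith

omit [FiniteDimensional ℝ V] [MeasurableSpace V] [BorelSpace V] in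
lemma norm_phaseWindow_le (w : V × V) : ‖phaseWindow V w‖ ≤ 1 := by
  have h : ∀ x : V, ‖schwartzGaussian V (2 * Real.pi) Real.two_pi_pos x‖ ≤ 1 := fun x => by
    rw [schwartzGaussian_apply, Complex.norm_real, Real.norm_eq_abs, Real.abs_exp,
      Real.exp_le_one_iff]
    have := Real.pi_pos
    have : 0 ≤ 2 * Real.pi * ‖x‖ ^ 2 := by positivity
    linarith
  rw [phaseWindow, schwartzTensor_apply, norm_mul]
  exact mul_le_one₀ (h _) (norm_nonneg _) (h _)

lemma continuous_stft (u : 𝓢(V, ℂ)) : Continuous (stft u) := by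
  have huc := u.continuous
  have hgc := (window V).continuous
  refine continuous_of_dominated (bound := fun y => ‖u y‖)
    (fun z => Continuous.aestronglyMeasurable (by fun_prop))
    (fun z => Filter.Eventually.of_forall fun y => ?_) u.integrable.norm
    (Filter.Eventually.of_forall fun y => by fun_prop)
  rw [norm_mul, Circle.norm_coe, one_mul, norm_mul]
  exact mul_le_of_le_one_left (norm_nonneg _) (norm_window_le _)

lemma lintegral_enorm_fourier_sq (f : 𝓢(V, ℂ)) :
    ∫⁻ p, ‖∫ y, (fourierChar (-(inner ℝ y p)) : ℂ) * f y‖ₑ ^ (2 : ℝ) = ∫⁻ y, ‖f y‖ₑ ^ (2 : ℝ) := by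
  have h := SchwartzMap.integral_norm_sq_fourier f
  have e : ∀ g : 𝓢(V, ℂ), ∫⁻ y, ‖g y‖ₑ ^ (2 : ℝ) = ENNReal.ofReal (∫ y, ‖g y‖ ^ 2) := by
    intro g
    rw [ofReal_integral_eq_lintegral_ofReal]
    · congr 1
      ext y
      rw [ENNReal.ofReal_pow (norm_nonneg _), ofReal_norm]
      norm_cast
    · have := (g.memLp 2 volume).integrable_norm_rpow (by norm_num) (by norm_num)
      simpa using this
    · exact Filter.Eventually.of_forall fun _ => by positivity
  rw [e, ← h, ← e]
  rfl

lemma lintegral_enorm_stft_sq (u : 𝓢(V, ℂ)) :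
    ∫⁻ z, ‖stft u z‖ₑ ^ (2 : ℝ)
      = (∫⁻ x, ‖window V x‖ₑ ^ (2 : ℝ)) * ∫⁻ y, ‖u y‖ₑ ^ (2 : ℝ) := by
  have hgc := (window V).continuous
  have huc := u.continuous
  rw [Measure.volume_eq_prod, lintegral_prod _
    (((continuous_stft u).measurable.enorm.pow_const _).aemeasurable)]
  have h1 : ∀ q, ∫⁻ p, ‖stft u (q, p)‖ₑ ^ (2 : ℝ)
      = ∫⁻ y, ‖window V (y - q)‖ₑ ^ (2 : ℝ) * ‖u y‖ₑ ^ (2 : ℝ) := by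
    intro q
    have := lintegral_enorm_fourier_sq (SchwartzMap.pairing (ContinuousLinearMap.mul ℂ ℂ)
      (SchwartzMap.compSubConstCLM ℂ q (window V)) u)
    simp only [SchwartzMap.pairing_apply_apply, ContinuousLinearMap.mul_apply',
      SchwartzMap.compSubConstCLM_apply, enorm_mul] at this
    simp only [ENNReal.mul_rpow_of_nonneg _ _ zero_le_two] at this
    exact this
  simp only [h1]
  rw [lintegral_lintegral_swap]
  · rw [← lintegral_const_mul' _ _ ?_]
    · congr 1
      ext y
      rw [lintegral_mul_const' _ _ (by simp)]
      congr 1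
      exact lintegral_sub_left_eq_self (fun x => ‖window V x‖ₑ ^ (2 : ℝ)) y
    · have := (window V).memLp 2 volume
      have := this.eLpNorm_lt_top
      rw [eLpNorm_lt_top_iff_lintegral_rpow_enorm_lt_top (by norm_num) (by norm_num)] at this
      simpa using this.ne
  · have hm : Measurable (Function.uncurry fun q y : V =>
        ‖window V (y - q)‖ₑ ^ (2 : ℝ) * ‖u y‖ₑ ^ (2 : ℝ)) := by
      have h1 : Continuous fun p : V × V => window V (p.2 - p.1) := by fun_prop
      have h2 : Continuous fun p : V × V => u p.2 := by fun_prop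
      exact (h1.measurable.enorm.pow_const _).mul (h2.measurable.enorm.pow_const _)
    exact hm.aemeasurable

/-- The Fourier transform of the Gaussian `exp (-2π ‖x‖²)` at `0`. -/
def gaussConst (V : Type) [NormedAddCommGroup V] [InnerProductSpace ℝ V] : ℝ :=
  (1 / 2 : ℝ) ^ ((Module.finrank ℝ V : ℝ) / 2)

omit [FiniteDimensional ℝ V] [MeasurableSpace V] [BorelSpace V] in
lemma gaussConst_pos : 0 < gaussConst V := Real.rpow_pos_of_pos (by norm_num) _

lemma integral_fourierChar_gaussian (s p : V) :
    ∫ ξ : V, (fourierChar (inner ℝ s ξ) : ℂ) * schwartzGaussian V (2 * Real.pi) Real.two_pi_pos (ξ - p)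
      = (fourierChar (inner ℝ s p) : ℂ) *
        (gaussConst V * (Real.exp (-(Real.pi / 2) * ‖s‖ ^ 2) : ℂ)) := by
  have h := fourier_gaussian_innerProductSpace (V := V) (b := 2 * Real.pi)
    (by simp [Real.pi_pos]) (-s)
  rw [Real.fourier_eq] at h
  have e1 : ((Real.pi : ℂ) / (2 * Real.pi)) ^ ((Module.finrank ℝ V : ℂ) / 2)
      = (gaussConst V : ℂ) := by
    rw [gaussConst, Complex.ofReal_cpow (by norm_num)]
    have : (Real.pi : ℂ) ≠ 0 := by exact_mod_cast Real.pi_ne_zero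
    push_cast
    congr 1
    field_simp
  have e2 : Complex.exp (-(Real.pi : ℂ) ^ 2 * (‖(-s)‖ : ℂ) ^ 2 / (2 * Real.pi))
      = (Real.exp (-(Real.pi / 2) * ‖s‖ ^ 2) : ℂ) := by
    rw [norm_neg]
    push_cast
    congr 1
    have : (Real.pi : ℂ) ≠ 0 := by exact_mod_cast Real.pi_ne_zero
    field_simp
  rw [e1, e2] at h
  rw [← h, ← integral_const_mul, ← integral_add_right_eq_self _ p]
  congr 1
  ext ξ
  rw [inner_add_right, AddChar.map_add_eq_mul, Circle.coe_mul, add_sub_cancel_right,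
    schwartzGaussian_apply, inner_neg_right, neg_neg, Circle.smul_def, smul_eq_mul,
    real_inner_comm s ξ]
  push_cast
  ring

omit [FiniteDimensional ℝ V] [MeasurableSpace V] [BorelSpace V] in
lemma window_mul_window (X t q c : V) :
    window V (X + (1 / 2 : ℝ) • t - (q - (1 / 2 : ℝ) • c)) *
      window V (X - (1 / 2 : ℝ) • t - (q + (1 / 2 : ℝ) • c))
    = schwartzGaussian V (2 * Real.pi) Real.two_pi_pos (X - q) *
      (Real.exp (-(Real.pi / 2) * ‖t + c‖ ^ 2) : ℂ) := by
  simp only [window, schwartzGaussian_apply]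
  rw [← Complex.ofReal_mul, ← Complex.ofReal_mul, ← Real.exp_add, ← Real.exp_add]
  congr 2
  have e1 : X + (1 / 2 : ℝ) • t - (q - (1 / 2 : ℝ) • c) = (X - q) + (1 / 2 : ℝ) • (t + c) := by
    module
  have e2 : X - (1 / 2 : ℝ) • t - (q + (1 / 2 : ℝ) • c) = (X - q) - (1 / 2 : ℝ) • (t + c) := by
    module
  have h := parallelogram_law_with_norm ℝ (X - q) ((1 / 2 : ℝ) • (t + c))
  have h3 : ‖(1 / 2 : ℝ) • (t + c)‖ = 1 / 2 * ‖t + c‖ := by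
    rw [norm_smul]; norm_num
  rw [e1, e2]
  rw [h3] at h
  linear_combination (-Real.pi) * h

/-- Modulated phase space Gaussians are symbols of rank one operators. -/
lemma integral_phaseWindow_mul_wigner (u v : 𝓢(V, ℂ)) (z ζ : V × V) :
    ∫ w, (fourierChar (prodPairing V ζ w) : ℂ) * (phaseWindow V (w - z) * wigner u v w)
      = gaussConst V * (fourierChar (inner ℝ z.2 ζ.2) : ℂ) *
        (stft u (z.1 + (1 / 2 : ℝ) • ζ.2, z.2 - (1 / 2 : ℝ) • ζ.1) *
          (starRingEnd ℂ) (stft v (z.1 - (1 / 2 : ℝ) • ζ.2, z.2 + (1 / 2 : ℝ) • ζ.1))) := by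
  obtain ⟨q, p⟩ := z
  obtain ⟨b, c⟩ := ζ
  set γ := schwartzGaussian V (2 * Real.pi) Real.two_pi_pos with hγ
  have hγc := γ.continuous
  have hgc := (window V).continuous
  have huc := u.continuous
  have hvc := v.continuous
  have hpc := (phaseWindow V).continuous
  have hΦc := (wignerKernel u v).continuous
  have hcc : Continuous fun w : V × V => prodPairing V (b, c) w := (prodPairing V (b, c)).continuous
  have hInt : Integrable (fun w => (fourierChar (prodPairing V (b, c) w) : ℂ) *
      (phaseWindow V (w - (q, p)) * wigner u v w)) (volume.prod volume) := by
    simp only [← mul_assoc]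
    refine (integrable_wigner u v).bdd_mul (c := 1) (Continuous.aestronglyMeasurable (by fun_prop))
      (Filter.Eventually.of_forall fun w => ?_)
    rw [norm_mul, Circle.norm_coe, one_mul]
    exact norm_phaseWindow_le _
  have hFint : ∀ (f : 𝓢(V, ℂ)) (s r : V), Integrable fun x =>
      (fourierChar (inner ℝ x s) : ℂ) * (window V (x - r) * f x) := by
    intro f s r
    have hfc := f.continuous
    simp only [← mul_assoc]
    refine f.integrable.bdd_mul (c := 1) (Continuous.aestronglyMeasurable (by fun_prop))
      (Filter.Eventually.of_forall fun w => ?_)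
    rw [norm_mul, Circle.norm_coe, one_mul]
    exact norm_window_le _
  -- the kernel of the rank one operator
  set F : V × V → ℂ := fun r => ((fourierChar (inner ℝ r.1 (p + (1 / 2 : ℝ) • b)) : ℂ) *
      (window V (r.1 - (q - (1 / 2 : ℝ) • c)) * schwartzConj v r.1)) *
    ((fourierChar (inner ℝ r.2 (-(p - (1 / 2 : ℝ) • b))) : ℂ) *
      (window V (r.2 - (q + (1 / 2 : ℝ) • c)) * u r.2)) with hF
  have hFi : Integrable F := (hFint (schwartzConj v) _ _).mul_prod (hFint u _ _)
  have hconj : ∀ x : V, (starRingEnd ℂ) (window V x) = window V x := fun x => by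
    rw [window, schwartzGaussian_apply, Complex.conj_ofReal]
  have hprod : ∫ x, ∫ y, F (x, y) = stft u (q + (1 / 2 : ℝ) • c, p - (1 / 2 : ℝ) • b) *
      (starRingEnd ℂ) (stft v (q - (1 / 2 : ℝ) • c, p + (1 / 2 : ℝ) • b)) := by
    simp only [hF, integral_const_mul, integral_mul_const]
    rw [mul_comm]
    congr 1
    · rw [stft]
      simp only [inner_neg_right]
    · rw [stft, ← integral_conj]
      congr 1
      ext x
      simp only [map_mul, hconj, schwartzConj_apply]
      rw [← Circle.coe_inv_eq_conj, ← AddChar.map_neg_eq_inv, neg_neg]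
  calc ∫ w, (fourierChar (prodPairing V (b, c) w) : ℂ) * (phaseWindow V (w - (q, p)) * wigner u v w)
      = ∫ X, ∫ ξ, (fourierChar (prodPairing V (b, c) (X, ξ)) : ℂ) *
          (phaseWindow V ((X, ξ) - (q, p)) * wigner u v (X, ξ)) := integral_prod _ hInt
    _ = ∫ X, ∫ t, (gaussConst V * (fourierChar (inner ℝ p c) : ℂ)) *
          F (X + (1 / 2 : ℝ) • t, X - (1 / 2 : ℝ) • t) := by
        congr 1
        ext X
        have hi2 : Integrable (fun r : V × V => (fourierChar (inner ℝ c r.1) : ℂ) * γ (r.1 - p) *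
            ((fourierChar (inner ℝ r.2 r.1) : ℂ) * wignerKernel u v (X, r.2)))
            (volume.prod volume) := by
          have h := (γ.integrable (μ := volume)).comp_sub_right p
          have h' := (h.norm).mul_prod (integrable_schwartz_snd (wignerKernel u v) X).norm
          refine h'.mono' (Continuous.aestronglyMeasurable (by fun_prop))
            (Filter.Eventually.of_forall fun r => ?_)
          simp only [norm_mul, Circle.norm_coe, one_mul, le_refl]
        calc ∫ ξ, (fourierChar (prodPairing V (b, c) (X, ξ)) : ℂ) *
              (phaseWindow V ((X, ξ) - (q, p)) * wigner u v (X, ξ))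
            = ((fourierChar (inner ℝ b X) : ℂ) * γ (X - q)) * ∫ ξ, ∫ t,
              (fourierChar (inner ℝ c ξ) : ℂ) * γ (ξ - p) *
                ((fourierChar (inner ℝ t ξ) : ℂ) * wignerKernel u v (X, t)) := by
              rw [← integral_const_mul]
              congr 1
              ext ξ
              rw [integral_const_mul, prodPairing_apply, AddChar.map_add_eq_mul, Circle.coe_mul,
                phaseWindow, schwartzTensor_apply, wigner]
              simp only [Prod.fst_sub, Prod.snd_sub, hγ]
              ring
          _ = ((fourierChar (inner ℝ b X) : ℂ) * γ (X - q)) * ∫ t, ∫ ξ,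
              (fourierChar (inner ℝ c ξ) : ℂ) * γ (ξ - p) *
                ((fourierChar (inner ℝ t ξ) : ℂ) * wignerKernel u v (X, t)) := by
              rw [integral_integral_swap hi2]
          _ = _ := by
              rw [← integral_const_mul]
              congr 1
              ext t
              have e1 : ∫ ξ, (fourierChar (inner ℝ c ξ) : ℂ) * γ (ξ - p) *
                  ((fourierChar (inner ℝ t ξ) : ℂ) * wignerKernel u v (X, t))
                  = (fourierChar (inner ℝ (t + c) p) : ℂ) *
                    (gaussConst V * (Real.exp (-(Real.pi / 2) * ‖t + c‖ ^ 2) : ℂ)) *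
                    wignerKernel u v (X, t) := by
                rw [← integral_fourierChar_gaussian, ← integral_mul_const]
                congr 1
                ext ξ
                rw [inner_add_left, AddChar.map_add_eq_mul, Circle.coe_mul]
                ring
              have e2 := window_mul_window X t q c
              rw [e1, wignerKernel_apply]
              simp only [hF, schwartzConj_apply]
              have e3 : (fourierChar (inner ℝ b X) : ℂ) * (fourierChar (inner ℝ (t + c) p) : ℂ)
                  = (fourierChar (inner ℝ p c) : ℂ) *
                    ((fourierChar (inner ℝ (X + (1 / 2 : ℝ) • t) (p + (1 / 2 : ℝ) • b)) : ℂ) *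
                    (fourierChar (inner ℝ (X - (1 / 2 : ℝ) • t) (-(p - (1 / 2 : ℝ) • b))) : ℂ)) := by
                simp only [← Circle.coe_mul, ← AddChar.map_add_eq_mul]
                congr 2
                simp only [inner_add_left, inner_sub_left, inner_add_right, inner_sub_right,
                  inner_neg_right, inner_smul_left, inner_smul_right, real_inner_comm b X,
                  real_inner_comm p c, RCLike.conj_to_real]
                ring
              linear_combination
                (γ (X - q) * gaussConst V * (Real.exp (-(Real.pi / 2) * ‖t + c‖ ^ 2) : ℂ) *
                  (starRingEnd ℂ) (v (X + (1 / 2 : ℝ) • t)) * u (X - (1 / 2 : ℝ) • t)) * e3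
                - (gaussConst V * (fourierChar (inner ℝ p c) : ℂ) *
                  (fourierChar (inner ℝ (X + (1 / 2 : ℝ) • t) (p + (1 / 2 : ℝ) • b)) : ℂ) *
                  (fourierChar (inner ℝ (X - (1 / 2 : ℝ) • t) (-(p - (1 / 2 : ℝ) • b))) : ℂ) *
                  (starRingEnd ℂ) (v (X + (1 / 2 : ℝ) • t)) * u (X - (1 / 2 : ℝ) • t)) * e2
    _ = _ := by
        simp only [integral_const_mul]
        rw [integral_midpoint hFi, hprod]

end Stft

/-! ### The Calderón–Vaillancourt bound -/

section CalderonVaillancourt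

variable {V : Type} [NormedAddCommGroup V] [InnerProductSpace ℝ V] [FiniteDimensional ℝ V]
  [MeasurableSpace V] [BorelSpace V]

open Real (fourierChar)

lemma integrable_mul_comp_sub {h k : V × V → ℂ} (hh : Integrable h) (hk : Integrable k) :
    Integrable (fun p : (V × V) × (V × V) => h p.1 * k (p.1 - p.2)) (volume.prod volume) := by
  have hmp : MeasurePreserving (fun p : (V × V) × (V × V) => (p.1, p.1 - p.2))
      (volume.prod volume) (volume.prod volume) :=
    (MeasurePreserving.id _).skew_product (g := fun x t => x - t)
      (by fun_prop) (Filter.Eventually.of_forall fun x =>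
        (Measure.measurePreserving_sub_left volume x).map_eq)
  exact hmp.integrable_comp_of_integrable (hh.mul_prod hk)

lemma lintegral_sq_ne_top {E : Type} [NormedAddCommGroup E] [NormedSpace ℝ E]
    [FiniteDimensional ℝ E] [MeasurableSpace E] [BorelSpace E] (μ : Measure E)
    [μ.IsAddHaarMeasure] (f : 𝓢(E, ℂ)) : ∫⁻ x, ‖f x‖ₑ ^ (2 : ℝ) ∂μ ≠ ⊤ := by
  have h := (f.memLp 2 μ).eLpNorm_lt_top
  rw [eLpNorm_lt_top_iff_lintegral_rpow_enorm_lt_top (by norm_num) (by norm_num)] at h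
  simpa using h.ne

lemma enorm_toLp_eq {E : Type} [NormedAddCommGroup E] [NormedSpace ℝ E]
    [FiniteDimensional ℝ E] [MeasurableSpace E] [BorelSpace E] (μ : Measure E)
    [μ.IsAddHaarMeasure] (f : 𝓢(E, ℂ)) :
    ‖f.toLp 2 μ‖ₑ = (∫⁻ x, ‖f x‖ₑ ^ (2 : ℝ) ∂μ) ^ (1 / 2 : ℝ) := by
  rw [SchwartzMap.toLp, Lp.enorm_toLp, eLpNorm_eq_lintegral_rpow_enorm_toReal (by norm_num)
    (by norm_num)]
  simp

/-- The `L²` norm of the window. -/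
def windowNorm (V : Type) [NormedAddCommGroup V] [InnerProductSpace ℝ V] [FiniteDimensional ℝ V]
    [MeasurableSpace V] [BorelSpace V] : ℝ := ‖(window V).toLp 2 (volume : Measure V)‖

lemma lintegral_stft_mul_stft_le (u v : 𝓢(V, ℂ)) (s t : V × V) :
    ∫⁻ z, ‖stft u (z + s)‖ₑ * ‖stft v (z + t)‖ₑ
      ≤ ENNReal.ofReal (windowNorm V ^ 2 * ‖u.toLp 2 (volume : Measure V)‖ *
        ‖v.toLp 2 (volume : Measure V)‖) := by
  have hm : ∀ (f : 𝓢(V, ℂ)) (s : V × V), Measurable fun z => ‖stft f (z + s)‖ₑ := fun f s =>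
    ((continuous_stft f).comp (by fun_prop : Continuous fun z : V × V => z + s)).measurable.enorm
  have h := ENNReal.lintegral_mul_le_Lp_mul_Lq volume (Real.HolderConjugate.two_two)
    (hm u s).aemeasurable (hm v t).aemeasurable
  refine h.trans (le_of_eq ?_)
  have e : ∀ (f : 𝓢(V, ℂ)) (s : V × V), (∫⁻ z, ‖stft f (z + s)‖ₑ ^ (2 : ℝ)) ^ (1 / 2 : ℝ)
      = ‖(window V).toLp 2 (volume : Measure V)‖ₑ * ‖f.toLp 2 (volume : Measure V)‖ₑ := by
    intro f s
    rw [lintegral_add_right_eq_self (fun z => ‖stft f z‖ₑ ^ (2 : ℝ)) s, lintegral_enorm_stft_sq,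
      ENNReal.mul_rpow_of_nonneg _ _ (by norm_num), enorm_toLp_eq, enorm_toLp_eq]
  rw [e, e, windowNorm, ENNReal.ofReal_mul (by positivity), ENNReal.ofReal_mul (by positivity),
    ENNReal.ofReal_pow (by positivity), ofReal_norm, ofReal_norm, ofReal_norm]
  ring

/-- The integral of the square of the phase space window. -/
lemma integral_phaseWindow_sq_ne_zero :
    ∫ z : V × V, phaseWindow V z * phaseWindow V z ≠ 0 := by
  have e : ∀ z : V × V, phaseWindow V z * phaseWindow V z
      = ((Real.exp (-(2 * Real.pi) * ‖z.1‖ ^ 2) * Real.exp (-(2 * Real.pi) * ‖z.2‖ ^ 2)) ^ 2 : ℝ) := by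
    intro z
    simp only [phaseWindow, schwartzTensor_apply, schwartzGaussian_apply]
    push_cast
    ring
  have hi : Integrable fun z : V × V => phaseWindow V z * phaseWindow V z :=
    (phaseWindow V).integrable.bdd_mul (c := 1) (phaseWindow V).continuous.aestronglyMeasurable
      (Filter.Eventually.of_forall norm_phaseWindow_le)
  simp only [e] at hi ⊢
  rw [integral_complex_ofReal, Complex.ofReal_ne_zero]
  refine ne_of_gt ?_
  rw [integral_pos_iff_support_of_nonneg (fun z => by positivity) 
    (by simpa only [RCLike.re_eq_complex_re, Complex.ofReal_re] using hi.re)]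
  have : Function.support (fun z : V × V => (Real.exp (-(2 * Real.pi) * ‖z.1‖ ^ 2) *
      Real.exp (-(2 * Real.pi) * ‖z.2‖ ^ 2)) ^ 2) = Set.univ := by
    ext z
    simp only [Function.mem_support, Set.mem_univ, iff_true]
    positivity
  rw [this]
  exact Measure.measure_univ_pos.2 (NeZero.ne _)

/-- The Fourier transform of the symbol `a`, localized near `z`. -/
def localFourier (a : V × V → ℂ) (z ζ : V × V) : ℂ :=
  ∫ w, (fourierChar (-(prodPairing V w ζ)) : ℂ) * (a w * phaseWindow V (w - z))

omit [FiniteDimensional ℝ V] [MeasurableSpace V] [BorelSpace V] in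
lemma continuous_prodPairing : Continuous fun p : (V × V) × (V × V) => prodPairing V p.1 p.2 := by
  simp only [prodPairing_apply]
  fun_prop

lemma integrable_mul_phaseWindow {N : ℕ} {M : ℝ} {a : V × V → ℂ} (ha : BddDeriv N M a)
    (z : V × V) : Integrable fun w => a w * phaseWindow V (w - z) :=
  ((phaseWindow V).integrable.comp_sub_right z).bdd_mul (c := M) ha.continuous.aestronglyMeasurable
    (Filter.Eventually.of_forall ha.norm_le)

lemma continuous_localFourier {N : ℕ} {M : ℝ} {a : V × V → ℂ} (ha : BddDeriv N M a)
    (z : V × V) : Continuous (localFourier a z) := by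
  have hac := ha.continuous
  have hpc := (phaseWindow V).continuous
  have hpp := continuous_prodPairing (V := V)
  have hbc : Continuous fun w => a w * phaseWindow V (w - z) := by fun_prop
  have hch : Continuous fun p : (V × V) × (V × V) =>
      (fourierChar (-(prodPairing V p.1 p.2)) : ℂ) := by fun_prop
  refine continuous_of_dominated (fun ζ => Continuous.aestronglyMeasurable ?_)
    (fun ζ => Filter.Eventually.of_forall fun w => ?_) (integrable_mul_phaseWindow ha z).norm
    (Filter.Eventually.of_forall fun w => ?_)
  · exact (hch.comp (by fun_prop : Continuous fun w : V × V => (w, ζ))).mul hbc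
  · rw [norm_mul, Circle.norm_coe, one_mul]
  · exact (hch.comp (by fun_prop : Continuous fun ζ : V × V => (w, ζ))).mul continuous_const

lemma exists_norm_localFourier_le (N : ℕ) : ∃ C, 0 ≤ C ∧ ∀ (M : ℝ) (a : V × V → ℂ),
    BddDeriv N M a → ∀ z ζ, ‖localFourier a z ζ‖ ≤ C * M * ((1 + ‖ζ‖) ^ N)⁻¹ := by
  obtain ⟨C, hC0, hC⟩ := exists_norm_fourierIntegral_mul_le (volume : Measure (V × V))
    (isPerfect_prodPairing (E := V)) (phaseWindow V) N
  refine ⟨C, hC0, fun M a ha z ζ => ?_⟩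
  have h := hC M _ (ha.comp_affine z (ContinuousLinearMap.id ℝ (V × V))
    ContinuousLinearMap.norm_id_le) ζ
  have e : localFourier a z ζ = (fourierChar (-(prodPairing V z ζ)) : ℂ) *
      ∫ w, (fourierChar (-(prodPairing V w ζ)) : ℂ) *
        (a (z + ContinuousLinearMap.id ℝ (V × V) w) * phaseWindow V w) := by
    rw [localFourier, ← integral_add_right_eq_self _ z, ← integral_const_mul]
    congr 1
    ext w
    rw [map_add, _root_.add_apply, neg_add, AddChar.map_add_eq_mul, Circle.coe_mul,
      add_sub_cancel_right, ContinuousLinearMap.id_apply, add_comm w z]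
    ring
  rw [e, norm_mul, Circle.norm_coe, one_mul, ← div_eq_mul_inv, le_div_iff₀ (by positivity)]
  exact h

/-- The contribution of a localized symbol to the matrix elements. -/
lemma integral_mul_wigner_mul_phaseWindow {N : ℕ} {M : ℝ} {a : V × V → ℂ} (ha : BddDeriv N M a)
    (hN : Module.finrank ℝ (V × V) < N) (u v : 𝓢(V, ℂ)) (z : V × V) :
    ∫ w, a w * wigner u v w * (phaseWindow V (w - z) * phaseWindow V (w - z))
      = ∫ ζ, localFourier a z ζ * (gaussConst V * (fourierChar (inner ℝ z.2 ζ.2) : ℂ) *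
        (stft u (z.1 + (1 / 2 : ℝ) • ζ.2, z.2 - (1 / 2 : ℝ) • ζ.1) *
          (starRingEnd ℂ) (stft v (z.1 - (1 / 2 : ℝ) • ζ.2, z.2 + (1 / 2 : ℝ) • ζ.1)))) := by
  obtain ⟨C, hC0, hC⟩ := exists_norm_localFourier_le (V := V) N
  have hpc := (phaseWindow V).continuous
  have hac := ha.continuous
  have hbc := continuous_localFourier ha z
  have hbi : Integrable (localFourier a z) :=
    ((integrable_inv_one_add_norm_pow (volume : Measure (V × V)) hN).const_mul (C * M)).mono'
      hbc.aestronglyMeasurable (Filter.Eventually.of_forall (hC M a ha z))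
  have hcont : Continuous fun w => a w * phaseWindow V (w - z) := by fun_prop
  have hinv := fourier_inversion_prod hcont (integrable_mul_phaseWindow ha z) hbi
  have hi : Integrable (fun p : (V × V) × (V × V) =>
      localFourier a z p.2 * ((fourierChar (prodPairing V p.2 p.1) : ℂ) *
        (phaseWindow V (p.1 - z) * wigner u v p.1))) (volume.prod volume) := by
    have h := (integrable_wigner u v).norm.mul_prod hbi.norm
    have h1 : Continuous fun p : (V × V) × (V × V) => (fourierChar (prodPairing V p.2 p.1) : ℂ) := by
      have := (continuous_prodPairing (V := V)).comp
        (by fun_prop : Continuous fun p : (V × V) × (V × V) => (p.2, p.1))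
      simp only [Function.comp_def] at this
      fun_prop
    have h2 : Continuous fun w => phaseWindow V (w - z) * wigner u v w :=
      (hpc.comp (by fun_prop)).mul (continuous_wigner u v)
    refine h.mono' (((hbc.comp continuous_snd).mul
      (h1.mul (h2.comp continuous_fst))).aestronglyMeasurable)
      (Filter.Eventually.of_forall fun p => ?_)
    rw [norm_mul, norm_mul, norm_mul, Circle.norm_coe, one_mul, mul_comm]
    gcongr
    exact mul_le_of_le_one_left (norm_nonneg _) (norm_phaseWindow_le _)
  calc _ = ∫ w, ∫ ζ, localFourier a z ζ * ((fourierChar (prodPairing V ζ w) : ℂ) *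
        (phaseWindow V (w - z) * wigner u v w)) := by
        congr 1
        ext w
        calc _ = (a w * phaseWindow V (w - z)) * (phaseWindow V (w - z) * wigner u v w) := by ring
          _ = _ := by
            rw [hinv w, ← integral_mul_const]
            congr 1
            ext ζ
            rw [localFourier]
            ring
    _ = ∫ ζ, ∫ w, localFourier a z ζ * ((fourierChar (prodPairing V ζ w) : ℂ) *
        (phaseWindow V (w - z) * wigner u v w)) := integral_integral_swap hi
    _ = _ := by
        congr 1
        ext ζ
        rw [integral_const_mul, integral_phaseWindow_mul_wigner]

lemma integral_mul_wigner_mul_const {N : ℕ} {M : ℝ} {a : V × V → ℂ} (ha : BddDeriv N M a)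
    (u v : 𝓢(V, ℂ)) {k : V × V → ℂ} (hk : Integrable k) :
    (∫ w, a w * wigner u v w) * ∫ z, k z = ∫ z, ∫ w, a w * wigner u v w * k (w - z) := by
  have haW : Integrable fun w => a w * wigner u v w :=
    (integrable_wigner u v).bdd_mul (c := M) ha.continuous.aestronglyMeasurable
      (Filter.Eventually.of_forall ha.norm_le)
  rw [← integral_integral_swap (integrable_mul_comp_sub haW hk), ← integral_mul_const]
  congr 1
  ext w
  rw [integral_const_mul]
  congr 1
  exact (integral_sub_left_eq_self k volume w).symm

/-- **Calderón–Vaillancourt**: the matrix elements of a Weyl operator are controlled by finitely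
many derivatives of the symbol. -/
lemma exists_norm_integral_mul_wigner_le :
    ∃ C, 0 ≤ C ∧ ∀ (M : ℝ) (a : V × V → ℂ), BddDeriv (Module.finrank ℝ (V × V) + 1) M a →
      ∀ u v : 𝓢(V, ℂ), ‖∫ w, a w * wigner u v w‖
        ≤ C * M * ‖u.toLp 2 (volume : Measure V)‖ * ‖v.toLp 2 (volume : Measure V)‖ := by
  set N := Module.finrank ℝ (V × V) + 1 with hN
  obtain ⟨C, hC0, hC⟩ := exists_norm_localFourier_le (V := V) N
  set c := ∫ z : V × V, phaseWindow V z * phaseWindow V z with hc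
  have hc0 : c ≠ 0 := integral_phaseWindow_sq_ne_zero
  have hk := integrable_inv_one_add_norm_pow (volume : Measure (V × V)) (Nat.lt_succ_self _)
  set I := ∫ ζ : V × V, ((1 + ‖ζ‖) ^ N)⁻¹ with hI
  have hI0 : 0 ≤ I := integral_nonneg fun t => by positivity
  have hg0 := (gaussConst_pos (V := V)).le
  refine ⟨‖c‖⁻¹ * (C * gaussConst V * windowNorm V ^ 2 * I), by positivity, fun M a ha u v => ?_⟩
  have hM := ha.nonneg
  have hpc := (phaseWindow V).continuous
  have hsq : Integrable fun z : V × V => phaseWindow V z * phaseWindow V z :=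
    (phaseWindow V).integrable.bdd_mul (c := 1) hpc.aestronglyMeasurable
      (Filter.Eventually.of_forall norm_phaseWindow_le)
  have hmain : (∫ w, a w * wigner u v w) * c = ∫ z, ∫ w, a w * wigner u v w *
      (phaseWindow V (w - z) * phaseWindow V (w - z)) :=
    integral_mul_wigner_mul_const ha u v hsq
  have hen : ‖(∫ w, a w * wigner u v w) * c‖ₑ ≤ ENNReal.ofReal ((C * M * gaussConst V) *
      (windowNorm V ^ 2 * ‖u.toLp 2 (volume : Measure V)‖ * ‖v.toLp 2 (volume : Measure V)‖) * I) := by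
    rw [hmain]
    set S : (V × V) → (V × V) := fun ζ => ((1 / 2 : ℝ) • ζ.2, -((1 / 2 : ℝ) • ζ.1)) with hS
    have hSc : Continuous S := by fun_prop
    set k : V × V → ENNReal := fun ζ => ENNReal.ofReal (C * M * gaussConst V * ((1 + ‖ζ‖) ^ N)⁻¹)
      with hkdef
    have hkm : Measurable k := by
      refine ENNReal.measurable_ofReal.comp (Continuous.measurable ?_)
      refine continuous_const.mul (Continuous.inv₀ (by fun_prop) fun ζ => ?_)
      positivity
    calc _ ≤ ∫⁻ z, ‖∫ w, a w * wigner u v w * (phaseWindow V (w - z) * phaseWindow V (w - z))‖ₑ :=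
          enorm_integral_le_lintegral_enorm _
      _ ≤ ∫⁻ z, ∫⁻ ζ, k ζ * (‖stft u (z + S ζ)‖ₑ * ‖stft v (z + -S ζ)‖ₑ) := by
          refine lintegral_mono fun z => ?_
          rw [integral_mul_wigner_mul_phaseWindow ha (Nat.lt_succ_self _)]
          refine (enorm_integral_le_lintegral_enorm _).trans (lintegral_mono fun ζ => ?_)
          have e1 : (z.1 + (1 / 2 : ℝ) • ζ.2, z.2 - (1 / 2 : ℝ) • ζ.1) = z + S ζ := by
            ext <;> simp [hS, sub_eq_add_neg]
          have e2 : (z.1 - (1 / 2 : ℝ) • ζ.2, z.2 + (1 / 2 : ℝ) • ζ.1) = z + -S ζ := by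
            ext <;> simp [hS, sub_eq_add_neg]
          rw [e1, e2, ← mul_assoc, enorm_mul, enorm_mul (stft u _), RCLike.enorm_conj]
          gcongr
          rw [← ofReal_norm, hkdef]
          refine ENNReal.ofReal_le_ofReal ?_
          rw [norm_mul, norm_mul, Circle.norm_coe, mul_one, Complex.norm_real, Real.norm_of_nonneg hg0]
          calc _ ≤ C * M * ((1 + ‖ζ‖) ^ N)⁻¹ * gaussConst V := by
                gcongr
                exact hC M a ha z ζ
            _ = _ := by ring
      _ = ∫⁻ ζ, ∫⁻ z, k ζ * (‖stft u (z + S ζ)‖ₑ * ‖stft v (z + -S ζ)‖ₑ) := by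
          refine lintegral_lintegral_swap (Measurable.aemeasurable ?_)
          have h1 : Continuous fun p : (V × V) × (V × V) => stft u (p.1 + S p.2) :=
            (continuous_stft u).comp (by fun_prop)
          have h2 : Continuous fun p : (V × V) × (V × V) => stft v (p.1 + -S p.2) :=
            (continuous_stft v).comp (by fun_prop)
          exact (hkm.comp measurable_snd).mul (h1.measurable.enorm.mul h2.measurable.enorm)
      _ ≤ ∫⁻ ζ, k ζ * ENNReal.ofReal (windowNorm V ^ 2 * ‖u.toLp 2 (volume : Measure V)‖ *
            ‖v.toLp 2 (volume : Measure V)‖) := by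
          refine lintegral_mono fun ζ => ?_
          rw [lintegral_const_mul' _ _ ENNReal.ofReal_ne_top]
          gcongr
          exact lintegral_stft_mul_stft_le u v _ _
      _ = _ := by
          rw [lintegral_mul_const' _ _ ENNReal.ofReal_ne_top, hkdef,
            ← ofReal_integral_eq_lintegral_ofReal (hk.const_mul _)
              (Filter.Eventually.of_forall fun ζ => by positivity), integral_const_mul,
            ← ENNReal.ofReal_mul (by positivity)]
          congr 1
          ring
  rw [← ofReal_norm, ENNReal.ofReal_le_ofReal_iff (by rw [windowNorm]; positivity), norm_mul] at hen
  have hc1 : 0 < ‖c‖ := norm_pos_iff.2 hc0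
  calc ‖∫ w, a w * wigner u v w‖ = ‖c‖⁻¹ * (‖∫ w, a w * wigner u v w‖ * ‖c‖) := by
        field_simp
    _ ≤ ‖c‖⁻¹ * _ := mul_le_mul_of_nonneg_left hen (by positivity)
    _ = _ := by ring

end CalderonVaillancourt

/-! ### A lower bound for Weyl operators with positive symbols -/

section Garding

variable {V : Type} [NormedAddCommGroup V] [InnerProductSpace ℝ V] [FiniteDimensional ℝ V]
  [MeasurableSpace V] [BorelSpace V]

open Real (fourierChar)

/-- All derivatives of `a` exist and are bounded. -/
def AllBdd {E F : Type} [NormedAddCommGroup E] [NormedSpace ℝ E] [NormedAddCommGroup F]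
    [NormedSpace ℝ F] (a : E → F) : Prop :=
  ContDiff ℝ ∞ a ∧ ∀ k : ℕ, ∃ C, ∀ x, ‖iteratedFDeriv ℝ k a x‖ ≤ C

lemma AllBdd.fderiv {E F : Type} [NormedAddCommGroup E] [NormedSpace ℝ E] [NormedAddCommGroup F]
    [NormedSpace ℝ F] {a : E → F} (h : AllBdd a) : AllBdd (fderiv ℝ a) := by
  refine ⟨h.1.fderiv_right (m := ∞) le_rfl, fun k => ?_⟩
  obtain ⟨C, hC⟩ := h.2 (k + 1)
  exact ⟨C, fun x => by rw [norm_iteratedFDeriv_fderiv]; exact hC x⟩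

lemma AllBdd.exists_norm_le {E F : Type} [NormedAddCommGroup E] [NormedSpace ℝ E]
    [NormedAddCommGroup F] [NormedSpace ℝ F] {a : E → F} (h : AllBdd a) :
    ∃ C, ∀ x, ‖a x‖ ≤ C := by
  obtain ⟨C, hC⟩ := h.2 0
  exact ⟨C, fun x => by simpa using hC x⟩

lemma AllBdd.exists_bddDeriv {E : Type} [NormedAddCommGroup E] [NormedSpace ℝ E] {a : E → ℂ}
    (h : AllBdd a) (N : ℕ) : ∃ M, BddDeriv N M a := by
  choose C hC using h.2
  refine ⟨∑ k ∈ Finset.range (N + 1), |C k|, h.1, fun k hk x => ?_⟩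
  exact ((hC k x).trans (le_abs_self _)).trans (Finset.single_le_sum (f := fun k => |C k|)
    (fun _ _ => abs_nonneg _) (Finset.mem_range.2 (Nat.lt_succ_iff.2 hk)))

/-- The weight `exp (-2π ‖s‖²)` on the phase space. -/
def phaseWeight (s : V × V) : ℝ :=
  Real.exp (-(2 * Real.pi) * ‖s.1‖ ^ 2) * Real.exp (-(2 * Real.pi) * ‖s.2‖ ^ 2)

omit [FiniteDimensional ℝ V] [MeasurableSpace V] [BorelSpace V] in
lemma phaseWindow_eq (s : V × V) : phaseWindow V s = (phaseWeight s : ℂ) := by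
  simp only [phaseWindow, schwartzTensor_apply, schwartzGaussian_apply, phaseWeight,
    Complex.ofReal_mul]

omit [FiniteDimensional ℝ V] [MeasurableSpace V] [BorelSpace V] in
lemma phaseWeight_pos (s : V × V) : 0 < phaseWeight s := by
  rw [phaseWeight]
  positivity

omit [FiniteDimensional ℝ V] [MeasurableSpace V] [BorelSpace V] in
lemma continuous_phaseWeight : Continuous (phaseWeight : V × V → ℝ) := by
  unfold phaseWeight
  fun_prop

omit [FiniteDimensional ℝ V] [MeasurableSpace V] [BorelSpace V] in
lemma norm_phaseWindow (s : V × V) : ‖phaseWindow V s‖ = phaseWeight s := by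
  rw [phaseWindow_eq, Complex.norm_real, Real.norm_of_nonneg (phaseWeight_pos s).le]

lemma integrable_phaseWeight : Integrable (phaseWeight : V × V → ℝ) := by
  refine (phaseWindow V).integrable.norm.congr (Filter.Eventually.of_forall fun s => ?_)
  exact norm_phaseWindow s

lemma integrable_norm_mul_phaseWeight : Integrable fun s : V × V => ‖s‖ * phaseWeight s := by
  have := (phaseWindow V).integrable_pow_mul volume 1
  simpa only [pow_one, norm_phaseWindow] using this

lemma integral_phaseWeight_pos : 0 < ∫ s : V × V, phaseWeight s := by
  rw [integral_pos_iff_support_of_nonneg (fun z => (phaseWeight_pos z).le) integrable_phaseWeight]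
  have : Function.support (phaseWeight : V × V → ℝ) = Set.univ :=
    Set.eq_univ_of_forall fun s => (phaseWeight_pos s).ne'
  rw [this]
  exact Measure.measure_univ_pos.2 (NeZero.ne _)

/-- The difference of a function and its Gaussian average (up to normalization). -/
def gaussDiff {F : Type} [NormedAddCommGroup F] [NormedSpace ℝ F] (a : V × V → F) (w : V × V) : F :=
  ∫ s : V × V, phaseWeight s • (a w - a (w - s))

lemma hasFDerivAt_gaussDiff {F : Type} [NormedAddCommGroup F] [NormedSpace ℝ F]
    {a : V × V → F} (ha : AllBdd a) (w : V × V) :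
    HasFDerivAt (gaussDiff a) (gaussDiff (fderiv ℝ a) w) w := by
  obtain ⟨C, hC⟩ := ha.exists_norm_le
  obtain ⟨C', hC'⟩ := ha.fderiv.exists_norm_le
  have hac := ha.1.continuous
  have hac' := ha.fderiv.1.continuous
  have hwc := continuous_phaseWeight (V := V)
  have hd : ∀ x, HasFDerivAt a (fderiv ℝ a x) x := fun x =>
    (ha.1.differentiable (by simp) x).hasFDerivAt
  refine hasFDerivAt_integral_of_dominated_of_fderiv_le (s := Set.univ)
    (F := fun x s => phaseWeight s • (a x - a (x - s)))
    (F' := fun x s => phaseWeight s • (fderiv ℝ a x - fderiv ℝ a (x - s)))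
    (bound := fun s => phaseWeight s * (C' + C')) Filter.univ_mem
    (Filter.Eventually.of_forall fun x => Continuous.aestronglyMeasurable (by fun_prop)) ?_
    (Continuous.aestronglyMeasurable (by fun_prop)) (Filter.Eventually.of_forall fun s x _ => ?_)
    (integrable_phaseWeight.mul_const _) (Filter.Eventually.of_forall fun s x _ => ?_)
  · refine (integrable_phaseWeight.mul_const (C + C)).mono'
      (Continuous.aestronglyMeasurable (by fun_prop)) (Filter.Eventually.of_forall fun s => ?_)
    rw [norm_smul, Real.norm_of_nonneg (phaseWeight_pos s).le]
    exact mul_le_mul_of_nonneg_left ((norm_sub_le _ _).trans (add_le_add (hC _) (hC _)))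
      (phaseWeight_pos s).le
  · rw [norm_smul, Real.norm_of_nonneg (phaseWeight_pos s).le]
    exact mul_le_mul_of_nonneg_left ((norm_sub_le _ _).trans (add_le_add (hC' _) (hC' _)))
      (phaseWeight_pos s).le
  · exact (((hd x).sub ((hd (x - s)).comp x ((hasFDerivAt_id x).sub_const s))).const_smul _)

lemma fderiv_gaussDiff {F : Type} [NormedAddCommGroup F] [NormedSpace ℝ F]
    {a : V × V → F} (ha : AllBdd a) : fderiv ℝ (gaussDiff a) = gaussDiff (fderiv ℝ a) :=
  funext fun w => (hasFDerivAt_gaussDiff ha w).fderiv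

lemma contDiff_gaussDiff (k : ℕ) : ∀ {F : Type} [NormedAddCommGroup F] [NormedSpace ℝ F]
    {a : V × V → F}, AllBdd a → ContDiff ℝ k (gaussDiff a) := by
  induction k with
  | zero =>
    intro F _ _ a ha
    rw [Nat.cast_zero, contDiff_zero]
    exact continuous_iff_continuousAt.2 fun w => (hasFDerivAt_gaussDiff ha w).continuousAt
  | succ k ih =>
    intro F _ _ a ha
    rw [Nat.cast_succ, contDiff_succ_iff_fderiv]
    refine ⟨fun w => (hasFDerivAt_gaussDiff ha w).differentiableAt, by simp, ?_⟩
    rw [fderiv_gaussDiff ha]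
    exact ih ha.fderiv

lemma norm_iteratedFDeriv_gaussDiff_le (k : ℕ) : ∀ {F : Type} [NormedAddCommGroup F]
    [NormedSpace ℝ F] {a : V × V → F} {M : ℝ}, AllBdd a →
    (∀ x, ‖iteratedFDeriv ℝ (k + 1) a x‖ ≤ M) → ∀ w,
    ‖iteratedFDeriv ℝ k (gaussDiff a) w‖ ≤ (∫ s : V × V, ‖s‖ * phaseWeight s) * M := by
  induction k with
  | zero =>
    intro F _ _ a M ha hM w
    rw [norm_iteratedFDeriv_zero, gaussDiff, ← integral_mul_const]
    refine norm_integral_le_of_norm_le (integrable_norm_mul_phaseWeight.mul_const M)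
      (Filter.Eventually.of_forall fun s => ?_)
    have h : ‖a w - a (w - s)‖ ≤ M * ‖w - (w - s)‖ := by
      refine Convex.norm_image_sub_le_of_norm_fderiv_le (𝕜 := ℝ) (s := Set.univ)
        (fun x _ => ha.1.differentiable (by simp) x) (fun x _ => ?_) convex_univ
        (Set.mem_univ _) (Set.mem_univ _)
      have := hM x
      rwa [← norm_iteratedFDeriv_fderiv, norm_iteratedFDeriv_zero] at this
    rw [sub_sub_cancel] at h
    rw [norm_smul, Real.norm_of_nonneg (phaseWeight_pos s).le]
    calc _ ≤ phaseWeight s * (M * ‖s‖) := mul_le_mul_of_nonneg_left h (phaseWeight_pos s).le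
      _ = _ := by ring
  | succ k ih =>
    intro F _ _ a M ha hM w
    rw [← norm_iteratedFDeriv_fderiv, fderiv_gaussDiff ha]
    exact ih ha.fderiv (fun x => by rw [norm_iteratedFDeriv_fderiv]; exact hM x) w

lemma integrable_norm_stft_sq (u : 𝓢(V, ℂ)) : Integrable fun z => ‖stft u z‖ ^ 2 := by
  have h : MemLp (stft u) 2 := by
    refine ⟨(continuous_stft u).aestronglyMeasurable, ?_⟩
    rw [eLpNorm_lt_top_iff_lintegral_rpow_enorm_lt_top (by norm_num) (by norm_num)]
    simp only [ENNReal.toReal_ofNat]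
    rw [lintegral_enorm_stft_sq]
    exact ENNReal.mul_lt_top (lintegral_sq_ne_top _ _).lt_top (lintegral_sq_ne_top _ _).lt_top
  simpa using h.integrable_norm_rpow (by norm_num) (by norm_num)

lemma integral_norm_stft_sq (u : 𝓢(V, ℂ)) :
    ∫ z, ‖stft u z‖ ^ 2 = windowNorm V ^ 2 * ‖u.toLp 2 (volume : Measure V)‖ ^ 2 := by
  have e : ∀ f : 𝓢(V, ℂ), ENNReal.ofReal (‖f.toLp 2 (volume : Measure V)‖ ^ 2)
      = ∫⁻ x, ‖f x‖ₑ ^ (2 : ℝ) := by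
    intro f
    rw [ENNReal.ofReal_pow (norm_nonneg _), ofReal_norm, enorm_toLp_eq, ← ENNReal.rpow_natCast,
      ← ENNReal.rpow_mul]
    norm_num
  have h := lintegral_enorm_stft_sq u
  rw [← e, ← e, ← ENNReal.ofReal_mul (by positivity)] at h
  have h2 := ofReal_integral_eq_lintegral_ofReal (integrable_norm_stft_sq u)
    (Filter.Eventually.of_forall fun _ => by positivity)
  have h3 : ∫⁻ z, ENNReal.ofReal (‖stft u z‖ ^ 2) = ∫⁻ z, ‖stft u z‖ₑ ^ (2 : ℝ) := by
    congr 1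
    ext z
    rw [ENNReal.ofReal_pow (norm_nonneg _), ofReal_norm]
    norm_cast
  rw [h3, h, ENNReal.ofReal_eq_ofReal_iff (integral_nonneg fun _ => by positivity)
    (by positivity)] at h2
  exact h2

lemma windowNorm_pos : 0 < windowNorm V := by
  rw [windowNorm, norm_pos_iff]
  intro h
  have h0 : (window V).toLp 2 (volume : Measure V) = (0 : 𝓢(V, ℂ)).toLp 2 volume := by
    rw [h]
    exact (map_zero (SchwartzMap.toLpCLM ℂ ℂ 2 (volume : Measure V))).symm
  have h1 := SchwartzMap.injective_toLp 2 (volume : Measure V) h0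
  have h2 := DFunLike.congr_fun h1 0
  rw [window, schwartzGaussian_apply] at h2
  simp at h2

/-- Gårding's inequality for symbols with small derivatives. -/
lemma exists_le_re_integral_mul_wigner :
    ∃ κ C : ℝ, 0 < κ ∧ 0 ≤ C ∧ ∀ (c M : ℝ) (a : V × V → ℝ), AllBdd (fun w => (a w : ℂ)) →
      (∀ w, c ≤ a w) →
      (∀ k ≤ Module.finrank ℝ (V × V) + 1, ∀ w,
        ‖iteratedFDeriv ℝ (k + 1) (fun w => (a w : ℂ)) w‖ ≤ M) →
      ∀ u : 𝓢(V, ℂ), (κ * c - C * M) * ‖u.toLp 2 (volume : Measure V)‖ ^ 2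
        ≤ (∫ w, (a w : ℂ) * wigner u u w).re := by
  obtain ⟨C, hC0, hC⟩ := exists_norm_integral_mul_wigner_le (V := V)
  set c₁ := ∫ s : V × V, phaseWeight s with hc₁
  have hc₁p : 0 < c₁ := integral_phaseWeight_pos
  set I := ∫ s : V × V, ‖s‖ * phaseWeight s
  have hI : 0 ≤ I := integral_nonneg fun s => mul_nonneg (norm_nonneg _) (phaseWeight_pos s).le
  have hg := gaussConst_pos (V := V)
  have hw := windowNorm_pos (V := V)
  refine ⟨c₁⁻¹ * (gaussConst V * windowNorm V ^ 2), c₁⁻¹ * (C * I), by positivity, by positivity,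
    fun c M a ha hca hM u => ?_⟩
  obtain ⟨B, hB⟩ := ha.exists_norm_le
  have hac : Continuous fun w => (a w : ℂ) := ha.1.continuous
  have hWi := integrable_wigner u u
  have hpc := (phaseWindow V).continuous
  have hd : BddDeriv (Module.finrank ℝ (V × V) + 1) (I * M) (gaussDiff fun w => (a w : ℂ)) :=
    ⟨contDiff_infty.2 fun k => contDiff_gaussDiff k ha, fun k hk x =>
      norm_iteratedFDeriv_gaussDiff_le k ha (hM k hk) x⟩
  have herr := hC _ _ hd u u
  have hprod : Integrable (fun p : (V × V) × (V × V) => wigner u u p.1 *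
      phaseWindow V (p.1 - p.2)) (volume.prod volume) :=
    integrable_mul_comp_sub hWi (phaseWindow V).integrable
  have hprod2 : Integrable (fun p : (V × V) × (V × V) => (a p.2 : ℂ) * (wigner u u p.1 *
      phaseWindow V (p.1 - p.2))) (volume.prod volume) :=
    hprod.bdd_mul (c := B) (hac.comp continuous_snd).aestronglyMeasurable
      (Filter.Eventually.of_forall fun p => hB _)
  have hgd : ∀ w, gaussDiff (fun w => (a w : ℂ)) w
      = c₁ * a w - ∫ z, (a z : ℂ) * phaseWindow V (w - z) := by
    intro w
    have h1 : Integrable fun s : V × V => (phaseWindow V s) * (a w : ℂ) :=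
      (phaseWindow V).integrable.mul_const _
    have h2 : Integrable fun s : V × V => (a (w - s) : ℂ) * phaseWindow V s :=
      (phaseWindow V).integrable.bdd_mul (c := B)
        (hac.comp (by fun_prop : Continuous fun s : V × V => w - s)).aestronglyMeasurable
        (Filter.Eventually.of_forall fun p => hB _)
    have h3 : ∫ z, (a z : ℂ) * phaseWindow V (w - z) = ∫ s, (a (w - s) : ℂ) * phaseWindow V s := by
      rw [← integral_sub_left_eq_self _ volume w]
      simp only [sub_sub_cancel]
    have h4 : (c₁ : ℂ) * a w = ∫ s : V × V, (phaseWindow V s) * (a w : ℂ) := by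
      rw [integral_mul_const, hc₁, ← integral_complex_ofReal]
      simp only [phaseWindow_eq]
    rw [h3, h4, ← integral_sub h1 h2, gaussDiff]
    congr 1
    ext s
    rw [Complex.real_smul, ← phaseWindow_eq]
    ring
  have hAW : ∫ w, (∫ z, (a z : ℂ) * phaseWindow V (w - z)) * wigner u u w
      = ((gaussConst V * ∫ z, a z * ‖stft u z‖ ^ 2 : ℝ) : ℂ) := by
    calc _ = ∫ w, ∫ z, (a z : ℂ) * (wigner u u w * phaseWindow V (w - z)) := by
          congr 1
          ext w
          rw [← integral_mul_const]
          congr 1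
          ext z
          ring
      _ = ∫ z, ∫ w, (a z : ℂ) * (wigner u u w * phaseWindow V (w - z)) :=
          integral_integral_swap hprod2
      _ = ∫ z, ((gaussConst V * (a z * ‖stft u z‖ ^ 2) : ℝ) : ℂ) := by
          congr 1
          ext z
          rw [integral_const_mul]
          have h := integral_phaseWindow_mul_wigner u u z 0
          simp only [map_zero, _root_.zero_apply, AddChar.map_zero_eq_one, Circle.coe_one, one_mul,
            Prod.snd_zero, Prod.fst_zero, smul_zero, add_zero, sub_zero, inner_zero_right,
            mul_one, Prod.mk.eta, Complex.mul_conj'] at h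
          simp only [mul_comm (wigner u u _)]
          rw [h]
          push_cast
          ring
      _ = _ := by
          rw [integral_complex_ofReal, integral_const_mul]
  have hsum : (c₁ : ℂ) * ∫ w, (a w : ℂ) * wigner u u w
      = (∫ w, gaussDiff (fun w => (a w : ℂ)) w * wigner u u w)
        + ((gaussConst V * ∫ z, a z * ‖stft u z‖ ^ 2 : ℝ) : ℂ) := by
    rw [← hAW, ← integral_add, ← integral_const_mul]
    · congr 1
      ext w
      rw [hgd]
      ring
    · exact hWi.bdd_mul (c := I * M) hd.continuous.aestronglyMeasurable
        (Filter.Eventually.of_forall hd.norm_le)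
    · have := hprod2.integral_prod_left
      refine this.congr (Filter.Eventually.of_forall fun w => ?_)
      simp only
      rw [← integral_mul_const]
      congr 1
      ext z
      ring
  have hlow : c * (windowNorm V ^ 2 * ‖u.toLp 2 (volume : Measure V)‖ ^ 2)
      ≤ ∫ z, a z * ‖stft u z‖ ^ 2 := by
    rw [← integral_norm_stft_sq, ← integral_const_mul]
    have har : Continuous a := by
      have := Complex.continuous_re.comp hac
      exact this
    refine integral_mono ((integrable_norm_stft_sq u).const_mul c)
      ((integrable_norm_stft_sq u).bdd_mul (c := B) har.aestronglyMeasurable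
        (Filter.Eventually.of_forall fun z => by simpa using hB z)) fun z => ?_
    exact mul_le_mul_of_nonneg_right (hca z) (by positivity)
  have hre := congrArg Complex.re hsum
  rw [Complex.re_ofReal_mul, Complex.add_re, Complex.ofReal_re] at hre
  have h5 : -(C * (I * M) * ‖u.toLp 2 (volume : Measure V)‖ * ‖u.toLp 2 (volume : Measure V)‖)
      ≤ (∫ w, gaussDiff (fun w => (a w : ℂ)) w * wigner u u w).re :=
    (neg_le_neg herr).trans (neg_le_of_abs_le (Complex.abs_re_le_norm _))
  have h6 := mul_le_mul_of_nonneg_left hlow hg.le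
  rw [← mul_le_mul_iff_right₀ hc₁p, hre]
  calc _ = gaussConst V * (c * (windowNorm V ^ 2 * ‖u.toLp 2 (volume : Measure V)‖ ^ 2))
        - C * (I * M) * ‖u.toLp 2 (volume : Measure V)‖ * ‖u.toLp 2 (volume : Measure V)‖ := by
        field_simp
    _ ≤ _ := by linarith

end Garding

/-! ### Weyl operators on the space of square integrable functions -/

section Duality

variable {V : Type} [NormedAddCommGroup V] [InnerProductSpace ℝ V] [FiniteDimensional ℝ V]
  [MeasurableSpace V] [BorelSpace V]

lemma integrable_schwartz_mul {g : V → ℂ} (hg : Continuous g) {B : ℝ} (hB : ∀ x, ‖g x‖ ≤ B)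
    (v : 𝓢(V, ℂ)) : Integrable fun x => v x * g x :=
  v.integrable.mul_bdd (c := B) hg.aestronglyMeasurable (Filter.Eventually.of_forall hB)

lemma denseRange_schwartz_toLp :
    DenseRange fun u : 𝓢(V, ℂ) => u.toLp 2 (volume : Measure V) :=
  SchwartzMap.denseRange_toLpCLM (p := 2) (by simp)

/-- A bounded continuous function which is a bounded functional on the Schwartz functions, for the
`L²` norm, is square integrable. -/
lemma exists_ae_eq_of_norm_integral_le {g : V → ℂ} (hg : Continuous g) {B : ℝ}
    (hB : ∀ x, ‖g x‖ ≤ B) {C : ℝ} (hC0 : 0 ≤ C)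
    (hC : ∀ v : 𝓢(V, ℂ), ‖∫ x, v x * g x‖ ≤ C * ‖v.toLp 2 (volume : Measure V)‖) :
    ∃ w : L2 V, w =ᵐ[volume] g ∧ ‖w‖ ≤ C := by
  let l₀ : 𝓢(V, ℂ) →ₗ[ℂ] ℂ :=
    { toFun := fun v => ∫ x, v x * g x
      map_add' := fun u v => by
        rw [← integral_add (integrable_schwartz_mul hg hB u) (integrable_schwartz_mul hg hB v)]
        simp [add_mul]
      map_smul' := fun c v => by
        simp only [smul_apply, smul_eq_mul, mul_assoc, RingHom.id_apply]
        rw [integral_const_mul] }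
  let e : 𝓢(V, ℂ) →ₗ[ℂ] L2 V := (SchwartzMap.toLpCLM ℂ ℂ 2 (volume : Measure V)).toLinearMap
  have he : DenseRange e := denseRange_schwartz_toLp
  let l : L2 V →L[ℂ] ℂ := l₀.extendOfNorm e
  have hl : ∀ v : 𝓢(V, ℂ), l (v.toLp 2 volume) = ∫ x, v x * g x := fun v =>
    LinearMap.extendOfNorm_eq he ⟨C, hC⟩ v
  set w₀ : L2 V := (InnerProductSpace.toDual ℂ (L2 V)).symm l
  have hw₀ : ∀ φ, inner ℂ w₀ φ = l φ := fun φ => InnerProductSpace.toDual_symm_apply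
  have hn : ‖w₀‖ ≤ C := by
    rw [LinearIsometryEquiv.norm_map]
    exact LinearMap.opNorm_extendOfNorm_le he hC0 hC
  refine ⟨star w₀, ?_, by rwa [Lp.norm_def, eLpNorm_congr_ae (Lp.coeFn_star w₀), eLpNorm_star,
    ← Lp.norm_def]⟩
  have hL : LocallyIntegrable (star w₀ : L2 V) volume :=
    (Lp.memLp (star w₀)).locallyIntegrable (by norm_num)
  refine ae_eq_of_integral_contDiff_smul_eq hL hg.locallyIntegrable fun φ h1 h2 => ?_
  let v : 𝓢(V, ℂ) := (h2.comp_left (g := fun t : ℝ => (t : ℂ)) (by simp)).toSchwartzMap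
    (Complex.ofRealCLM.contDiff.comp h1)
  have hv : ∀ x, v x = (φ x : ℂ) := fun x => rfl
  have h := (hw₀ (v.toLp 2 volume)).trans (hl v)
  rw [L2.inner_def] at h
  simp only [hv] at h
  simp only [Complex.real_smul]
  rw [← h]
  refine integral_congr_ae ?_
  filter_upwards [v.coeFn_toLp 2 volume, Lp.coeFn_star w₀] with x h3 h4
  rw [h3, h4, hv, Pi.star_apply, RCLike.inner_apply, RCLike.star_def]

end Duality

section Dilation

variable {V : Type} [NormedAddCommGroup V] [NormedSpace ℝ V]

/-- The Schwartz function `x ↦ u (c • x)`. -/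
def schwartzDilate (c : ℝ) (hc : c ≠ 0) (u : 𝓢(V, ℂ)) : 𝓢(V, ℂ) :=
  SchwartzMap.compCLMOfContinuousLinearEquiv ℝ
    (ContinuousLinearEquiv.smulLeft (Units.mk0 c hc) : V ≃L[ℝ] V) u

@[simp] lemma schwartzDilate_apply (c : ℝ) (hc : c ≠ 0) (u : 𝓢(V, ℂ)) (x : V) :
    schwartzDilate c hc u x = u (c • x) := rfl

variable [FiniteDimensional ℝ V] [MeasurableSpace V] [BorelSpace V]

lemma integral_eq_integral_smul {F : Type} [NormedAddCommGroup F] [NormedSpace ℝ F]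
    (μ : Measure V) [μ.IsAddHaarMeasure] {c : ℝ} (hc : 0 < c) (f : V → F) :
    ∫ x, f x ∂μ = c ^ Module.finrank ℝ V • ∫ x, f (c • x) ∂μ := by
  rw [Measure.integral_comp_smul, smul_smul, abs_of_pos (by positivity),
    mul_inv_cancel₀ (by positivity), one_smul]

lemma norm_toLp_schwartzDilate_sq (μ : Measure V) [μ.IsAddHaarMeasure] {c : ℝ} (hc : 0 < c)
    (u : 𝓢(V, ℂ)) : c ^ Module.finrank ℝ V * ‖(schwartzDilate c hc.ne' u).toLp 2 μ‖ ^ 2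
      = ‖u.toLp 2 μ‖ ^ 2 := by
  have h : ∀ v : 𝓢(V, ℂ), ‖v.toLp 2 μ‖ ^ 2 = ∫ x, ‖v x‖ ^ 2 ∂μ := fun v => by
    have := SchwartzMap.inner_toL2_toL2_eq v v (μ := μ)
    rw [inner_self_eq_norm_sq_to_K] at this
    simp only [inner_self_eq_norm_sq_to_K, Complex.coe_algebraMap, ← Complex.ofReal_pow] at this
    rw [integral_complex_ofReal] at this
    exact_mod_cast this
  rw [h, h, integral_eq_integral_smul μ hc (fun x => ‖u x‖ ^ 2), smul_eq_mul]
  rfl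

end Dilation

section Quantization

variable {m : ℕ}

open Real (fourierChar)

/-- `Op^w_ħ(a) u`. -/
def weylFun (ħ : ℝ) (a : E m × E m → ℝ) (u : E m → ℂ) : E m → ℂ :=
  weyl pairE ħ (fun y η (v : ℂ) => (a (y, η) : ℂ) • v) u

/-- The length `√(2πħ)`. -/
def planckLength (ħ : ℝ) : ℝ := Real.sqrt (2 * Real.pi * ħ)

lemma planckLength_pos {ħ : ℝ} (hħ : 0 < ħ) : 0 < planckLength ħ :=
  Real.sqrt_pos.2 (by positivity)

lemma planckLength_sq {ħ : ℝ} (hħ : 0 < ħ) : planckLength ħ ^ 2 = 2 * Real.pi * ħ :=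
  Real.sq_sqrt (by positivity)

/-- The symbol `w ↦ a (√(2πħ) w)`, which has the quantization of `a` with `2πħ = 1`. -/
def scaledSymbol (ħ : ℝ) (a : E m × E m → ℝ) (w : E m × E m) : ℂ := (a (planckLength ħ • w) : ℂ)

lemma exp_eq_fourierChar {ħ t : ℝ} (hħ : 0 < ħ) :
    Complex.exp (Complex.I * ((planckLength ħ ^ 2 * t / ħ : ℝ) : ℂ)) = (fourierChar t : ℂ) := by
  rw [Real.fourierChar_apply, planckLength_sq hħ, mul_comm Complex.I]
  congr 3
  field_simp

lemma inner_div_eq {ħ : ℝ} (hħ : 0 < ħ) (x y ξ : E m) :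
    inner ℝ (x - planckLength ħ • y) (planckLength ħ • ξ)
      = planckLength ħ ^ 2 * inner ℝ ((planckLength ħ)⁻¹ • x - y) ξ := by
  have h := (planckLength_pos hħ).ne'
  rw [inner_smul_right, inner_sub_left, inner_sub_left, inner_smul_left, inner_smul_left]
  simp only [conj_trivial]
  field_simp

lemma weylFun_inner_eq {ħ : ℝ} (hħ : 0 < ħ) (a : E m × E m → ℝ) (u : E m → ℂ) (x ξ : E m) :
    ∫ x', Complex.exp (Complex.I * ((pairE (x - x') (planckLength ħ • ξ) / ħ : ℝ) : ℂ)) •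
        (a ((1 / 2 : ℝ) • (x + x'), planckLength ħ • ξ) : ℂ) • u x'
      = (planckLength ħ : ℂ) ^ m * weylInner (scaledSymbol ħ a) (fun y => u (planckLength ħ • y))
          ((planckLength ħ)⁻¹ • x) ξ := by
  have h := (planckLength_pos hħ).ne'
  rw [integral_eq_integral_smul volume (planckLength_pos hħ), weylInner, Complex.real_smul,
    finrank_euclideanSpace_fin, Complex.ofReal_pow]
  congr 2
  ext y
  rw [pairE, inner_div_eq hħ, exp_eq_fourierChar hħ, scaledSymbol, smul_eq_mul, smul_eq_mul,
    Prod.smul_mk, smul_comm _ (1 / 2 : ℝ), smul_add (planckLength ħ), smul_inv_smul₀ h]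

lemma weylFun_eq {ħ : ℝ} (hħ : 0 < ħ) (a : E m × E m → ℝ) (u : E m → ℂ) (x : E m) :
    weylFun ħ a u x = weylOp (scaledSymbol ħ a) (fun y => u (planckLength ħ • y))
      ((planckLength ħ)⁻¹ • x) := by
  have h := (planckLength_pos hħ).ne'
  have hc : (planckLength ħ : ℂ) ≠ 0 := by exact_mod_cast h
  have hsq : (2 * (Real.pi : ℂ) * ħ) = (planckLength ħ : ℂ) ^ 2 := by
    rw [← Complex.ofReal_pow, planckLength_sq hħ]
    push_cast
    rfl
  rw [weylFun, weyl, integral_eq_integral_smul volume (planckLength_pos hħ), weylOp]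
  simp only [weylFun_inner_eq hħ]
  rw [integral_const_mul, Complex.real_smul, finrank_euclideanSpace_fin, hsq, smul_eq_mul,
    Complex.ofReal_pow, ← mul_assoc (_ ^ m), ← mul_pow, ← sq, inv_mul_cancel_left₀ (by positivity)]

lemma scaledSymbol_allBdd {ħ : ℝ} {a : E m × E m → ℝ}
    (ha : AllBdd fun w => (a w : ℂ)) : AllBdd (scaledSymbol ħ a) := by
  have e : scaledSymbol ħ a = fun w => (fun w => (a w : ℂ)) (0 +
      (planckLength ħ • ContinuousLinearMap.id ℝ (E m × E m)) w) := by
    ext w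
    simp [scaledSymbol]
  refine ⟨?_, fun k => ?_⟩
  · rw [e]
    exact ha.1.comp (by fun_prop)
  · obtain ⟨C, hC⟩ := ha.2 k
    refine ⟨C * ‖planckLength ħ • ContinuousLinearMap.id ℝ (E m × E m)‖ ^ k, fun w => ?_⟩
    rw [e]
    exact (norm_iteratedFDeriv_comp_clm_le ha.1 0 _ k w).trans (by gcongr; exact hC _)

lemma norm_iteratedFDeriv_scaledSymbol_le {ħ : ℝ} {a : E m × E m → ℝ}
    (ha : AllBdd fun w => (a w : ℂ)) {k : ℕ} {C : ℝ}
    (hC : ∀ w, ‖iteratedFDeriv ℝ k (fun w => (a w : ℂ)) w‖ ≤ C) (w : E m × E m) :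
    ‖iteratedFDeriv ℝ k (scaledSymbol ħ a) w‖ ≤ C * planckLength ħ ^ k := by
  have e : scaledSymbol ħ a = fun w => (fun w => (a w : ℂ)) (0 +
      (planckLength ħ • ContinuousLinearMap.id ℝ (E m × E m)) w) := by
    ext w
    simp [scaledSymbol]
  have h0 : 0 ≤ planckLength ħ := Real.sqrt_nonneg _
  have h1 : ‖planckLength ħ • ContinuousLinearMap.id ℝ (E m × E m)‖ ≤ planckLength ħ := by
    refine ContinuousLinearMap.opNorm_le_bound _ h0 fun w => ?_
    simp [norm_smul, abs_of_nonneg h0]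
  have hC0 : 0 ≤ C := (norm_nonneg _).trans (hC w)
  rw [e]
  refine (norm_iteratedFDeriv_comp_clm_le ha.1 0 _ k w).trans ?_
  gcongr
  exact hC _

lemma AllBdd.exists_bddDeriv_scaledSymbol {a : E m × E m → ℝ} (ha : AllBdd fun w => (a w : ℂ))
    (ħ : ℝ) : ∃ M, BddDeriv (Module.finrank ℝ (E m × E m) + 1) M (scaledSymbol ħ a) :=
  (scaledSymbol_allBdd ha).exists_bddDeriv _

lemma finrank_lt_finrank_prod_add_one :
    Module.finrank ℝ (E m) < Module.finrank ℝ (E m × E m) + 1 := by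
  rw [Module.finrank_prod]
  omega

lemma weylFun_eq_weylOp_dilate {ħ : ℝ} (hħ : 0 < ħ) (a : E m × E m → ℝ) (u : 𝓢(E m, ℂ)) (x : E m) :
    weylFun ħ a u x = weylOp (scaledSymbol ħ a) (schwartzDilate _ (planckLength_pos hħ).ne' u)
      ((planckLength ħ)⁻¹ • x) :=
  weylFun_eq hħ a u x

lemma continuous_weylFun {ħ : ℝ} (hħ : 0 < ħ) {a : E m × E m → ℝ}
    (ha : AllBdd fun w => (a w : ℂ)) (u : 𝓢(E m, ℂ)) : Continuous (weylFun ħ a u) := by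
  obtain ⟨M, hM⟩ := ha.exists_bddDeriv_scaledSymbol ħ
  simp only [funext (weylFun_eq_weylOp_dilate hħ a u)]
  exact (continuous_weylOp hM finrank_lt_finrank_prod_add_one _).comp (by fun_prop)

lemma exists_norm_weylFun_le {ħ : ℝ} (hħ : 0 < ħ) {a : E m × E m → ℝ}
    (ha : AllBdd fun w => (a w : ℂ)) (u : 𝓢(E m, ℂ)) : ∃ B, ∀ x, ‖weylFun ħ a u x‖ ≤ B := by
  obtain ⟨M, hM⟩ := ha.exists_bddDeriv_scaledSymbol ħ
  obtain ⟨B, hB⟩ := exists_norm_weylOp_le hM finrank_lt_finrank_prod_add_one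
    (schwartzDilate _ (planckLength_pos hħ).ne' u)
  exact ⟨B, fun x => by rw [weylFun_eq_weylOp_dilate hħ]; exact hB _⟩

lemma integral_conj_mul_weylFun {ħ : ℝ} (hħ : 0 < ħ) {a : E m × E m → ℝ}
    (ha : AllBdd fun w => (a w : ℂ)) (u v : 𝓢(E m, ℂ)) :
    ∫ x, (starRingEnd ℂ) (v x) * weylFun ħ a u x
      = (planckLength ħ : ℂ) ^ m * ∫ w, scaledSymbol ħ a w *
          wigner (schwartzDilate _ (planckLength_pos hħ).ne' u)
            (schwartzDilate _ (planckLength_pos hħ).ne' v) w := by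
  obtain ⟨M, hM⟩ := ha.exists_bddDeriv_scaledSymbol ħ
  rw [← integral_conj_mul_weylOp hM finrank_lt_finrank_prod_add_one,
    integral_eq_integral_smul volume (planckLength_pos hħ), finrank_euclideanSpace_fin,
    Complex.real_smul, Complex.ofReal_pow]
  simp only [weylFun_eq_weylOp_dilate hħ, inv_smul_smul₀ (planckLength_pos hħ).ne',
    schwartzDilate_apply]

lemma weylInner_add {N : ℕ} {M : ℝ} {a : E m × E m → ℂ} (ha : BddDeriv N M a) (u v : 𝓢(E m, ℂ))
    (x ξ : E m) : weylInner a (u + v) x ξ = weylInner a u x ξ + weylInner a v x ξ := by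
  have hac := ha.continuous
  have hi : ∀ u : 𝓢(E m, ℂ), Integrable fun y =>
      (fourierChar (inner ℝ (x - y) ξ) : ℂ) * (a ((1 / 2 : ℝ) • (x + y), ξ) * u y) := fun u => by
    refine (u.integrable.norm.const_mul M).mono' (Continuous.aestronglyMeasurable ?_)
      (Filter.Eventually.of_forall fun y => ?_)
    · have := u.continuous
      fun_prop
    · rw [norm_mul, Circle.norm_coe, one_mul, norm_mul]
      gcongr
      exact ha.norm_le _
  rw [weylInner, weylInner, weylInner, ← integral_add (hi u) (hi v)]
  simp only [Pi.add_apply, mul_add]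

lemma weylFun_add {ħ : ℝ} (hħ : 0 < ħ) {a : E m × E m → ℝ}
    (ha : AllBdd fun w => (a w : ℂ)) (u v : 𝓢(E m, ℂ)) (x : E m) :
    weylFun ħ a (u + v : 𝓢(E m, ℂ)) x = weylFun ħ a u x + weylFun ħ a v x := by
  obtain ⟨M, hM⟩ := ha.exists_bddDeriv_scaledSymbol ħ
  simp only [weylFun_eq_weylOp_dilate hħ]
  rw [weylOp, weylOp, weylOp, ← integral_add
    (integrable_weylInner hM finrank_lt_finrank_prod_add_one _ _)
    (integrable_weylInner hM finrank_lt_finrank_prod_add_one _ _)]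
  simp only [← weylInner_add hM]
  rfl

lemma weylFun_const_smul (ħ : ℝ) (a : E m × E m → ℝ) (c : ℂ) (u : E m → ℂ) (x : E m) :
    weylFun ħ a (c • u) x = c * weylFun ħ a u x := by
  simp only [weylFun, weyl, Pi.smul_apply, smul_eq_mul]
  rw [mul_left_comm c, ← integral_const_mul]
  simp only [← integral_const_mul]
  congr 3
  ext ξ
  congr 1
  ext y
  ring

lemma mul_mul_eq_mul_of_sq {c x y : ℝ} (hc : 0 ≤ c) (h1 : ℝ) (h2 : ℝ)
    (hx : c * h1 ^ 2 = x ^ 2) (hy : c * h2 ^ 2 = y ^ 2) (h1' : 0 ≤ h1) (h2' : 0 ≤ h2) (hx' : 0 ≤ x)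
    (hy' : 0 ≤ y) : c * (h1 * h2) = x * y := by
  refine (pow_left_inj₀ (by positivity) (by positivity) two_ne_zero).1 ?_
  rw [mul_pow x, ← hx, ← hy]
  ring

/-- The Weyl quantization of a symbol with bounded derivatives is a bounded operator; it is
symmetric if the symbol is real. -/
lemma exists_weylCLM {ħ : ℝ} (hħ : 0 < ħ) {a : E m × E m → ℝ} (ha : AllBdd fun w => (a w : ℂ)) :
    ∃ A : L2 (E m) →L[ℂ] L2 (E m), ∀ u : 𝓢(E m, ℂ), A (u.toLp 2 volume) =ᵐ[volume] weylFun ħ a u := by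
  obtain ⟨M, hM⟩ := ha.exists_bddDeriv_scaledSymbol ħ
  obtain ⟨C, hC0, hC⟩ := exists_norm_integral_mul_wigner_le (V := E m)
  have hl := planckLength_pos hħ
  have key : ∀ u : 𝓢(E m, ℂ), ∃ w : L2 (E m), w =ᵐ[volume] weylFun ħ a u ∧
      ‖w‖ ≤ C * M * ‖u.toLp 2 (volume : Measure (E m))‖ := by
    intro u
    obtain ⟨B, hB⟩ := exists_norm_weylFun_le hħ ha u
    refine exists_ae_eq_of_norm_integral_le (continuous_weylFun hħ ha u) hB
      (mul_nonneg (mul_nonneg hC0 hM.nonneg) (norm_nonneg _)) fun v => ?_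
    have h1 := integral_conj_mul_weylFun hħ ha u (schwartzConj v)
    simp only [schwartzConj_apply, Complex.conj_conj] at h1
    rw [h1, norm_mul, norm_pow, Complex.norm_real, Real.norm_of_nonneg hl.le]
    have hv : ∀ v : 𝓢(E m, ℂ), ‖(schwartzConj v).toLp 2 (volume : Measure (E m))‖
        = ‖v.toLp 2 (volume : Measure (E m))‖ := fun v => by
      rw [SchwartzMap.norm_toLp, SchwartzMap.norm_toLp]
      congr 1
      refine eLpNorm_congr_norm_ae (Filter.Eventually.of_forall fun x => ?_)
      simp
    have h2 := norm_toLp_schwartzDilate_sq (volume : Measure (E m)) hl u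
    have h3 := norm_toLp_schwartzDilate_sq (volume : Measure (E m)) hl (schwartzConj v)
    rw [finrank_euclideanSpace_fin] at h2 h3
    have h4 := mul_mul_eq_mul_of_sq (by positivity) _ _ h2 h3 (norm_nonneg _) (norm_nonneg _)
      (norm_nonneg _) (norm_nonneg _)
    rw [hv v] at h4
    calc _ ≤ planckLength ħ ^ m * (C * M * ‖_‖ * ‖_‖) := by
          gcongr
          exact hC M _ hM _ _
      _ = _ := by
          rw [mul_assoc (C * M), mul_left_comm, h4]
          ring
  choose T hT hTn using key
  let f : 𝓢(E m, ℂ) →ₗ[ℂ] L2 (E m) :=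
    { toFun := T
      map_add' := fun u v => by
        refine Lp.ext ?_
        filter_upwards [hT u, hT v, hT (u + v), Lp.coeFn_add (T u) (T v)] with x h1 h2 h3 h4
        rw [h3, h4, Pi.add_apply, h1, h2, weylFun_add hħ ha]
      map_smul' := fun c u => by
        refine Lp.ext ?_
        filter_upwards [hT u, hT (c • u), Lp.coeFn_smul c (T u)] with x h1 h3 h4
        rw [h3, RingHom.id_apply, h4, Pi.smul_apply, h1, smul_eq_mul]
        exact weylFun_const_smul ħ a c u x }
  let e : 𝓢(E m, ℂ) →ₗ[ℂ] L2 (E m) :=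
    (SchwartzMap.toLpCLM ℂ ℂ 2 (volume : Measure (E m))).toLinearMap
  refine ⟨f.extendOfNorm e, fun u => ?_⟩
  have : f.extendOfNorm e (u.toLp 2 volume) = T u :=
    LinearMap.extendOfNorm_eq (f := f) (e := e) denseRange_schwartz_toLp ⟨_, hTn⟩ u
  rw [this]
  exact hT u

open Classical in
/-- The bounded operator `Op^w_ħ(a)`. -/
def weylCLM (ħ : ℝ) (a : E m × E m → ℝ) : L2 (E m) →L[ℂ] L2 (E m) :=
  if h : 0 < ħ ∧ AllBdd fun w => (a w : ℂ) then (exists_weylCLM h.1 h.2).choose else 0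

lemma weylCLM_toLp {ħ : ℝ} (hħ : 0 < ħ) {a : E m × E m → ℝ} (ha : AllBdd fun w => (a w : ℂ))
    (u : 𝓢(E m, ℂ)) : weylCLM ħ a (u.toLp 2 volume) =ᵐ[volume] weylFun ħ a u := by
  rw [weylCLM, dif_pos ⟨hħ, ha⟩]
  exact (exists_weylCLM hħ ha).choose_spec u

lemma inner_weylCLM {ħ : ℝ} (hħ : 0 < ħ) {a : E m × E m → ℝ} (ha : AllBdd fun w => (a w : ℂ))
    (u v : 𝓢(E m, ℂ)) : inner ℂ (v.toLp 2 volume) (weylCLM ħ a (u.toLp 2 volume))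
      = (planckLength ħ : ℂ) ^ m * ∫ w, scaledSymbol ħ a w *
          wigner (schwartzDilate _ (planckLength_pos hħ).ne' u)
            (schwartzDilate _ (planckLength_pos hħ).ne' v) w := by
  rw [← integral_conj_mul_weylFun hħ ha, L2.inner_def]
  refine integral_congr_ae ?_
  filter_upwards [v.coeFn_toLp 2 volume, weylCLM_toLp hħ ha u] with x h1 h2
  rw [h1, h2, RCLike.inner_apply, mul_comm]

lemma inner_weylCLM_comm {ħ : ℝ} (hħ : 0 < ħ) {a : E m × E m → ℝ} (ha : AllBdd fun w => (a w : ℂ))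
    (u v : 𝓢(E m, ℂ)) : inner ℂ (weylCLM ħ a (u.toLp 2 volume)) (v.toLp 2 volume)
      = inner ℂ (u.toLp 2 volume) (weylCLM ħ a (v.toLp 2 volume)) := by
  rw [← inner_conj_symm, inner_weylCLM hħ ha, inner_weylCLM hħ ha, map_mul, map_pow,
    Complex.conj_ofReal, ← integral_conj]
  congr 2
  ext w
  rw [map_mul, conj_wigner, scaledSymbol, Complex.conj_ofReal]

lemma isSelfAdjoint_weylCLM {ħ : ℝ} (hħ : 0 < ħ) {a : E m × E m → ℝ}
    (ha : AllBdd fun w => (a w : ℂ)) : IsSelfAdjoint (weylCLM ħ a) := by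
  refine ContinuousLinearMap.isSelfAdjoint_iff_isSymmetric.2 fun x y => ?_
  refine (denseRange_schwartz_toLp (V := E m)).induction_on₂
    (p := fun x y => inner ℂ (weylCLM ħ a x) y = inner ℂ x (weylCLM ħ a y)) ?_ ?_ x y
  · exact isClosed_eq (by fun_prop) (by fun_prop)
  · exact fun u v => inner_weylCLM_comm hħ ha u v

lemma weylCLM_ext {A B : L2 (E m) →L[ℂ] L2 (E m)}
    (h : ∀ u v : 𝓢(E m, ℂ), inner ℂ (v.toLp 2 volume) (A (u.toLp 2 volume))
      = inner ℂ (v.toLp 2 (volume : Measure (E m))) (B (u.toLp 2 volume))) : A = B := by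
  refine ContinuousLinearMap.ext fun x => ?_
  refine (denseRange_schwartz_toLp (V := E m)).induction_on x
    (isClosed_eq (by fun_prop) (by fun_prop)) fun u => ?_
  refine ext_inner_left ℂ fun y => ?_
  refine (denseRange_schwartz_toLp (V := E m)).induction_on y
    (isClosed_eq (by fun_prop) (by fun_prop)) fun v => h u v

/-- The quantization is bounded from below by a positive constant if the symbol is and `ħ` is
small. -/
lemma exists_le_re_inner_weylCLM {a : E m × E m → ℝ} (ha : AllBdd fun w => (a w : ℂ)) {c : ℝ}
    (hc : 0 < c) (hca : ∀ w, c ≤ a w) : ∃ ħ₀ > 0, ∃ c' > 0, ∀ ħ ∈ Set.Ioc 0 ħ₀, ∀ u,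
      c' * ‖u‖ ^ 2 ≤ (inner ℂ (weylCLM ħ a u) u).re := by
  obtain ⟨κ, C, hκ, hC0, hG⟩ := exists_le_re_integral_mul_wigner (V := E m)
  set N := Module.finrank ℝ (E m × E m) + 1 with hN
  choose D hD using ha.2
  set M := ∑ k ∈ Finset.range (N + 1), |D (k + 1)| with hM
  have hM0 : 0 ≤ M := Finset.sum_nonneg fun _ _ => abs_nonneg _
  set l := min 1 (κ * c / (2 * (C * M + 1))) with hl
  have hl0 : 0 < l := lt_min one_pos (by positivity)
  refine ⟨l ^ 2 / (2 * Real.pi), by positivity, κ * c / 2, by positivity, fun ħ hħ u => ?_⟩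
  have hp := planckLength_pos hħ.1
  have hpl : planckLength ħ ≤ l := by
    refine Real.sqrt_le_iff.2 ⟨hl0.le, ?_⟩
    have := (le_div_iff₀ (by positivity)).1 hħ.2
    linarith
  have hbd : ∀ k ≤ N, ∀ w, ‖iteratedFDeriv ℝ (k + 1) (scaledSymbol ħ a) w‖
      ≤ M * planckLength ħ := by
    intro k hk w
    refine (norm_iteratedFDeriv_scaledSymbol_le ha (hD (k + 1)) w).trans ?_
    have h1 : D (k + 1) ≤ M := (le_abs_self _).trans (Finset.single_le_sum
      (f := fun k => |D (k + 1)|) (fun _ _ => abs_nonneg _)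
      (Finset.mem_range.2 (Nat.lt_succ_iff.2 hk)))
    have h2 : planckLength ħ ^ (k + 1) ≤ planckLength ħ := by
      rw [pow_succ]
      exact mul_le_of_le_one_left hp.le (pow_le_one₀ hp.le (hpl.trans (min_le_left _ _)))
    exact mul_le_mul h1 h2 (by positivity) hM0
  have hsmall : C * (M * planckLength ħ) ≤ κ * c / 2 := by
    have h3 : planckLength ħ ≤ κ * c / (2 * (C * M + 1)) := hpl.trans (min_le_right _ _)
    have h4 : 0 ≤ C * M := mul_nonneg hC0 hM0
    rw [le_div_iff₀ (by positivity)] at h3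
    nlinarith
  refine (denseRange_schwartz_toLp (V := E m)).induction_on u
    (isClosed_le (by fun_prop) (by fun_prop)) fun u => ?_
  have h5 := hG c (M * planckLength ħ) (fun w => a (planckLength ħ • w))
    (scaledSymbol_allBdd ha) (fun w => hca _) hbd (schwartzDilate _ hp.ne' u)
  have h6 := norm_toLp_schwartzDilate_sq (volume : Measure (E m)) hp u
  rw [finrank_euclideanSpace_fin] at h6
  rw [← inner_conj_symm, Complex.conj_re, inner_weylCLM hħ.1 ha, ← Complex.ofReal_pow,
    Complex.re_ofReal_mul, ← h6]
  calc _ = planckLength ħ ^ m * (κ * c / 2 *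
        ‖(schwartzDilate _ hp.ne' u).toLp 2 (volume : Measure (E m))‖ ^ 2) := by ring
    _ ≤ _ := by
        refine mul_le_mul_of_nonneg_left (le_trans ?_ h5) (by positivity)
        gcongr
        linarith

end Quantization

/-! ### Symbols -/

section Symmetry

variable {V F : Type} [NormedAddCommGroup V] [NormedSpace ℝ V] [NormedAddCommGroup F]
  [NormedSpace ℝ F]

lemma fderiv_iteratedFDeriv_apply {f : V → F} (hf : ContDiff ℝ ∞ f) (n : ℕ) (x v : V)
    (w : Fin n → V) : fderiv ℝ (iteratedFDeriv ℝ n f) x v w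
      = fderiv ℝ (fun y => iteratedFDeriv ℝ n f y w) x v := by
  have hd : DifferentiableAt ℝ (iteratedFDeriv ℝ n f) x :=
    hf.differentiable_iteratedFDeriv (mod_cast WithTop.coe_lt_top _) x
  have h := (ContinuousMultilinearMap.apply ℝ (fun _ : Fin n => V) F w).hasFDerivAt.comp x
    hd.hasFDerivAt
  exact (congrArg (fun L : V →L[ℝ] F => L v) h.fderiv).symm

lemma iteratedFDeriv_comp_swap {f : V → F} (hf : ContDiff ℝ ∞ f) (n : ℕ) (i : Fin n)
    (v : Fin (n + 1) → V) (x : V) :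
    iteratedFDeriv ℝ (n + 1) f x (v ∘ Equiv.swap i.castSucc i.succ)
      = iteratedFDeriv ℝ (n + 1) f x v := by
  induction n generalizing x with
  | zero => exact i.elim0
  | succ n ih =>
    rw [iteratedFDeriv_succ_apply_left, iteratedFDeriv_succ_apply_left]
    refine Fin.cases ?_ (fun i => ?_) i
    · have key : ∀ (a b : V) (w : Fin n → V),
          fderiv ℝ (iteratedFDeriv ℝ (n + 1) f) x a (Fin.cons b w)
            = fderiv ℝ (fderiv ℝ (iteratedFDeriv ℝ n f)) x a b w := by
        intro a b w
        have hd : ContDiff ℝ ∞ (fderiv ℝ (iteratedFDeriv ℝ n f)) :=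
          (hf.iteratedFDeriv_right (m := ∞) (i := n) (mod_cast le_top)).fderiv_right (m := ∞) le_rfl
        have h1 := (((ContinuousMultilinearMap.apply ℝ (fun _ : Fin n => V) F w).comp
          (ContinuousLinearMap.apply ℝ (V [×n]→L[ℝ] F) b)).hasFDerivAt.comp x
          (hd.differentiable (by simp) x).hasFDerivAt)
        rw [fderiv_iteratedFDeriv_apply hf]
        exact congrArg (fun L : V →L[ℝ] F => L a) h1.fderiv
      have hs : IsSymmSndFDerivAt ℝ (iteratedFDeriv ℝ n f) x :=
        (hf.iteratedFDeriv_right (m := ∞) (i := n) (mod_cast le_top)).contDiffAt.isSymmSndFDerivAt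
          (by rw [minSmoothness_of_isRCLikeNormedField]; exact WithTop.coe_le_coe.2 (le_top : (2 : ℕ∞) ≤ ⊤))
      have e1 : Fin.tail (v ∘ Equiv.swap (Fin.castSucc (0 : Fin (n + 1))) (Fin.succ 0))
          = Fin.cons (v 0) (Fin.tail (Fin.tail v)) := by
        ext1 k
        refine Fin.cases ?_ (fun k => ?_) k
        · simp [Fin.tail]
        · have : Equiv.swap (0 : Fin (n + 2)) 1 k.succ.succ = k.succ.succ :=
            Equiv.swap_apply_of_ne_of_ne (Fin.succ_ne_zero _)
              (fun h => Fin.succ_ne_zero k (Fin.succ_injective _ h))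
          simp [Fin.tail, this]
      have e2 : Fin.tail v = Fin.cons (v 1) (Fin.tail (Fin.tail v)) := by
        ext1 k
        refine Fin.cases ?_ (fun k => ?_) k <;> simp [Fin.tail]
      rw [e1, e2, key, key, hs.eq]
      simp
    · have e1 : Fin.tail (v ∘ Equiv.swap (Fin.castSucc i.succ) (Fin.succ i.succ))
          = Fin.tail v ∘ Equiv.swap i.castSucc i.succ := by
        ext1 k
        simp only [Fin.tail, Function.comp_apply, Fin.castSucc_succ]
        congr 1
        exact ((Fin.succ_injective _).map_swap _ _ _).symm
      have e2 : Equiv.swap (Fin.castSucc i.succ) (Fin.succ i.succ) (0 : Fin (n + 2)) = 0 :=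
        Equiv.swap_apply_of_ne_of_ne (by simp [Fin.castSucc_succ, (Fin.succ_ne_zero _).symm])
          (Fin.succ_ne_zero _).symm
      rw [e1, Function.comp_apply, e2, fderiv_iteratedFDeriv_apply hf,
        fderiv_iteratedFDeriv_apply hf]
      simp only [ih i]

lemma iteratedFDeriv_comp_perm_of_contDiff {f : V → F} (hf : ContDiff ℝ ∞ f) {n : ℕ}
    (v : Fin n → V) (σ : Equiv.Perm (Fin n)) (x : V) :
    iteratedFDeriv ℝ n f x (v ∘ σ) = iteratedFDeriv ℝ n f x v := by
  cases n with
  | zero => rw [Subsingleton.elim (v ∘ σ) v]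
  | succ n =>
    have h : σ ∈ Submonoid.closure (Set.range fun i : Fin n => Equiv.swap i.castSucc i.succ) := by
      rw [Equiv.Perm.mclosure_swap_castSucc_succ]
      trivial
    induction h using Submonoid.closure_induction generalizing v with
    | mem σ hσ =>
      obtain ⟨i, rfl⟩ := hσ
      exact iteratedFDeriv_comp_swap hf n i v x
    | one => rfl
    | mul σ τ _ _ h1 h2 =>
      rw [Equiv.Perm.coe_mul, ← Function.comp_assoc, h2, h1]

end Symmetry

section Symbols

variable {m : ℕ}

/-- The standard basis vectors of `ℝᵐ × ℝᵐ`. -/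
def phaseBasis : Fin m ⊕ Fin m → E m × E m :=
  Sum.elim (fun i => (EuclideanSpace.single i (1 : ℝ), 0)) fun i => (0, EuclideanSpace.single i 1)

/-- The coordinates in `ℝᵐ × ℝᵐ`. -/
def phaseCoord (s : Fin m ⊕ Fin m) (w : E m × E m) : ℝ :=
  Sum.elim (fun i => w.1 i) (fun i => w.2 i) s

lemma abs_phaseCoord_le (s : Fin m ⊕ Fin m) (w : E m × E m) : |phaseCoord s w| ≤ ‖w‖ := by
  rcases s with i | i
  · exact (PiLp.norm_apply_le w.1 i).trans (norm_fst_le w)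
  · exact (PiLp.norm_apply_le w.2 i).trans (norm_snd_le w)

lemma sum_phaseCoord_smul (w : E m × E m) : ∑ s, phaseCoord s w • phaseBasis s = w := by
  rw [Fintype.sum_sum_type]
  ext i <;> simp [phaseBasis, phaseCoord, Finset.sum_apply, Prod.fst_sum, Prod.snd_sum,
    Pi.single_apply]

lemma norm_multilinear_le {k : ℕ} (T : ContinuousMultilinearMap ℝ (fun _ : Fin k => E m × E m) ℝ) :
    ‖T‖ ≤ ∑ r : Fin k → Fin m ⊕ Fin m, |T fun i => phaseBasis (r i)| := by
  refine T.opNorm_le_bound (Finset.sum_nonneg fun _ _ => abs_nonneg _) fun v => ?_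
  have h : T v = ∑ r : Fin k → Fin m ⊕ Fin m,
      (∏ i, phaseCoord (r i) (v i)) * T fun i => phaseBasis (r i) := by
    conv_lhs => rw [← funext fun i => sum_phaseCoord_smul (v i)]
    rw [T.map_sum]
    refine Finset.sum_congr rfl fun r _ => ?_
    rw [T.map_smul_univ, smul_eq_mul]
  rw [h, Finset.sum_mul]
  refine (norm_sum_le _ _).trans (Finset.sum_le_sum fun r _ => ?_)
  rw [norm_mul, mul_comm, Real.norm_eq_abs, norm_prod]
  gcongr with i
  exact abs_phaseCoord_le _ _

/-- A sequence of variables can be sorted. -/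
lemma exists_perm_append {α β : Type} {k : ℕ} (r : Fin k → α ⊕ β) :
    ∃ (p q : ℕ) (a : Fin p → α) (b : Fin q → β) (h : p + q = k) (σ : Equiv.Perm (Fin k)),
      ∀ i, r (σ i) = Fin.append (Sum.inl ∘ a) (Sum.inr ∘ b) (Fin.cast h.symm i) := by
  classical
  let P : Fin k → Prop := fun i => (r i).isLeft
  let e₁ := Fintype.equivFin {i // P i}
  let e₂ := Fintype.equivFin {i // ¬ P i}
  let e : Fin (Fintype.card {i // P i} + Fintype.card {i // ¬ P i}) ≃ Fin k :=
    finSumFinEquiv.symm.trans ((e₁.symm.sumCongr e₂.symm).trans (Equiv.sumCompl P))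
  have h : Fintype.card {i // P i} + Fintype.card {i // ¬ P i} = k := by
    simpa using Fintype.card_congr e
  refine ⟨_, _, fun i => (r (e₁.symm i)).getLeft (e₁.symm i).2,
    fun i => (r (e₂.symm i)).getRight (by simpa [P] using (e₂.symm i).2), h,
    (finCongr h.symm).trans e, fun i => ?_⟩
  obtain ⟨i, rfl⟩ := (finCongr h).surjective i
  induction i using Fin.addCases with
  | left i => simp [e]
  | right i => simp [e]

variable {κ : Type}

lemma IsSymbolFamily.exists_norm_iteratedFDeriv_le {ρ : ℝ} (hρ : 0 ≤ ρ) {a : κ → E m × E m → ℝ}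
    (h : IsSymbolFamily ρ a) (k : ℕ) : ∃ C, ∀ l w, ‖iteratedFDeriv ℝ k (a l) w‖ ≤ C := by
  choose C hC using h.2
  set B := ∑ p ∈ Finset.range (k + 1), ∑ q ∈ Finset.range (k + 1), |C p q| with hB
  refine ⟨∑ _r : Fin k → Fin m ⊕ Fin m, B, fun l w => (norm_multilinear_le _).trans
    (Finset.sum_le_sum fun r _ => ?_)⟩
  obtain ⟨p, q, α, γ, hk, σ, hσ⟩ := exists_perm_append r
  subst hk
  have h1 : iteratedFDeriv ℝ (p + q) (a l) w (fun i => phaseBasis (r i))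
      = iteratedFDeriv ℝ (p + q) (a l) w
        (Fin.append (fun s => ((EuclideanSpace.single (α s) (1 : ℝ) : E m), (0 : E m)))
        (fun t => ((0 : E m), (EuclideanSpace.single (γ t) (1 : ℝ) : E m)))) := by
    have h2 := iteratedFDeriv_comp_perm_of_contDiff (h.1 l) (fun i => phaseBasis (r i)) σ w
    rw [← h2]
    congr 1
    ext1 i
    rw [Function.comp_apply, hσ]
    induction i using Fin.addCases with
    | left i => simp [phaseBasis]
    | right i => simp [phaseBasis]
  rw [h1]
  refine (hC p q l α γ w.1 w.2).trans ?_
  have h3 : (1 + ‖w.2‖ ^ 2) ^ (-(ρ * q / 2)) ≤ 1 :=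
    Real.rpow_le_one_of_one_le_of_nonpos (by nlinarith [sq_nonneg ‖w.2‖])
      (neg_nonpos.2 (by positivity))
  have h4 : |C p q| ≤ B := by
    rw [hB, ← Finset.sum_product']
    exact Finset.single_le_sum (f := fun x : ℕ × ℕ => |C x.1 x.2|) (a := (p, q))
      (fun _ _ => abs_nonneg _) (by simp only [Finset.mem_product, Finset.mem_range]; omega)
  calc _ ≤ |C p q| * (1 + ‖w.2‖ ^ 2) ^ (-(ρ * q / 2)) := by
        gcongr
        exact le_abs_self _
    _ ≤ |C p q| * 1 := by gcongr
    _ ≤ B := by rwa [mul_one]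

lemma IsSymbolFamily.allBdd {ρ : ℝ} (hρ : 0 ≤ ρ) {a : κ → E m × E m → ℝ}
    (h : IsSymbolFamily ρ a) (l : κ) : AllBdd fun w => (a l w : ℂ) := by
  refine ⟨Complex.ofRealCLM.contDiff.comp (h.1 l), fun k => ?_⟩
  obtain ⟨C, hC⟩ := h.exists_norm_iteratedFDeriv_le hρ k
  refine ⟨C, fun w => ?_⟩
  have := Complex.ofRealLI.norm_iteratedFDeriv_comp_left ((h.1 l).contDiffAt (x := w))
    (i := k) (mod_cast le_top)
  exact this.le.trans (hC l w)

lemma IsSymbolFamily.comp {ρ : ℝ} {a : κ → E m × E m → ℝ} (h : IsSymbolFamily ρ a) {κ' : Type}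
    (g : κ' → κ) : IsSymbolFamily ρ fun l => a (g l) :=
  ⟨fun _ => h.1 _, fun p q => (h.2 p q).imp fun _ hC l => hC (g l)⟩

lemma IsSymbolFamily.add {ρ : ℝ} {a b : κ → E m × E m → ℝ} (ha : IsSymbolFamily ρ a)
    (hb : IsSymbolFamily ρ b) : IsSymbolFamily ρ fun l w => a l w + b l w := by
  refine ⟨fun l => (ha.1 l).add (hb.1 l), fun p q => ?_⟩
  obtain ⟨C, hC⟩ := ha.2 p q
  obtain ⟨D, hD⟩ := hb.2 p q
  refine ⟨C + D, fun l α γ y η => ?_⟩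
  have h1 : ContDiff ℝ (p + q : ℕ) (a l) := (ha.1 l).of_le (mod_cast le_top)
  have h2 : ContDiff ℝ (p + q : ℕ) (b l) := (hb.1 l).of_le (mod_cast le_top)
  rw [fun_iteratedFDeriv_add_apply h1.contDiffAt h2.contDiffAt, add_apply, add_mul]
  exact (abs_add_le _ _).trans (add_le_add (hC l α γ y η) (hD l α γ y η))

lemma IsSymbolFamily.const_mul {ρ : ℝ} {a : κ → E m × E m → ℝ} (ha : IsSymbolFamily ρ a)
    {c : κ → ℝ} {B : ℝ} (hc : ∀ l, |c l| ≤ B) : IsSymbolFamily ρ fun l w => c l * a l w := by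
  refine ⟨fun l => contDiff_const.mul (ha.1 l), fun p q => ?_⟩
  obtain ⟨C, hC⟩ := ha.2 p q
  refine ⟨B * C, fun l α γ y η => ?_⟩
  have h1 : ContDiff ℝ (p + q : ℕ) (a l) := (ha.1 l).of_le (mod_cast le_top)
  have h2 := iteratedFDeriv_const_smul_apply (𝕜 := ℝ) (a := c l) (h1.contDiffAt (x := (y, η)))
  change |iteratedFDeriv ℝ (p + q) (c l • a l) (y, η) _| ≤ _
  rw [h2, smul_apply, smul_eq_mul, abs_mul, mul_assoc]
  exact mul_le_mul (hc l) (hC l α γ y η) (abs_nonneg _) ((abs_nonneg _).trans (hc l))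

lemma isSymbolFamily_zero (ρ : ℝ) : IsSymbolFamily (m := m) ρ fun (_ : κ) _ => 0 := by
  refine ⟨fun l => contDiff_const, fun p q => ⟨0, fun l α γ y η => ?_⟩⟩
  simp [iteratedFDeriv_fun_zero]

lemma IsSymbolFamily.sum {ρ : ℝ} {ι : Type} (s : Finset ι) {a : ι → κ → E m × E m → ℝ}
    (ha : ∀ i, IsSymbolFamily ρ (a i)) : IsSymbolFamily ρ fun l w => ∑ i ∈ s, a i l w := by
  classical
  induction s using Finset.induction_on with
  | empty => simpa using isSymbolFamily_zero ρ
  | insert i s hi ih =>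
    simp only [Finset.sum_insert hi]
    exact (ha i).add ih

lemma isSymbolFamily_reducedSymbol {ρ : ℝ} {β : Fin m → E m × E m → ℝ} (hβ : IsSymbolFamily ρ β)
    {f : E m × E m → (Fin m → ℝ) → ℝ → ℝ}
    (hf : IsSymbolFamily ρ fun (s : (Fin m → ℝ) × ℝ) (w : E m × E m) => f w s.1 s.2)
    (n : Fin m → ℕ) (ħ₀ : ℝ) :
    IsSymbolFamily ρ fun ħ : Set.Ioc (0 : ℝ) ħ₀ => reducedSymbol β f n ħ := by
  have h1 : IsSymbolFamily ρ fun (ħ : Set.Ioc (0 : ℝ) ħ₀) (w : E m × E m) =>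
      ∑ j, (ħ * (2 * n j + 1) : ℝ) * β j w := by
    refine IsSymbolFamily.sum _ fun j => ?_
    refine (hβ.comp fun _ : Set.Ioc (0 : ℝ) ħ₀ => j).const_mul (B := ħ₀ * (2 * n j + 1)) fun ħ => ?_
    rw [abs_of_nonneg (mul_nonneg ħ.2.1.le (by positivity))]
    have := ħ.2.2
    gcongr
  have h2 := h1.add (hf.comp fun ħ : Set.Ioc (0 : ℝ) ħ₀ => (fun j => (ħ : ℝ) * (2 * n j + 1), (ħ : ℝ)))
  convert h2 using 3 with ħ w
  simp only [reducedSymbol, Finset.mul_sum]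
  congr 1
  exact Finset.sum_congr rfl fun j _ => by ring

end Symbols

/-! ### Quantizations as closed operators -/

section Graph

lemma schwartzClasses_eq {V : Type} [NormedAddCommGroup V] [NormedSpace ℝ V] [MeasureSpace V]
    [OpensMeasurableSpace V] [SecondCountableTopologyEither V ℂ]
    [(volume : Measure V).HasTemperateGrowth] :
    schwartzClasses V = (LinearMap.range
      (SchwartzMap.toLpCLM ℂ ℂ 2 (volume : Measure V)).toLinearMap : Submodule ℂ (L2 V)) := by
  ext g
  constructor
  · rintro ⟨u, hu⟩
    exact ⟨u, (Lp.ext (hu.trans (u.coeFn_toLp 2 volume).symm)).symm⟩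
  · rintro ⟨u, rfl⟩
    exact ⟨u, u.coeFn_toLp 2 volume⟩

lemma eq_toLp_of_ae_eq {V : Type} [NormedAddCommGroup V] [NormedSpace ℝ V] [MeasureSpace V]
    [OpensMeasurableSpace V] [SecondCountableTopologyEither V ℂ]
    [(volume : Measure V).HasTemperateGrowth] {g : L2 V} {u : 𝓢(V, ℂ)} (h : g =ᵐ[volume] u) :
    g = u.toLp 2 volume :=
  Lp.ext (h.trans (u.coeFn_toLp 2 volume).symm)

variable {m : ℕ}

lemma component_id {H : Type} [NormedAddCommGroup H] [InnerProductSpace ℂ H] [CompleteSpace H]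
    (ψ : H) : component (fun _ : Unit => LinearIsometry.id (R := ℂ) (E := H)) () ψ = ψ :=
  component_self _ () ψ

lemma weylGraph_essentiallySelfAdjoint {ħ : ℝ} (hħ : 0 < ħ) {a : E m × E m → ℝ}
    (ha : AllBdd fun w => (a w : ℂ)) :
    IsEssentiallySelfAdjoint (schwartzClasses (E m)) (weylGraph ħ a) ∧
      ∀ p, p ∈ (weylOperator ħ a).graph ↔ p.2 = weylCLM ħ a p.1 := by
  let J : Unit → L2 (E m) →ₗᵢ[ℂ] L2 (E m) := fun _ => LinearIsometry.id
  have hJ : IsOrthogonalSum J :=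
    ⟨fun i j h => (h rfl).elim, fun ψ h => (component_id ψ).symm.trans (h ())⟩
  have hmem : ∀ u : 𝓢(E m, ℂ),
      (u.toLp 2 volume, weylCLM ħ a (u.toLp 2 volume)) ∈ weylGraph ħ a := fun u =>
    ⟨u, u.coeFn_toLp 2 volume, weylCLM_toLp hħ ha u⟩
  have h := hJ.essentiallySelfAdjoint (A := fun _ => weylCLM ħ a)
    (fun _ => isSelfAdjoint_weylCLM hħ ha) (G := weylGraph ħ a)
    (LinearMap.range (SchwartzMap.toLpCLM ℂ ℂ 2 (volume : Measure (E m))).toLinearMap) ?_ ?_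
    (D₀ := Set.range fun u : 𝓢(E m, ℂ) => u.toLp 2 volume) denseRange_schwartz_toLp ?_
  · rw [← schwartzClasses_eq] at h
    refine ⟨h.1, fun p => ?_⟩
    rw [weylOperator, h.2, mem_diagonalGraph]
    exact ⟨fun h => by simpa only [J, component_id] using h (),
      fun h _ => (component_id _).trans (h.trans (by rw [component_id]))⟩
  · rintro ⟨g, g'⟩ ⟨u, h1, h2⟩ n
    rw [component_id, component_id]
    simp only at h1 h2 ⊢
    rw [eq_toLp_of_ae_eq h1]
    exact Lp.ext (h2.trans (weylCLM_toLp hħ ha u).symm)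
  · rw [← schwartzClasses_eq]
    ext g
    constructor
    · rintro ⟨p, ⟨u, h1, h2⟩, rfl⟩
      exact ⟨u, h1⟩
    · rintro ⟨u, hu⟩
      exact ⟨_, hmem u, (eq_toLp_of_ae_eq hu).symm⟩
  · rintro _ _ ⟨u, rfl⟩
    exact hmem u

end Graph

/-! ### Hermite functions of one variable -/

section HermiteOne

open Polynomial

lemma derivative_hermite_succ (k : ℕ) :
    derivative (hermite (k + 1)) = ((k + 1 : ℕ) : ℤ[X]) * hermite k := by
  induction k with
  | zero => simp
  | succ k ih =>
    rw [hermite_succ (k + 1), derivative_sub, derivative_mul, derivative_X, ih, derivative_mul,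
      derivative_natCast, hermite_succ k]
    push_cast
    ring

lemma derivative_derivative_hermite (k : ℕ) : derivative (derivative (hermite k))
    = X * derivative (hermite k) - (k : ℤ[X]) * hermite k := by
  have h := derivative_hermite_succ k
  rw [hermite_succ, derivative_sub, derivative_mul, derivative_X] at h
  push_cast at h
  linear_combination -h

lemma X_mul_hermite (k : ℕ) :
    X * hermite k = hermite (k + 1) + (k : ℤ[X]) * hermite (k - 1) := by
  rw [hermite_succ]
  cases k with
  | zero => simp
  | succ k => rw [derivative_hermite_succ, Nat.add_sub_cancel]; ring

lemma hasDerivAt_hermite_mul_exp {ħ : ℝ} (hħ : 0 < ħ) (p : ℤ[X]) (s t : ℝ) :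
    HasDerivAt (fun t => aeval (s * t) p * Real.exp (-t ^ 2 / (2 * ħ)))
      ((s * aeval (s * t) (derivative p) - t / ħ * aeval (s * t) p) *
        Real.exp (-t ^ 2 / (2 * ħ))) t := by
  have h1 : HasDerivAt (fun t => s * t) s t := by simpa using (hasDerivAt_id t).const_mul s
  have h2 := (p.hasDerivAt_aeval (s * t)).comp t h1
  have h3 : HasDerivAt (fun t : ℝ => -t ^ 2 / (2 * ħ)) (-(2 * t) / (2 * ħ)) t := by
    simpa using ((hasDerivAt_pow 2 t).neg).div_const (2 * ħ)
  refine (h2.mul h3.exp).congr_deriv ?_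
  simp only [Function.comp_apply]
  field_simp
  ring

lemma iteratedDeriv_two_hermiteFun {ħ : ℝ} (hħ : 0 < ħ) (k : ℕ) (t : ℝ) :
    -ħ ^ 2 * iteratedDeriv 2 (hermiteFun ħ k) t + t ^ 2 * hermiteFun ħ k t
      = ħ * (2 * k + 1) * hermiteFun ħ k t := by
  set s := Real.sqrt (2 / ħ) with hs
  have hs2 : s ^ 2 = 2 / ħ := Real.sq_sqrt (by positivity)
  set c := (Real.sqrt (k.factorial * Real.sqrt (Real.pi * ħ)))⁻¹
  have e0 : hermiteFun ħ k = fun t => c * (aeval (s * t) (hermite k) *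
      Real.exp (-t ^ 2 / (2 * ħ))) := by
    ext t
    rw [hermiteFun, mul_assoc]
  have e1 : deriv (hermiteFun ħ k) = fun t => c * (s * (aeval (s * t) (derivative (hermite k)) *
      Real.exp (-t ^ 2 / (2 * ħ))) - 1 / ħ * (t * (aeval (s * t) (hermite k) *
      Real.exp (-t ^ 2 / (2 * ħ))))) := by
    ext t
    rw [e0, ((hasDerivAt_hermite_mul_exp hħ (hermite k) s t).const_mul c).deriv]
    ring
  have e2 := ((((hasDerivAt_hermite_mul_exp hħ (derivative (hermite k)) s t).const_mul s).sub
    (((hasDerivAt_id t).mul (hasDerivAt_hermite_mul_exp hħ (hermite k) s t)).const_mul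
      (1 / ħ))).const_mul c).deriv
  rw [iteratedDeriv_succ, iteratedDeriv_one, e1]
  have e3 : aeval (s * t) (derivative (derivative (hermite k)))
      = (s * t) * aeval (s * t) (derivative (hermite k)) - k * aeval (s * t) (hermite k) := by
    rw [derivative_derivative_hermite]
    simp
  simp only [id_eq, Pi.sub_apply, Pi.mul_apply] at e2
  refine (congrArg (fun d => -ħ ^ 2 * d + t ^ 2 * hermiteFun ħ k t) e2).trans ?_
  simp only [e3, e0]
  have hħ' := hħ.ne'
  have hs3 : ħ * s ^ 2 = 2 := by rw [hs2]; field_simp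
  generalize aeval (s * t) (hermite k) = A
  generalize aeval (s * t) (derivative (hermite k)) = B
  generalize Real.exp (-t ^ 2 / (2 * ħ)) = X
  clear_value c s
  field_simp
  linear_combination (c * X * (-ħ * s * t * B + ħ * k * A)) * hs3

/-- Multiplication by the variable. -/
lemma exists_mul_hermiteFun {ħ : ℝ} (hħ : 0 < ħ) (k : ℕ) : ∃ a b : ℝ, ∀ t,
    t * hermiteFun ħ k t = a * hermiteFun ħ (k + 1) t + b * hermiteFun ħ (k - 1) t := by
  set s := Real.sqrt (2 / ħ) with hs
  have hs0 : s ≠ 0 := (Real.sqrt_pos.2 (by positivity)).ne'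
  set c : ℕ → ℝ := fun k => (Real.sqrt (k.factorial * Real.sqrt (Real.pi * ħ)))⁻¹ with hc
  have hc0 : ∀ k, c k ≠ 0 := fun k => by
    have : (0 : ℝ) < k.factorial := by exact_mod_cast k.factorial_pos
    have h2 : 0 < Real.sqrt (Real.pi * ħ) := Real.sqrt_pos.2 (by positivity)
    exact inv_ne_zero (Real.sqrt_pos.2 (by positivity)).ne'
  refine ⟨c k / s / c (k + 1), k * c k / s / c (k - 1), fun t => ?_⟩
  have h := congrArg (aeval (s * t)) (X_mul_hermite k)
  simp only [map_mul, aeval_X, map_add, map_natCast] at h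
  simp only [hermiteFun, ← hs]
  change t * (c k * _ * _) = _ / c (k + 1) * (c (k + 1) * _ * _) + _ / c (k - 1) * (c (k - 1) * _ * _)
  have h1 := hc0 (k + 1)
  have h2 := hc0 (k - 1)
  generalize aeval (s * t) (hermite k) = A at h ⊢
  generalize aeval (s * t) (hermite (k + 1)) = B at h ⊢
  generalize aeval (s * t) (hermite (k - 1)) = D at h ⊢
  clear_value c s
  field_simp
  linear_combination c k * h

lemma integrable_eval_mul_exp (p : ℝ[X]) :
    Integrable fun t : ℝ => p.eval t * Real.exp (-(1 / 2) * t ^ 2) := by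
  simp only [eval_eq_sum_range, Finset.sum_mul, mul_assoc]
  refine integrable_finsetSum _ fun k _ => Integrable.const_mul ?_ _
  have h := integrable_rpow_mul_exp_neg_mul_sq (b := 1 / 2) (by norm_num) (s := k)
    (by have : (0 : ℝ) ≤ k := Nat.cast_nonneg k
        linarith)
  simpa only [Real.rpow_natCast] using h

lemma integral_derivative_mul_exp (p : ℝ[X]) :
    ∫ t : ℝ, (derivative p - X * p).eval t * Real.exp (-(1 / 2) * t ^ 2) = 0 := by
  refine integral_eq_zero_of_hasDerivAt_of_integrable
    (f := fun t => p.eval t * Real.exp (-(1 / 2) * t ^ 2)) (fun t => ?_)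
    (integrable_eval_mul_exp _) (integrable_eval_mul_exp p)
  have h3 : HasDerivAt (fun t : ℝ => -(1 / 2) * t ^ 2) (-(1 / 2) * (2 * t)) t := by
    simpa using (hasDerivAt_pow 2 t).const_mul (-(1 / 2) : ℝ)
  refine ((p.hasDerivAt t).mul h3.exp).congr_deriv ?_
  simp only [eval_sub, eval_mul, eval_X]
  ring

lemma integral_hermite_mul_hermite (k l : ℕ) :
    ∫ t : ℝ, aeval t (hermite k) * aeval t (hermite l) * Real.exp (-(1 / 2) * t ^ 2)
      = if k = l then (k.factorial : ℝ) * Real.sqrt (2 * Real.pi) else 0 := by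
  set H : ℕ → ℝ[X] := fun k => (hermite k).map (algebraMap ℤ ℝ) with hH
  have hHe : ∀ k (t : ℝ), aeval t (hermite k) = (H k).eval t := fun k t => by
    rw [hH, eval_map_algebraMap]
  have hsucc : ∀ k, H (k + 1) = X * H k - derivative (H k) := fun k => by
    simp [hH, hermite_succ, derivative_map]
  have hder : ∀ k, derivative (H (k + 1)) = ((k + 1 : ℕ) : ℝ[X]) * H k := fun k => by
    simp only [hH, derivative_map, derivative_hermite_succ, Polynomial.map_mul,
      Polynomial.map_natCast]
  have hzero : H 0 = 1 := by simp [hH]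
  set I : ℝ[X] → ℝ := fun p => ∫ t : ℝ, p.eval t * Real.exp (-(1 / 2) * t ^ 2) with hI
  have hstep : ∀ k (q : ℝ[X]), I (H (k + 1) * q) = I (H k * derivative q) := fun k q => by
    have h := integral_derivative_mul_exp (H k * q)
    have e : H (k + 1) * q = H k * derivative q - (derivative (H k * q) - X * (H k * q)) := by
      rw [hsucc, derivative_mul]
      ring
    simp only [hI]
    rw [e]
    simp only [eval_sub (p := H k * derivative q), sub_mul (eval _ (H k * derivative q))]
    rw [integral_sub (integrable_eval_mul_exp _) (integrable_eval_mul_exp _), h, sub_zero]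
  have hsmul : ∀ (c : ℕ) q, I ((c : ℝ[X]) * q) = c * I q := fun c q => by
    simp only [hI, eval_mul, eval_natCast, mul_assoc]
    rw [integral_const_mul]
  have key : ∀ k l, I (H k * H l) = if k = l then (k.factorial : ℝ) * Real.sqrt (2 * Real.pi)
      else 0 := by
    intro k
    induction k with
    | zero =>
      intro l
      cases l with
      | zero =>
        simp only [hI, hzero, mul_one, eval_one, one_mul, integral_gaussian]
        simp [div_eq_mul_inv, mul_comm]
      | succ l => rw [mul_comm, hstep, hzero, derivative_one, mul_zero]; simp [hI]
    | succ k ih =>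
      intro l
      cases l with
      | zero => rw [hstep, hzero, derivative_one, mul_zero]; simp [hI]
      | succ l =>
        rw [hstep, hder, mul_left_comm, hsmul, ih]
        by_cases h : k = l
        · subst h
          simp only [if_true, Nat.factorial_succ, Nat.cast_mul]
          ring
        · simp [h]
  rw [← key k l]
  simp only [hI, eval_mul, hHe]

lemma integral_hermiteFun_mul {ħ : ℝ} (hħ : 0 < ħ) (k l : ℕ) :
    ∫ t, hermiteFun ħ k t * hermiteFun ħ l t = if k = l then 1 else 0 := by
  set s := Real.sqrt (2 / ħ) with hs
  have hs0 : 0 < s := Real.sqrt_pos.2 (by positivity)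
  have hs2 : s ^ 2 = 2 / ħ := Real.sq_sqrt (by positivity)
  set c : ℕ → ℝ := fun k => (Real.sqrt (k.factorial * Real.sqrt (Real.pi * ħ)))⁻¹ with hc
  have h1 : ∀ t, hermiteFun ħ k t * hermiteFun ħ l t = c k * c l *
      (fun t => aeval t (hermite k) * aeval t (hermite l) * Real.exp (-(1 / 2) * t ^ 2)) (s * t) := by
    intro t
    have e : Real.exp (-(1 / 2) * (s * t) ^ 2)
        = Real.exp (-t ^ 2 / (2 * ħ)) * Real.exp (-t ^ 2 / (2 * ħ)) := by
      rw [← Real.exp_add, mul_pow, hs2]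
      congr 1
      field_simp
      ring
    simp only [hermiteFun, e, ← hs, hc]
    ring
  simp only [h1]
  rw [integral_const_mul, Measure.integral_comp_mul_left (fun t : ℝ => aeval t (hermite k) *
    aeval t (hermite l) * Real.exp (-(1 / 2) * t ^ 2)), integral_hermite_mul_hermite,
    abs_of_pos (by positivity), smul_eq_mul]
  by_cases h : k = l
  · subst h
    have hk : (0 : ℝ) < k.factorial := by exact_mod_cast k.factorial_pos
    have hp : 0 < Real.sqrt (Real.pi * ħ) := Real.sqrt_pos.2 (by positivity)
    have h2 : c k * c k = (k.factorial * Real.sqrt (Real.pi * ħ))⁻¹ := by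
      rw [hc, ← mul_inv, Real.mul_self_sqrt (by positivity)]
    have h3 : Real.sqrt (2 * Real.pi) = s * Real.sqrt (Real.pi * ħ) := by
      rw [hs, ← Real.sqrt_mul (by positivity)]
      congr 1
      field_simp
    rw [if_pos rfl, if_pos rfl, h2, h3]
    field_simp
  · simp [h]

end HermiteOne

/-! ### Hermite functions of several variables -/

section Oscillator

open LineDeriv

variable {V : Type} [NormedAddCommGroup V] [NormedSpace ℝ V]

/-- The operator `-ħ² ∂_e² + l²` on Schwartz functions. -/
def schwartzOscillator (ħ : ℝ) (e : V) (l : V →L[ℝ] ℝ) (u : 𝓢(V, ℂ)) : 𝓢(V, ℂ) :=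
  (-(ħ : ℂ) ^ 2) • ∂_{e} (∂_{e} u) + SchwartzMap.smulLeftCLM ℂ (fun x => (l x : ℂ) ^ 2) u

lemma hasTemperateGrowth_clm_pow (l : V →L[ℝ] ℝ) (k : ℕ) :
    Function.HasTemperateGrowth fun x => (l x : ℂ) ^ k :=
  ((Complex.ofRealCLM.comp l).hasTemperateGrowth).pow k

lemma schwartzOscillator_apply (ħ : ℝ) (e : V) (l : V →L[ℝ] ℝ) (u : 𝓢(V, ℂ)) (x : V) :
    schwartzOscillator ħ e l u x
      = -(ħ : ℂ) ^ 2 * ∂_{e} (∂_{e} u) x + (l x : ℂ) ^ 2 * u x := by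
  rw [schwartzOscillator, add_apply,
    SchwartzMap.smulLeftCLM_apply_apply (hasTemperateGrowth_clm_pow l 2)]
  rfl

lemma hasDerivAt_schwartz_line (u : 𝓢(V, ℂ)) (x e : V) (t : ℝ) :
    HasDerivAt (fun t : ℝ => u (x + t • e)) (∂_{e} u (x + t • e)) t := by
  have h1 : HasDerivAt (fun t : ℝ => x + t • e) e t := by
    simpa using ((hasDerivAt_id t).smul_const e).const_add x
  exact (u.hasFDerivAt (x + t • e)).comp_hasDerivAt t h1

lemma iteratedDeriv_two_schwartz_line (u : 𝓢(V, ℂ)) (x e : V) :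
    iteratedDeriv 2 (fun t : ℝ => u (x + t • e)) 0 = ∂_{e} (∂_{e} u) x := by
  rw [iteratedDeriv_succ, iteratedDeriv_one,
    funext fun t => (hasDerivAt_schwartz_line u x e t).deriv,
    (hasDerivAt_schwartz_line (∂_{e} u) x e 0).deriv, zero_smul, add_zero]

lemma integral_mul_schwartzOscillator [FiniteDimensional ℝ V] [MeasurableSpace V] [BorelSpace V]
    (μ : Measure V) [μ.IsAddHaarMeasure] (ħ : ℝ) (e : V) (l : V →L[ℝ] ℝ) (u v : 𝓢(V, ℂ)) :
    ∫ x, v x * schwartzOscillator ħ e l u x ∂μ = ∫ x, schwartzOscillator ħ e l v x * u x ∂μ := by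
  have hi : ∀ u v : 𝓢(V, ℂ), Integrable (fun x => v x * u x) μ := fun u v => by
    obtain ⟨C, -, hC⟩ := exists_one_add_norm_pow_mul_norm_iteratedFDeriv_le u 0 0
    refine v.integrable.mul_bdd (c := C) u.continuous.aestronglyMeasurable
      (Filter.Eventually.of_forall fun x => ?_)
    simpa using hC x
  have h1 := SchwartzMap.integral_mul_lineDerivOp_right_eq_neg_left (μ := μ) v (∂_{e} u) e
  have h2 := SchwartzMap.integral_mul_lineDerivOp_right_eq_neg_left (μ := μ) (∂_{e} v) u e
  have h3 : ∫ x, v x * ∂_{e} (∂_{e} u) x ∂μ = ∫ x, ∂_{e} (∂_{e} v) x * u x ∂μ := by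
    rw [h1, h2, neg_neg]
  set M := SchwartzMap.smulLeftCLM ℂ (fun x => (l x : ℂ) ^ 2)
  have hM : ∀ (u : 𝓢(V, ℂ)) x, M u x = (l x : ℂ) ^ 2 * u x := fun u x =>
    SchwartzMap.smulLeftCLM_apply_apply (hasTemperateGrowth_clm_pow l 2) u x
  simp only [schwartzOscillator_apply, mul_add, add_mul]
  have e1 : ∀ x, v x * (-(ħ : ℂ) ^ 2 * ∂_{e} (∂_{e} u) x)
      = -(ħ : ℂ) ^ 2 * (v x * ∂_{e} (∂_{e} u) x) := fun x => by ring
  have e2 : ∀ x, v x * ((l x : ℂ) ^ 2 * u x) = v x * M u x := fun x => by rw [hM]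
  have e3 : ∀ x, (l x : ℂ) ^ 2 * v x * u x = v x * M u x := fun x => by rw [hM]; ring
  simp only [e1, e2, e3, mul_assoc (-(ħ : ℂ) ^ 2)]
  rw [integral_add ((hi _ _).const_mul _) (hi _ _), integral_add ((hi _ _).const_mul _) (hi _ _),
    integral_const_mul, integral_const_mul, h3]

end Oscillator

section HermiteSeveral

variable {m : ℕ}

lemma hasTemperateGrowth_aeval (p : Polynomial ℤ) (c : ℝ) (j : Fin m) :
    Function.HasTemperateGrowth fun x : E m => ((Polynomial.aeval (c * x j) p : ℝ) : ℂ) := by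
  have h : Function.HasTemperateGrowth fun x : E m => ((c * x j : ℝ) : ℂ) :=
    (Complex.ofRealCLM.comp (c • (EuclideanSpace.proj j : E m →L[ℝ] ℝ))).hasTemperateGrowth
  simp only [Polynomial.aeval_eq_sum_range, Complex.ofReal_sum, zsmul_eq_mul, Complex.ofReal_mul,
    Complex.ofReal_pow, Complex.ofReal_intCast] at h ⊢
  refine Function.HasTemperateGrowth.sum fun k _ => ?_
  exact (Function.HasTemperateGrowth.const _).mul (h.pow k)

lemma hasTemperateGrowth_prod {V ι : Type} [NormedAddCommGroup V] [NormedSpace ℝ V] (s : Finset ι)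
    {f : ι → V → ℂ} (hf : ∀ i, Function.HasTemperateGrowth (f i)) :
    Function.HasTemperateGrowth fun x => ∏ i ∈ s, f i x := by
  classical
  induction s using Finset.induction_on with
  | empty => simp
  | insert i s hi ih =>
    simp only [Finset.prod_insert hi]
    exact (hf i).mul ih

/-- The product `h_{n_1}(x_1) ⋯ h_{n_m}(x_m)`. -/
def hermiteMulti (ħ : ℝ) (n : Fin m → ℕ) (x : E m) : ℝ := ∏ j, hermiteFun ħ (n j) (x j)

lemma exists_schwartz_hermiteMulti {ħ : ℝ} (hħ : 0 < ħ) (n : Fin m → ℕ) :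
    ∃ h : 𝓢(E m, ℂ), ∀ x, h x = (hermiteMulti ħ n x : ℂ) := by
  set c : ℕ → ℝ := fun k => (Real.sqrt (k.factorial * Real.sqrt (Real.pi * ħ)))⁻¹ with hc
  have hg : Function.HasTemperateGrowth fun x : E m => ∏ j, ((c (n j) : ℂ) *
      ((Polynomial.aeval (Real.sqrt (2 / ħ) * x j) (Polynomial.hermite (n j)) : ℝ) : ℂ)) :=
    hasTemperateGrowth_prod _ fun j =>
      (Function.HasTemperateGrowth.const _).mul (hasTemperateGrowth_aeval _ _ j)
  refine ⟨SchwartzMap.smulLeftCLM ℂ (fun x : E m => ∏ j, ((c (n j) : ℂ) *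
      ((Polynomial.aeval (Real.sqrt (2 / ħ) * x j) (Polynomial.hermite (n j)) : ℝ) : ℂ))) (schwartzGaussian (E m) (1 / (2 * ħ)) (by positivity)),
    fun x => ?_⟩
  rw [SchwartzMap.smulLeftCLM_apply_apply hg, schwartzGaussian_apply, hermiteMulti, smul_eq_mul]
  have e : Real.exp (-(1 / (2 * ħ)) * ‖x‖ ^ 2) = ∏ j, Real.exp (-(x j) ^ 2 / (2 * ħ)) := by
    rw [← Real.exp_sum, EuclideanSpace.real_norm_sq_eq, Finset.mul_sum]
    congr 1
    exact Finset.sum_congr rfl fun j _ => by ring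
  rw [e, Complex.ofReal_prod, Complex.ofReal_prod, ← Finset.prod_mul_distrib]
  refine Finset.prod_congr rfl fun j _ => ?_
  rw [hermiteFun, Complex.ofReal_mul, Complex.ofReal_mul]

/-- The Hermite functions as Schwartz functions. -/
def hermiteSchwartz {ħ : ℝ} (hħ : 0 < ħ) (n : Fin m → ℕ) : 𝓢(E m, ℂ) :=
  (exists_schwartz_hermiteMulti hħ n).choose

lemma hermiteSchwartz_apply {ħ : ℝ} (hħ : 0 < ħ) (n : Fin m → ℕ) (x : E m) :
    hermiteSchwartz hħ n x = (hermiteMulti ħ n x : ℂ) :=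
  (exists_schwartz_hermiteMulti hħ n).choose_spec x

lemma hermiteProd_eq {ħ : ℝ} (hħ : 0 < ħ) (n : Fin m → ℕ) :
    hermiteProd ħ n = (hermiteSchwartz hħ n).toLp 2 volume := by
  have e : (fun x : E m => ((∏ j, hermiteFun ħ (n j) (x j) : ℝ) : ℂ)) = hermiteSchwartz hħ n :=
    funext fun x => (hermiteSchwartz_apply hħ n x).symm
  have h : MemLp (hermiteSchwartz hħ n) 2 (volume : Measure (E m)) :=
    (hermiteSchwartz hħ n).memLp 2 volume
  rw [hermiteProd, e, toL2, dif_pos h]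
  rfl

lemma coeFn_hermiteProd {ħ : ℝ} (hħ : 0 < ħ) (n : Fin m → ℕ) :
    hermiteProd ħ n =ᵐ[volume] fun x => (hermiteMulti ħ n x : ℂ) := by
  rw [hermiteProd_eq hħ]
  filter_upwards [(hermiteSchwartz hħ n).coeFn_toLp 2 volume] with x hx
  rw [hx, hermiteSchwartz_apply]

lemma inner_hermiteProd {ħ : ℝ} (hħ : 0 < ħ) (n : Fin m → ℕ) (g : L2 (E m)) :
    inner ℂ (hermiteProd ħ n) g = ∫ x, (hermiteMulti ħ n x : ℂ) * g x := by
  rw [L2.inner_def]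
  refine integral_congr_ae ?_
  filter_upwards [coeFn_hermiteProd hħ n] with x hx
  rw [hx, RCLike.inner_apply, Complex.conj_ofReal, mul_comm]

lemma integral_prod_coord (f : Fin m → ℝ → ℝ) :
    ∫ x : E m, ∏ j, f j (x j) = ∏ j, ∫ t, f j t := by
  rw [← integral_fintype_prod_volume_eq_prod]
  exact (EuclideanSpace.volume_preserving_symm_measurableEquiv_toLp (Fin m)).integral_comp'
    (fun x : Fin m → ℝ => ∏ j, f j (x j))

lemma inner_hermiteProd_hermiteProd {ħ : ℝ} (hħ : 0 < ħ) (n k : Fin m → ℕ) :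
    inner ℂ (hermiteProd ħ n) (hermiteProd ħ k) = if n = k then (1 : ℂ) else 0 := by
  have h1 : inner ℂ (hermiteProd ħ n) (hermiteProd ħ k)
      = ((∫ x : E m, ∏ j, (hermiteFun ħ (n j) (x j) * hermiteFun ħ (k j) (x j)) : ℝ) : ℂ) := by
    rw [inner_hermiteProd hħ, ← integral_complex_ofReal]
    refine integral_congr_ae ?_
    filter_upwards [coeFn_hermiteProd hħ k] with x hx
    rw [hx, Finset.prod_mul_distrib, Complex.ofReal_mul]
    rfl
  rw [h1, integral_prod_coord fun j t => hermiteFun ħ (n j) t * hermiteFun ħ (k j) t]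
  simp only [integral_hermiteFun_mul hħ]
  by_cases h : n = k
  · simp [h]
  · rw [if_neg h]
    obtain ⟨j, hj⟩ := Function.ne_iff.1 h
    rw [Finset.prod_eq_zero (Finset.mem_univ j) (if_neg hj), Complex.ofReal_zero]

lemma norm_hermiteProd {ħ : ℝ} (hħ : 0 < ħ) (n : Fin m → ℕ) : ‖hermiteProd ħ n‖ = 1 := by
  have h := inner_hermiteProd_hermiteProd hħ n n
  rw [if_pos rfl, inner_self_eq_norm_sq_to_K] at h
  have h' : ‖hermiteProd ħ n‖ ^ 2 = 1 := Complex.ofReal_injective (by push_cast; exact h)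
  exact (pow_eq_one_iff_of_nonneg (norm_nonneg _) two_ne_zero).1 h'

lemma exists_coord_mul_hermiteMulti {ħ : ℝ} (hħ : 0 < ħ) (n : Fin m → ℕ) (j : Fin m) :
    ∃ (a b : ℝ) (n₁ n₂ : Fin m → ℕ), ∀ x,
      x j * hermiteMulti ħ n x = a * hermiteMulti ħ n₁ x + b * hermiteMulti ħ n₂ x := by
  classical
  obtain ⟨a, b, hab⟩ := exists_mul_hermiteFun hħ (n j)
  refine ⟨a, b, Function.update n j (n j + 1), Function.update n j (n j - 1), fun x => ?_⟩
  have h : ∀ k, hermiteMulti ħ (Function.update n j k) x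
      = hermiteFun ħ k (x j) * ∏ i ∈ Finset.univ.erase j, hermiteFun ħ (n i) (x i) := fun k => by
    rw [hermiteMulti, ← Finset.mul_prod_erase _ _ (Finset.mem_univ j), Function.update_self]
    congr 1
    exact Finset.prod_congr rfl fun i hi => by
      rw [Function.update_of_ne (Finset.ne_of_mem_erase hi)]
  have h0 := h (n j)
  rw [Function.update_eq_self] at h0
  rw [h, h, h0]
  linear_combination (∏ i ∈ Finset.univ.erase j, hermiteFun ħ (n i) (x i)) * hab (x j)

lemma contDiff_hermiteFun (ħ : ℝ) (k : ℕ) : ContDiff ℝ ∞ (hermiteFun ħ k) := by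
  unfold hermiteFun
  have h := ((Polynomial.hermite k).contDiff_aeval (𝕜 := ℝ) (n := ∞)).comp
    (contDiff_const.mul contDiff_id : ContDiff ℝ ∞ fun t : ℝ => Real.sqrt (2 / ħ) * t)
  exact (contDiff_const.mul h).mul (by fun_prop)

lemma schwartzOscillator_hermiteSchwartz {ħ : ℝ} (hħ : 0 < ħ) (n : Fin m → ℕ) (j : Fin m) (x : E m) :
    schwartzOscillator ħ (EuclideanSpace.single j (1 : ℝ)) (EuclideanSpace.proj j)
      (hermiteSchwartz hħ n) x = (ħ * (2 * n j + 1) : ℝ) * hermiteSchwartz hħ n x := by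
  classical
  set c := ∏ i ∈ Finset.univ.erase j, hermiteFun ħ (n i) (x i) with hc
  have h : ∀ t : ℝ, hermiteSchwartz hħ n (x + t • EuclideanSpace.single j (1 : ℝ))
      = ((c * hermiteFun ħ (n j) (x j + t) : ℝ) : ℂ) := fun t => by
    rw [hermiteSchwartz_apply, hermiteMulti, ← Finset.mul_prod_erase _ _ (Finset.mem_univ j),
      mul_comm c]
    congr 2
    · simp
    · exact Finset.prod_congr rfl fun i hi => by simp [Finset.ne_of_mem_erase hi]
  have h0 := h 0
  rw [zero_smul, add_zero, add_zero] at h0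
  have hsm := contDiff_hermiteFun ħ (n j)
  have hd1 : ∀ t, HasDerivAt (hermiteFun ħ (n j)) (deriv (hermiteFun ħ (n j)) t) t := fun t =>
    (hsm.differentiable (by simp) t).hasDerivAt
  have hd2 : ∀ t, HasDerivAt (deriv (hermiteFun ħ (n j)))
      (deriv (deriv (hermiteFun ħ (n j))) t) t := fun t => by
    have h2 : ContDiff ℝ ∞ (deriv (hermiteFun ħ (n j))) := (contDiff_infty_iff_deriv.1 hsm).2
    exact (h2.differentiable (by simp) t).hasDerivAt
  have key : iteratedDeriv 2 (fun t : ℝ =>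
      hermiteSchwartz hħ n (x + t • EuclideanSpace.single j (1 : ℝ))) 0
      = ((c * iteratedDeriv 2 (hermiteFun ħ (n j)) (x j) : ℝ) : ℂ) := by
    simp only [h]
    have e1 : ∀ t, HasDerivAt (fun t : ℝ => ((c * hermiteFun ħ (n j) (x j + t) : ℝ) : ℂ))
        ((c * deriv (hermiteFun ħ (n j)) (x j + t) : ℝ) : ℂ) t := fun t =>
      (((hd1 (x j + t)).comp_const_add (x j) t).const_mul c).ofReal_comp
    have e2 : ∀ t, HasDerivAt (fun t : ℝ => ((c * deriv (hermiteFun ħ (n j)) (x j + t) : ℝ) : ℂ))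
        ((c * deriv (deriv (hermiteFun ħ (n j))) (x j + t) : ℝ) : ℂ) t := fun t =>
      (((hd2 (x j + t)).comp_const_add (x j) t).const_mul c).ofReal_comp
    rw [iteratedDeriv_succ, iteratedDeriv_one, iteratedDeriv_succ, iteratedDeriv_one,
      funext fun t => (e1 t).deriv, (e2 0).deriv, add_zero]
  rw [schwartzOscillator_apply, ← iteratedDeriv_two_schwartz_line, key, h0]
  have hode := iteratedDeriv_two_hermiteFun hħ (n j) (x j)
  have hc2 : ((-ħ ^ 2 * (c * iteratedDeriv 2 (hermiteFun ħ (n j)) (x j)) +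
      x j ^ 2 * (c * hermiteFun ħ (n j) (x j)) : ℝ) : ℂ)
      = ((ħ * (2 * n j + 1) * (c * hermiteFun ħ (n j) (x j)) : ℝ) : ℂ) := by
    congr 1
    linear_combination c * hode
  simp only [Complex.ofReal_add, Complex.ofReal_mul, Complex.ofReal_neg, Complex.ofReal_pow] at hc2 ⊢
  exact hc2

lemma integrable_schwartz_mul_L2 (φ : 𝓢(E m, ℂ)) (g : L2 (E m)) :
    Integrable fun x => φ x * g x :=
  (φ.memLp 2 volume).integrable_mul (Lp.memLp g)

lemma integral_inner_pow_mul_hermiteMulti {ħ : ℝ} (hħ : 0 < ħ) {g : L2 (E m)}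
    (hg : ∀ n : Fin m → ℕ, ∫ x, (hermiteMulti ħ n x : ℂ) * g x = 0) (t : E m) (k : ℕ)
    (n : Fin m → ℕ) : ∫ x, (inner ℝ t x : ℂ) ^ k * ((hermiteMulti ħ n x : ℂ) * g x) = 0 := by
  have hi : ∀ k n, Integrable fun x => (inner ℝ t x : ℂ) ^ k * ((hermiteMulti ħ n x : ℂ) * g x) := by
    intro k n
    have h := integrable_schwartz_mul_L2 (SchwartzMap.smulLeftCLM ℂ
      (fun x : E m => (innerSL ℝ t x : ℂ) ^ k) (hermiteSchwartz hħ n)) g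
    simp only [SchwartzMap.smulLeftCLM_apply_apply (hasTemperateGrowth_clm_pow (innerSL ℝ t) k),
      hermiteSchwartz_apply, smul_eq_mul, mul_assoc] at h
    exact h
  induction k generalizing n with
  | zero => simpa using hg n
  | succ k ih =>
    choose a b n₁ n₂ h using exists_coord_mul_hermiteMulti hħ n
    have e : ∀ x : E m, (inner ℝ t x : ℂ) ^ (k + 1) * ((hermiteMulti ħ n x : ℂ) * g x)
        = ∑ j, ((t j * a j : ℝ) * ((inner ℝ t x : ℂ) ^ k * ((hermiteMulti ħ (n₁ j) x : ℂ) * g x))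
          + (t j * b j : ℝ) * ((inner ℝ t x : ℂ) ^ k * ((hermiteMulti ħ (n₂ j) x : ℂ) * g x))) := by
      intro x
      have e1 : (inner ℝ t x : ℂ) = ∑ j, (t j : ℂ) * (x j : ℂ) := by
        rw [PiLp.inner_apply, Complex.ofReal_sum]
        refine Finset.sum_congr rfl fun j _ => ?_
        rw [RCLike.inner_apply, conj_trivial, Complex.ofReal_mul, mul_comm]
      rw [pow_succ, mul_assoc, ← mul_assoc (inner ℝ t x : ℂ) (hermiteMulti ħ n x : ℂ)]
      nth_rw 2 [e1]
      rw [Finset.sum_mul, Finset.sum_mul, Finset.mul_sum]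
      refine Finset.sum_congr rfl fun j _ => ?_
      have h1 : (x j : ℂ) * (hermiteMulti ħ n x : ℂ)
          = a j * (hermiteMulti ħ (n₁ j) x : ℂ) + b j * (hermiteMulti ħ (n₂ j) x : ℂ) := by
        exact_mod_cast h j x
      rw [mul_assoc (t j : ℂ), h1]
      push_cast
      ring
    simp only [e]
    rw [integral_finsetSum]
    swap
    · exact fun j _ => ((hi k (n₁ j)).const_mul _).add ((hi k (n₂ j)).const_mul _)
    refine Finset.sum_eq_zero fun j _ => ?_
    rw [integral_add ((hi k (n₁ j)).const_mul _) ((hi k (n₂ j)).const_mul _), integral_const_mul,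
      integral_const_mul, ih, ih, mul_zero, mul_zero, add_zero]

lemma hermiteMulti_zero {ħ : ℝ} (hħ : 0 < ħ) : ∃ c : ℝ, 0 < c ∧ ∀ x : E m,
    hermiteMulti ħ 0 x = c * Real.exp (-(1 / (2 * ħ)) * ‖x‖ ^ 2) := by
  have hp : 0 < Real.sqrt (Real.pi * ħ) := Real.sqrt_pos.2 (by positivity)
  refine ⟨∏ _j : Fin m, (Real.sqrt (Real.sqrt (Real.pi * ħ)))⁻¹, by positivity, fun x => ?_⟩
  have e : Real.exp (-(1 / (2 * ħ)) * ‖x‖ ^ 2) = ∏ j, Real.exp (-(x j) ^ 2 / (2 * ħ)) := by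
    rw [← Real.exp_sum, EuclideanSpace.real_norm_sq_eq, Finset.mul_sum]
    congr 1
    exact Finset.sum_congr rfl fun j _ => by ring
  rw [e, hermiteMulti, ← Finset.prod_mul_distrib]
  exact Finset.prod_congr rfl fun j _ => by simp [hermiteFun]

lemma integral_exp_mul_hermiteMulti {ħ : ℝ} (hħ : 0 < ħ) {g : L2 (E m)}
    (hg : ∀ n : Fin m → ℕ, ∫ x, (hermiteMulti ħ n x : ℂ) * g x = 0) (t : E m) :
    ∫ x, Complex.exp (Complex.I * (inner ℝ t x : ℂ)) * ((hermiteMulti ħ 0 x : ℂ) * g x) = 0 := by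
  obtain ⟨c, hc, h0⟩ := hermiteMulti_zero (m := m) hħ
  have hexp : ∀ z : ℂ, HasSum (fun k : ℕ => z ^ k / k.factorial) (Complex.exp z) := fun z => by
    rw [Complex.exp_eq_exp_ℂ]
    exact NormedSpace.expSeries_div_hasSum_exp z
  have hexpr : ∀ z : ℝ, HasSum (fun k : ℕ => z ^ k / k.factorial) (Real.exp z) := fun z => by
    rw [Real.exp_eq_exp_ℝ]
    exact NormedSpace.expSeries_div_hasSum_exp z
  have hgm := (Lp.memLp g).aestronglyMeasurable
  have hhc : Continuous fun x : E m => (hermiteMulti ħ 0 x : ℂ) := by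
    simp only [← hermiteSchwartz_apply hħ]
    exact (hermiteSchwartz hħ 0).continuous
  have hsum : HasSum (fun k : ℕ => ∫ x, (Complex.I * (inner ℝ t x : ℂ)) ^ k / k.factorial *
      ((hermiteMulti ħ 0 x : ℂ) * g x))
      (∫ x, Complex.exp (Complex.I * (inner ℝ t x : ℂ)) * ((hermiteMulti ħ 0 x : ℂ) * g x)) := by
    refine hasSum_integral_of_dominated_convergence
      (fun k x => |inner ℝ t x| ^ k / k.factorial * ‖(hermiteMulti ħ 0 x : ℂ) * g x‖)
      (fun k => ?_) (fun k => Filter.Eventually.of_forall fun x => ?_)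
      (Filter.Eventually.of_forall fun x => ?_) ?_ (Filter.Eventually.of_forall fun x => ?_)
    · exact (Continuous.aestronglyMeasurable (by fun_prop)).mul
        (hhc.aestronglyMeasurable.mul hgm)
    · rw [norm_mul, norm_div, norm_pow, norm_mul, Complex.norm_I, one_mul, Complex.norm_real,
        Complex.norm_natCast, Real.norm_eq_abs]
    · exact (hexpr _).summable.mul_right _
    · simp only [fun x : E m => ((hexpr |inner ℝ t x|).mul_right
        ‖(hermiteMulti ħ 0 x : ℂ) * g x‖).tsum_eq]
      have hG := integrable_schwartz_mul_L2
        (schwartzGaussian (E m) (1 / (4 * ħ)) (by positivity)) g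
      refine (hG.norm.const_mul (c * Real.exp (ħ * ‖t‖ ^ 2))).mono' ?_
        (Filter.Eventually.of_forall fun x => ?_)
      · exact (Continuous.aestronglyMeasurable (by fun_prop)).mul
          (hhc.aestronglyMeasurable.mul hgm).norm
      · rw [Real.norm_of_nonneg (by positivity), norm_mul, norm_mul, schwartzGaussian_apply,
          Complex.norm_real, Complex.norm_real, h0, Real.norm_of_nonneg (by positivity),
          Real.norm_of_nonneg (by positivity)]
        have h1 : |inner ℝ t x| ≤ ‖t‖ * ‖x‖ := abs_real_inner_le_norm t x
        have h2 : |inner ℝ t x| + -(1 / (2 * ħ)) * ‖x‖ ^ 2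
            ≤ ħ * ‖t‖ ^ 2 + -(1 / (4 * ħ)) * ‖x‖ ^ 2 := by
          have h3 : 0 ≤ (2 * ħ * ‖t‖ - ‖x‖) ^ 2 / (4 * ħ) := by positivity
          have h4 : (2 * ħ * ‖t‖ - ‖x‖) ^ 2 / (4 * ħ)
              = ħ * ‖t‖ ^ 2 - ‖t‖ * ‖x‖ + 1 / (4 * ħ) * ‖x‖ ^ 2 := by
            field_simp
            ring
          have h5 : 1 / (2 * ħ) = 2 * (1 / (4 * ħ)) := by field_simp; norm_num
          rw [h5]
          linarith
        have h6 := Real.exp_le_exp.2 h2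
        rw [Real.exp_add, Real.exp_add] at h6
        calc _ = c * (Real.exp |inner ℝ t x| * Real.exp (-(1 / (2 * ħ)) * ‖x‖ ^ 2)) * ‖g x‖ := by
              ring
          _ ≤ c * (Real.exp (ħ * ‖t‖ ^ 2) * Real.exp (-(1 / (4 * ħ)) * ‖x‖ ^ 2)) * ‖g x‖ := by
              gcongr
          _ = _ := by ring
    · exact (hexp _).mul_right _
  refine hsum.unique ?_
  have hz : ∀ k : ℕ, ∫ x, (Complex.I * (inner ℝ t x : ℂ)) ^ k / k.factorial *
      ((hermiteMulti ħ 0 x : ℂ) * g x) = 0 := fun k => by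
    have e : ∀ x, (Complex.I * (inner ℝ t x : ℂ)) ^ k / k.factorial *
        ((hermiteMulti ħ 0 x : ℂ) * g x) = Complex.I ^ k / k.factorial *
        ((inner ℝ t x : ℂ) ^ k * ((hermiteMulti ħ 0 x : ℂ) * g x)) := fun x => by
      rw [mul_pow]
      ring
    simp only [e]
    rw [integral_const_mul, integral_inner_pow_mul_hermiteMulti hħ hg, mul_zero]
  simp only [hz]
  exact hasSum_zero

/-- An integrable function is determined by its Fourier transform. -/
lemma ae_eq_zero_of_fourier_eq_zero {V : Type} [NormedAddCommGroup V] [InnerProductSpace ℝ V]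
    [FiniteDimensional ℝ V] [MeasurableSpace V] [BorelSpace V] {G : V → ℂ} (hG : Integrable G)
    (h : ∀ w, FourierTransform.fourier G w = 0) : G =ᵐ[volume] 0 := by
  refine ae_eq_zero_of_integral_contDiff_smul_eq_zero hG.locallyIntegrable fun φ h1 h2 => ?_
  let v : 𝓢(V, ℂ) := (h2.comp_left (g := fun t : ℝ => (t : ℂ)) (by simp)).toSchwartzMap
    (Complex.ofRealCLM.contDiff.comp h1)
  obtain ⟨θ, hθ⟩ : ∃ θ : 𝓢(V, ℂ), FourierTransform.fourier θ = v :=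
    ⟨FourierTransformInv.fourierInv v, FourierTransform.fourier_fourierInv_eq v⟩
  have h3 := VectorFourier.integral_fourierIntegral_smul_eq_flip (L := innerₗ V)
    Real.continuous_fourierChar continuous_inner (θ.integrable (μ := volume)) hG
  have h4 : ∀ x, (φ x : ℂ) = VectorFourier.fourierIntegral Real.fourierChar volume (innerₗ V) θ x := by
    intro x
    have h5 : v x = (φ x : ℂ) := rfl
    rw [← h5, ← hθ, SchwartzMap.fourier_coe]
    rfl
  simp only [← h4, flip_innerₗ] at h3
  simp only [Complex.real_smul]
  simp only [smul_eq_mul] at h3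
  rw [h3]
  have h6 : ∀ x, VectorFourier.fourierIntegral Real.fourierChar volume (innerₗ V) G x = 0 := h
  simp [h6]

/-- The Hermite functions are total. -/
lemma hermiteProd_total {ħ : ℝ} (hħ : 0 < ħ) {g : L2 (E m)}
    (hg : ∀ n : Fin m → ℕ, inner ℂ (hermiteProd ħ n) g = 0) : g = 0 := by
  simp only [inner_hermiteProd hħ] at hg
  obtain ⟨c, hc, h0⟩ := hermiteMulti_zero (m := m) hħ
  have hG : Integrable fun x => (hermiteMulti ħ 0 x : ℂ) * g x := by
    simp only [← hermiteSchwartz_apply hħ]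
    exact integrable_schwartz_mul_L2 _ _
  have h1 := ae_eq_zero_of_fourier_eq_zero hG fun w => by
    rw [Real.fourier_eq']
    have h := integral_exp_mul_hermiteMulti hħ hg ((-(2 * Real.pi)) • w)
    rw [← h]
    congr 1
    ext x
    rw [smul_eq_mul, inner_smul_left, real_inner_comm]
    simp only [conj_trivial]
    congr 2
    push_cast
    ring
  refine Lp.ext ?_
  filter_upwards [h1, Lp.coeFn_zero ℂ 2 (volume : Measure (E m))] with x h2 h3
  rw [h3]
  rcases mul_eq_zero.1 h2 with h4 | h4
  · rw [h0] at h4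
    have : 0 < c * Real.exp (-(1 / (2 * ħ)) * ‖x‖ ^ 2) := by positivity
    exact absurd (Complex.ofReal_eq_zero.1 h4) this.ne'
  · exact h4

end HermiteSeveral

/-! ### The harmonic oscillators -/

section Oscillators

variable {m : ℕ}

/-- The joint eigenvalue `ħ (2n + 1)` of the oscillators. -/
def oscillatorEigenvalue (ħ : ℝ) (n : Fin m → ℕ) (j : Fin m) : ℝ := ħ * (2 * n j + 1)

lemma oscillatorEigenvalue_injective {ħ : ℝ} (hħ : 0 < ħ) :
    Function.Injective (oscillatorEigenvalue ħ : (Fin m → ℕ) → Fin m → ℝ) := by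
  intro n k h
  ext j
  have h1 := congrFun h j
  simp only [oscillatorEigenvalue] at h1
  have h2 := mul_left_cancel₀ hħ.ne' h1
  have h3 : (n j : ℝ) = k j := by linarith
  exact_mod_cast h3

/-- The line spanned by a Hermite function. -/
def hermiteLine {ħ : ℝ} (hħ : 0 < ħ) (n : Fin m → ℕ) : ℂ →ₗᵢ[ℂ] L2 (E m) :=
  LinearIsometry.toSpanSingleton ℂ (L2 (E m)) (norm_hermiteProd hħ n)

lemma hermiteLine_apply {ħ : ℝ} (hħ : 0 < ħ) (n : Fin m → ℕ) (c : ℂ) :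
    hermiteLine hħ n c = c • hermiteProd ħ n := rfl

lemma component_hermiteLine {ħ : ℝ} (hħ : 0 < ħ) (n : Fin m → ℕ) (g : L2 (E m)) :
    component (hermiteLine hħ) n g = inner ℂ (hermiteProd ħ n) g := by
  refine ext_inner_left ℂ fun c => ?_
  rw [inner_component_right, hermiteLine_apply, inner_smul_left, RCLike.inner_apply, mul_comm]

lemma isOrthogonalSum_hermiteLine {ħ : ℝ} (hħ : 0 < ħ) :
    IsOrthogonalSum (hermiteLine hħ : (Fin m → ℕ) → _) := by
  refine ⟨fun n k h c d => ?_, fun g hg => hermiteProd_total hħ fun n => ?_⟩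
  · rw [hermiteLine_apply, hermiteLine_apply, inner_smul_left, inner_smul_right,
      inner_hermiteProd_hermiteProd hħ, if_neg h, mul_zero, mul_zero]
  · rw [← component_hermiteLine hħ, hg]

/-- Scalar multiplication by the eigenvalues of the `j`-th oscillator. -/
def oscillatorScalar (ħ : ℝ) (j : Fin m) (n : Fin m → ℕ) : ℂ →L[ℂ] ℂ :=
  (oscillatorEigenvalue ħ n j : ℂ) • ContinuousLinearMap.id ℂ ℂ

lemma integral_hermiteMulti_mul_oscillator {ħ : ℝ} (hħ : 0 < ħ) (n : Fin m → ℕ) (j : Fin m)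
    (u : 𝓢(E m, ℂ)) :
    ∫ x, (hermiteMulti ħ n x : ℂ) * schwartzOscillator ħ (EuclideanSpace.single j (1 : ℝ))
        (EuclideanSpace.proj j) u x
      = oscillatorEigenvalue ħ n j * ∫ x, (hermiteMulti ħ n x : ℂ) * u x := by
  simp only [← hermiteSchwartz_apply hħ]
  rw [integral_mul_schwartzOscillator, ← integral_const_mul]
  congr 1
  ext x
  rw [schwartzOscillator_hermiteSchwartz hħ, oscillatorEigenvalue, mul_assoc]

lemma inner_hermiteProd_toLp {ħ : ℝ} (hħ : 0 < ħ) (n : Fin m → ℕ) (u : 𝓢(E m, ℂ)) :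
    inner ℂ (hermiteProd ħ n) (u.toLp 2 volume) = ∫ x, (hermiteMulti ħ n x : ℂ) * u x := by
  rw [inner_hermiteProd hħ]
  refine integral_congr_ae ?_
  filter_upwards [u.coeFn_toLp 2 volume] with x hx
  rw [hx]

lemma mem_oscillatorGraph_iff {ħ : ℝ} {j : Fin m} {p : L2 (E m) × L2 (E m)} :
    p ∈ oscillatorGraph ħ j ↔ ∃ u : 𝓢(E m, ℂ), p = (u.toLp 2 volume,
      (schwartzOscillator ħ (EuclideanSpace.single j (1 : ℝ)) (EuclideanSpace.proj j) u).toLp 2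
        volume) := by
  have e : ∀ u : 𝓢(E m, ℂ), (fun x : E m => -(ħ : ℂ) ^ 2 * iteratedDeriv 2
      (fun t : ℝ => u (x + t • EuclideanSpace.single j (1 : ℝ))) 0 + (x j : ℂ) ^ 2 * u x)
      = schwartzOscillator ħ (EuclideanSpace.single j (1 : ℝ)) (EuclideanSpace.proj j) u := by
    intro u
    ext x
    rw [schwartzOscillator_apply, iteratedDeriv_two_schwartz_line]
    rfl
  constructor
  · rintro ⟨u, h1, h2⟩
    rw [e] at h2
    exact ⟨u, Prod.ext (eq_toLp_of_ae_eq h1) (eq_toLp_of_ae_eq h2)⟩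
  · rintro ⟨u, rfl⟩
    refine ⟨u, u.coeFn_toLp 2 volume, ?_⟩
    rw [e]
    exact SchwartzMap.coeFn_toLp _ 2 volume

lemma oscillatorGraph_essentiallySelfAdjoint {ħ : ℝ} (hħ : 0 < ħ) (j : Fin m) :
    IsEssentiallySelfAdjoint (schwartzClasses (E m)) (oscillatorGraph ħ j) ∧
      (oscillator ħ j).graph = diagonalGraph (hermiteLine hħ) (oscillatorScalar ħ j) := by
  have h := (isOrthogonalSum_hermiteLine (m := m) hħ).essentiallySelfAdjoint
    (A := oscillatorScalar ħ j) (fun n => ?_) (G := oscillatorGraph ħ j)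
    (LinearMap.range (SchwartzMap.toLpCLM ℂ ℂ 2 (volume : Measure (E m))).toLinearMap) ?_ ?_
    (D₀ := Set.univ) dense_univ ?_
  · rwa [← schwartzClasses_eq] at h
  · refine ContinuousLinearMap.isSelfAdjoint_iff_isSymmetric.2 fun x y => ?_
    simp only [oscillatorScalar, ContinuousLinearMap.coe_coe, smul_apply,
      ContinuousLinearMap.id_apply, inner_smul_left, inner_smul_right, Complex.conj_ofReal]
  · intro p hp n
    obtain ⟨u, rfl⟩ := mem_oscillatorGraph_iff.1 hp
    rw [component_hermiteLine, component_hermiteLine, inner_hermiteProd_toLp hħ,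
      inner_hermiteProd_toLp hħ, integral_hermiteMulti_mul_oscillator hħ]
    rfl
  · rw [← schwartzClasses_eq]
    ext g
    constructor
    · rintro ⟨p, ⟨u, h1, h2⟩, rfl⟩
      exact ⟨u, h1⟩
    · rintro ⟨u, hu⟩
      exact ⟨_, mem_oscillatorGraph_iff.2 ⟨u, rfl⟩, (eq_toLp_of_ae_eq hu).symm⟩
  · intro n c _
    refine mem_oscillatorGraph_iff.2 ⟨c • hermiteSchwartz hħ n, ?_⟩
    have e : schwartzOscillator ħ (EuclideanSpace.single j (1 : ℝ)) (EuclideanSpace.proj j)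
        (c • hermiteSchwartz hħ n)
        = (oscillatorEigenvalue ħ n j * c) • hermiteSchwartz hħ n := by
      have h1 : schwartzOscillator ħ (EuclideanSpace.single j (1 : ℝ)) (EuclideanSpace.proj j)
          (c • hermiteSchwartz hħ n) = c • schwartzOscillator ħ (EuclideanSpace.single j (1 : ℝ))
          (EuclideanSpace.proj j) (hermiteSchwartz hħ n) := by
        simp only [schwartzOscillator, LineDeriv.lineDerivOp_smul, map_smul, smul_add]
        rw [smul_comm]
      rw [h1]
      ext x
      rw [smul_apply, schwartzOscillator_hermiteSchwartz hħ, smul_apply, smul_eq_mul, smul_eq_mul,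
        oscillatorEigenvalue]
      ring
    rw [e, hermiteLine_apply, hermiteLine_apply, hermiteProd_eq hħ]
    rfl

lemma mem_jointEigenspace_iff {ħ : ℝ} (hħ : 0 < ħ) {l : Fin m → ℝ} {v : L2 (E m)} :
    v ∈ jointEigenspace (oscillator ħ) l ↔
      ∀ n, inner ℂ (hermiteProd ħ n) v ≠ 0 → l = oscillatorEigenvalue ħ n := by
  rw [jointEigenspace, Submodule.mem_iInf]
  simp only [mem_eigenspace_iff, (oscillatorGraph_essentiallySelfAdjoint hħ _).2,
    mem_diagonalGraph, component_hermiteLine, oscillatorScalar, inner_smul_right, smul_apply,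
    ContinuousLinearMap.id_apply, smul_eq_mul]
  constructor
  · intro h n hn
    ext j
    exact_mod_cast mul_right_cancel₀ hn (h j n)
  · intro h j n
    by_cases hn : inner ℂ (hermiteProd ħ n) v = 0
    · rw [hn, mul_zero, mul_zero]
    · rw [h n hn]

lemma jointEigenspace_eigenvalue {ħ : ℝ} (hħ : 0 < ħ) (n : Fin m → ℕ) :
    jointEigenspace (oscillator ħ) (oscillatorEigenvalue ħ n)
      = Submodule.span ℂ {hermiteProd ħ n} := by
  ext v
  rw [mem_jointEigenspace_iff hħ, Submodule.mem_span_singleton]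
  constructor
  · intro h
    refine ⟨inner ℂ (hermiteProd ħ n) v, (isOrthogonalSum_hermiteLine hħ).ext fun k => ?_⟩
    rw [component_hermiteLine, component_hermiteLine, inner_smul_right,
      inner_hermiteProd_hermiteProd hħ]
    by_cases hk : k = n
    · subst hk
      simp
    · rw [if_neg hk, mul_zero]
      by_contra h0
      exact hk (oscillatorEigenvalue_injective hħ (h k fun h1 => h0 h1.symm)).symm
  · rintro ⟨c, rfl⟩ k hk
    rw [inner_smul_right, inner_hermiteProd_hermiteProd hħ] at hk
    by_cases h : k = n
    · rw [h]
    · rw [if_neg h, mul_zero] at hk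
      exact absurd rfl hk

lemma jointEigenspace_eq_bot {ħ : ℝ} (hħ : 0 < ħ) {l : Fin m → ℝ}
    (hl : l ∉ Set.range (oscillatorEigenvalue ħ)) : jointEigenspace (oscillator ħ) l = ⊥ := by
  rw [Submodule.eq_bot_iff]
  intro v hv
  refine hermiteProd_total hħ fun n => ?_
  by_contra h
  exact hl ⟨n, ((mem_jointEigenspace_iff hħ).1 hv n h).symm⟩

lemma hasPurePointSpectrum_oscillator {ħ : ℝ} (hħ : 0 < ħ) :
    HasPurePointSpectrum (oscillator ħ : Fin m → _) := by
  rw [HasPurePointSpectrum, Submodule.topologicalClosure_eq_top_iff, Submodule.eq_bot_iff]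
  intro v hv
  refine hermiteProd_total hħ fun n => hv _ ?_
  refine Submodule.mem_iSup_of_mem (oscillatorEigenvalue ħ n) ?_
  rw [jointEigenspace_eigenvalue hħ]
  exact Submodule.mem_span_singleton_self _

/-- The functional calculus of the oscillators, for a function that vanishes at all but finitely
many eigenvalues. -/
lemma functionalCalculus_oscillator {ħ : ℝ} (hħ : 0 < ħ) (g : (Fin m → ℝ) → ℝ)
    (S : Finset (Fin m → ℕ)) (hS : ∀ n ∉ S, g (oscillatorEigenvalue ħ n) = 0) (v : L2 (E m)) :
    functionalCalculus (oscillator ħ) g v = ∑ n ∈ S,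
      (g (oscillatorEigenvalue ħ n) : ℂ) • inner ℂ (hermiteProd ħ n) v • hermiteProd ħ n := by
  have hterm : ∀ n, (g (oscillatorEigenvalue ħ n) : ℂ) •
      (jointEigenspace (oscillator ħ) (oscillatorEigenvalue ħ n)).topologicalClosure.starProjection v
      = (g (oscillatorEigenvalue ħ n) : ℂ) • inner ℂ (hermiteProd ħ n) v • hermiteProd ħ n := by
    intro n
    have e : (jointEigenspace (oscillator ħ) (oscillatorEigenvalue ħ n)).topologicalClosure
        = Submodule.span ℂ {hermiteProd ħ n} := by
      rw [jointEigenspace_eigenvalue hħ]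
      exact (Submodule.closed_of_finiteDimensional _).submodule_topologicalClosure_eq
    congr 1
    rw [← Submodule.starProjection_unit_singleton ℂ (norm_hermiteProd hħ n)]
    congr 2
  have hsupp : Function.support (fun l : Fin m → ℝ => (g l : ℂ) •
      (jointEigenspace (oscillator ħ) l).topologicalClosure.starProjection v)
      ⊆ Set.range (oscillatorEigenvalue ħ) := by
    intro l hl
    by_contra h
    refine hl ?_
    have e : (jointEigenspace (oscillator ħ) l).topologicalClosure = ⊥ := by
      rw [jointEigenspace_eq_bot hħ h]
      exact (Submodule.closed_of_finiteDimensional _).submodule_topologicalClosure_eq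
    have e2 : (jointEigenspace (oscillator ħ) l).topologicalClosure.starProjection v = 0 := by
      have h3 := Submodule.starProjection_apply_mem
        (jointEigenspace (oscillator ħ) l).topologicalClosure v
      exact (Submodule.mem_bot ℂ).1 (e.le h3)
    simp only [e2, smul_zero]
  rw [functionalCalculus, ← (oscillatorEigenvalue_injective hħ).tsum_eq hsupp]
  simp only [hterm]
  exact tsum_eq_sum fun n hn => by rw [hS n hn, Complex.ofReal_zero, zero_smul]

end Oscillators

/-! ### Weyl quantization in two groups of variables -/

section Slices

variable {V W : Type} [NormedAddCommGroup V] [NormedSpace ℝ V]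
  [NormedAddCommGroup W] [NormedSpace ℝ W]

/-- The Schwartz function `x ↦ ψ (y, x)`. -/
def sliceSnd (y : V) (ψ : 𝓢(V × W, ℂ)) : 𝓢(W, ℂ) :=
  SchwartzMap.compCLM ℝ (g := fun x : W => (y, x))
    (by
      have h := (Function.HasTemperateGrowth.const (E := W) ((y, 0) : V × W)).add
        (ContinuousLinearMap.inr ℝ V W).hasTemperateGrowth
      convert h using 1
      ext x <;> simp)
    ⟨1, 1, fun x => by
      rw [one_mul, pow_one]
      linarith [norm_snd_le (y, x)]⟩ ψ

@[simp] lemma sliceSnd_apply (y : V) (ψ : 𝓢(V × W, ℂ)) (x : W) : sliceSnd y ψ x = ψ (y, x) := rfl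

/-- The Schwartz function `y ↦ ψ (y, x)`. -/
def sliceFst (x : W) (ψ : 𝓢(V × W, ℂ)) : 𝓢(V, ℂ) :=
  SchwartzMap.compCLM ℝ (g := fun y : V => (y, x))
    (by
      have h := (Function.HasTemperateGrowth.const (E := V) ((0, x) : V × W)).add
        (ContinuousLinearMap.inl ℝ V W).hasTemperateGrowth
      convert h using 1
      ext y <;> simp)
    ⟨1, 1, fun y => by
      rw [one_mul, pow_one]
      linarith [norm_fst_le (y, x)]⟩ ψ

@[simp] lemma sliceFst_apply (x : W) (ψ : 𝓢(V × W, ℂ)) (y : V) : sliceFst x ψ y = ψ (y, x) := rfl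

lemma sliceSnd_schwartzOscillator (ħ : ℝ) (e : W) (l : W →L[ℝ] ℝ) (y : V) (ψ : 𝓢(V × W, ℂ)) :
    sliceSnd y (schwartzOscillator ħ ((0, e) : V × W) (l.comp (ContinuousLinearMap.snd ℝ V W)) ψ)
      = schwartzOscillator ħ e l (sliceSnd y ψ) := by
  ext x
  rw [sliceSnd_apply, schwartzOscillator_apply, schwartzOscillator_apply,
    ← iteratedDeriv_two_schwartz_line, ← iteratedDeriv_two_schwartz_line]
  simp

end Slices

section Product

variable {V : Type} [NormedAddCommGroup V] [InnerProductSpace ℝ V] [FiniteDimensional ℝ V]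
  [MeasurableSpace V] [BorelSpace V]

open Real (fourierChar)
open LineDeriv

lemma fourierChar_mul_fourierChar_mul (s t : ℝ) (z : ℂ) :
    (fourierChar s : ℂ) * ((fourierChar t : ℂ) * z) = (fourierChar (s + t) : ℂ) * z := by
  rw [AddChar.map_add_eq_mul, Circle.coe_mul, mul_assoc]

/-- The inner integral of the Weyl quantization in two groups of variables, with `2πħ = 1`, of a
symbol that depends on the first group only. -/
def prodInner (b : V × V → ℂ) (χ : V × V → ℂ) (y x : V) (p : V × V) : ℂ :=
  ∫ q : V × V, (fourierChar (inner ℝ (y - q.1) p.1 + inner ℝ (x - q.2) p.2) : ℂ) *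
    (b ((1 / 2 : ℝ) • (y + q.1), p.1) * χ q)

omit [FiniteDimensional ℝ V] [MeasurableSpace V] [BorelSpace V] in
lemma BddDeriv.comp_midpoint_fst {N : ℕ} {M : ℝ} {b : V × V → ℂ} (hb : BddDeriv N M b) (y η : V) :
    BddDeriv N M fun q : V × V => b ((1 / 2 : ℝ) • (y + q.1), η) := by
  have h := (hb.comp_midpoint y η).comp_affine 0 (ContinuousLinearMap.fst ℝ V V)
    (ContinuousLinearMap.norm_fst_le ℝ V V)
  simpa using h

lemma exists_norm_prodInner_le (χ : 𝓢(V × V, ℂ)) (N : ℕ) :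
    ∃ C, 0 ≤ C ∧ ∀ (M : ℝ) (b : V × V → ℂ), BddDeriv N M b → ∀ y x p,
      ‖prodInner b χ y x p‖ ≤ C * M * ((1 + ‖p‖) ^ N)⁻¹ := by
  obtain ⟨C, hC0, hC⟩ := exists_norm_fourierIntegral_mul_le volume (isPerfect_prodPairing (E := V)) χ N
  refine ⟨C, hC0, fun M b hb y x p => ?_⟩
  have h := hC M _ (hb.comp_midpoint_fst y p.1) p
  have e : prodInner b χ y x p = (fourierChar (inner ℝ y p.1 + inner ℝ x p.2) : ℂ) *
      ∫ q, (fourierChar (-(prodPairing V q p)) : ℂ) *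
        (b ((1 / 2 : ℝ) • (y + q.1), p.1) * χ q) := by
    rw [prodInner, ← integral_const_mul]
    congr 1
    ext q
    rw [fourierChar_mul_fourierChar_mul, prodPairing_apply, inner_sub_left, inner_sub_left]
    congr 3
    ring
  rw [e, norm_mul, Circle.norm_coe, one_mul, ← div_eq_mul_inv]
  exact (le_div_iff₀ (by positivity)).2 h

lemma integrable_prodInner_integrand {N : ℕ} {M : ℝ} {b : V × V → ℂ} (hb : BddDeriv N M b)
    (χ : 𝓢(V × V, ℂ)) (y x : V) (p : V × V) :
    Integrable fun q : V × V => (fourierChar (inner ℝ (y - q.1) p.1 + inner ℝ (x - q.2) p.2) : ℂ) *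
      (b ((1 / 2 : ℝ) • (y + q.1), p.1) * χ q) := by
  have hbc := hb.continuous
  have hχ := χ.continuous
  refine (χ.integrable.norm.const_mul M).mono' (Continuous.aestronglyMeasurable (by fun_prop))
    (Filter.Eventually.of_forall fun q => ?_)
  rw [norm_mul, Circle.norm_coe, one_mul, norm_mul]
  gcongr
  exact hb.norm_le _

lemma continuous_prodInner {N : ℕ} {M : ℝ} {b : V × V → ℂ} (hb : BddDeriv N M b)
    (χ : 𝓢(V × V, ℂ)) (y x : V) : Continuous (prodInner b χ y x) := by
  have hbc := hb.continuous
  have hχ := χ.continuous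
  refine continuous_of_dominated (bound := fun q => M * ‖χ q‖) (fun p => ?_) (fun p => ?_)
    (χ.integrable.norm.const_mul M) (Filter.Eventually.of_forall fun q => by fun_prop)
  · exact (integrable_prodInner_integrand hb χ y x p).aestronglyMeasurable
  · refine Filter.Eventually.of_forall fun q => ?_
    rw [norm_mul, Circle.norm_coe, one_mul, norm_mul]
    gcongr
    exact hb.norm_le _

lemma integrable_prodInner {N : ℕ} {M : ℝ} {b : V × V → ℂ} (hb : BddDeriv N M b)
    (hN : Module.finrank ℝ (V × V) < N) (χ : 𝓢(V × V, ℂ)) (y x : V) :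
    Integrable (prodInner b χ y x) := by
  obtain ⟨C, -, hC⟩ := exists_norm_prodInner_le χ N
  exact ((integrable_inv_one_add_norm_pow volume hN).const_mul (C * M)).mono'
    (continuous_prodInner hb χ y x).aestronglyMeasurable
    (Filter.Eventually.of_forall fun p => hC M b hb y x p)

/-- The quantization in the second group of variables of a symbol that does not depend on them is
the identity. -/
lemma integral_prodInner {N : ℕ} {M : ℝ} {b : V × V → ℂ} (hb : BddDeriv N M b)
    (hN : Module.finrank ℝ (V × V) < N) (χ : 𝓢(V × V, ℂ)) (y x : V) :
    ∫ p, prodInner b χ y x p = weylOp b (sliceFst x χ) y := by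
  have hbc := hb.continuous
  have hχ := χ.continuous
  have hN' : Module.finrank ℝ V < N := by
    rw [Module.finrank_prod] at hN
    omega
  have hInt := integrable_prodInner hb hN χ y x
  rw [Measure.volume_eq_prod] at hInt ⊢
  rw [integral_prod _ hInt, weylOp]
  congr 1
  ext η
  set Φ : V → ℂ := fun x' => ∫ y', (fourierChar (inner ℝ (y - y') η) : ℂ) *
    (b ((1 / 2 : ℝ) • (y + y'), η) * χ (y', x')) with hΦ
  have hΦi2 : Integrable (fun q : V × V => (fourierChar (inner ℝ (y - q.2) η) : ℂ) *
      (b ((1 / 2 : ℝ) • (y + q.2), η) * χ (q.2, q.1))) (volume.prod volume) := by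
    have hs : Integrable (fun q : V × V => χ (q.2, q.1)) (volume.prod volume) :=
      (χ.integrable (μ := (volume : Measure (V × V)))).swap
    refine (hs.norm.const_mul M).mono' (Continuous.aestronglyMeasurable (by fun_prop))
      (Filter.Eventually.of_forall fun q => ?_)
    rw [norm_mul, Circle.norm_coe, one_mul, norm_mul]
    gcongr
    exact hb.norm_le _
  have hΦi : Integrable Φ := hΦi2.integral_prod_left
  have hΦc : Continuous Φ := by
    obtain ⟨C, hC0, hC⟩ := exists_norm_iteratedFDeriv_snd_le χ (Module.finrank ℝ V + 1) 0
    refine continuous_of_dominated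
      (bound := fun y' => M * (C * ((1 + ‖y'‖) ^ (Module.finrank ℝ V + 1))⁻¹)) (fun x' => ?_)
      (fun x' => Filter.Eventually.of_forall fun y' => ?_)
      (((integrable_inv_one_add_norm_pow (volume : Measure V) (Nat.lt_succ_self _)).const_mul
        C).const_mul M) (Filter.Eventually.of_forall fun y' => by fun_prop)
    · exact Continuous.aestronglyMeasurable (by fun_prop)
    · rw [norm_mul, Circle.norm_coe, one_mul, norm_mul]
      have h1 := hC y' x'
      rw [norm_iteratedFDeriv_zero] at h1
      have h2 : ((1 + ‖x'‖) ^ (Module.finrank ℝ V + 1))⁻¹ ≤ 1 :=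
        inv_le_one_of_one_le₀ (one_le_pow₀ (by linarith [norm_nonneg x']))
      refine mul_le_mul (hb.norm_le _) (h1.trans ?_) (norm_nonneg _) hb.nonneg
      exact mul_le_of_le_one_right (by positivity) h2
  have hG : ∀ ξ, prodInner b χ y x (η, ξ)
      = (fourierChar (inner ℝ ξ x) : ℂ) * FourierTransform.fourier Φ ξ := by
    intro ξ
    have h1 := integrable_prodInner_integrand hb χ y x (η, ξ)
    rw [Measure.volume_eq_prod] at h1
    rw [prodInner, Measure.volume_eq_prod, integral_prod_symm _ h1, Real.fourier_eq,
      ← integral_const_mul]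
    congr 1
    ext x'
    rw [Circle.smul_def, smul_eq_mul, fourierChar_mul_fourierChar_mul, hΦ, ← integral_const_mul]
    congr 1
    ext y'
    rw [fourierChar_mul_fourierChar_mul]
    congr 3
    simp only [inner_sub_left, real_inner_comm x ξ]
    ring
  have hFi : Integrable (FourierTransform.fourier Φ) := by
    obtain ⟨C, hC0, hC⟩ := exists_norm_prodInner_le χ N
    have hFc : Continuous (FourierTransform.fourier Φ) :=
      VectorFourier.fourierIntegral_continuous Real.continuous_fourierChar continuous_inner hΦi
    refine ((integrable_inv_one_add_norm_pow volume hN').const_mul (C * M)).mono'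
      hFc.aestronglyMeasurable (Filter.Eventually.of_forall fun ξ => ?_)
    have h1 := hC M b hb y x (η, ξ)
    rw [hG, norm_mul, Circle.norm_coe, one_mul] at h1
    refine h1.trans (mul_le_mul_of_nonneg_left ?_ (mul_nonneg hC0 hb.nonneg))
    gcongr
    exact norm_snd_le (η, ξ)
  have hinv := congrFun (hΦc.fourierInv_fourier_eq hΦi hFi) x
  rw [Real.fourierInv_eq] at hinv
  simp only [Circle.smul_def, smul_eq_mul] at hinv
  simp only [hG]
  rw [hinv]
  rfl

/-- Integration by parts in the second group of variables. -/
lemma prodInner_lineDerivOp {N : ℕ} {M : ℝ} {b : V × V → ℂ} (hb : BddDeriv N M b)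
    (χ : 𝓢(V × V, ℂ)) (y x v : V) (p : V × V) :
    prodInner b (∂_{((0, v) : V × V)} χ : 𝓢(V × V, ℂ)) y x p
      = (2 * Real.pi * inner ℝ v p.2 : ℝ) * Complex.I * prodInner b χ y x p := by
  set F : V × V → ℂ := fun q => (fourierChar (inner ℝ (y - q.1) p.1 + inner ℝ (x - q.2) p.2) : ℂ) *
      b ((1 / 2 : ℝ) • (y + q.1), p.1) with hF
  set c : ℂ := -((2 * Real.pi * inner ℝ v p.2 : ℝ) * Complex.I) with hc
  have hline : ∀ q, HasLineDerivAt ℝ F (c * F q) q ((0, v) : V × V) := by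
    intro q
    have e : ∀ t : ℝ, F (q + t • ((0, v) : V × V))
        = Complex.exp (t * c) * F q := by
      intro t
      simp only [hF, Prod.smul_mk, smul_zero, Prod.fst_add, add_zero, Prod.snd_add, hc,
        Real.fourierChar_apply, ← mul_assoc, ← Complex.exp_add]
      congr 2
      rw [← sub_sub, inner_sub_left (x - q.2), inner_smul_left]
      simp only [conj_trivial]
      push_cast
      ring
    rw [HasLineDerivAt]
    simp only [e]
    have h1 : HasDerivAt (fun t : ℝ => Complex.exp ((t : ℂ) * c)) (Complex.exp (((0 : ℝ) : ℂ) * c) * c) 0 := by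
      have h2 : HasDerivAt (fun t : ℝ => (t : ℂ) * c) c 0 := by
        simpa using (HasDerivAt.ofReal_comp (hasDerivAt_id (0 : ℝ))).mul_const c
      exact h2.cexp
    simpa using h1.mul_const (F q)
  have hi : ∀ χ : 𝓢(V × V, ℂ), Integrable fun q => F q * χ q := fun χ => by
    simpa only [hF, mul_assoc] using integrable_prodInner_integrand hb χ y x p
  have hparts := integral_bilinear_hasLineDerivAt_right_eq_neg_left_of_integrable
    (μ := (volume : Measure (V × V))) (f := F) (f' := fun q => c * F q) (g := χ)
    (g' := (∂_{((0, v) : V × V)} χ : 𝓢(V × V, ℂ))) (v := ((0, v) : V × V)) (B := ContinuousLinearMap.mul ℝ ℂ)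
    (by simpa [mul_assoc] using (hi χ).const_mul c) (by simpa using hi (∂_{((0, v) : V × V)} χ))
    (by simpa using hi χ) (fun q _ => hline q)
    (fun q _ => by
      have := (χ.hasFDerivAt q).hasLineDerivAt ((0, v) : V × V)
      exact this)
  simp only [ContinuousLinearMap.mul_apply', mul_assoc c] at hparts
  rw [integral_const_mul, ← neg_mul, hc, neg_neg] at hparts
  simp only [hF, mul_assoc] at hparts
  rw [prodInner, prodInner, hparts]
  simp only [mul_assoc]

lemma prodInner_add {N : ℕ} {M : ℝ} {b : V × V → ℂ} (hb : BddDeriv N M b)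
    (χ θ : 𝓢(V × V, ℂ)) (y x : V) (p : V × V) :
    prodInner b (χ + θ : 𝓢(V × V, ℂ)) y x p = prodInner b χ y x p + prodInner b θ y x p := by
  rw [prodInner, prodInner, prodInner, ← integral_add (integrable_prodInner_integrand hb χ y x p)
    (integrable_prodInner_integrand hb θ y x p)]
  simp only [add_apply, mul_add]

lemma prodInner_smul (b : V × V → ℂ) (c : ℂ) (χ : V × V → ℂ) (y x : V) (p : V × V) :
    prodInner b (c • χ) y x p = c * prodInner b χ y x p := by
  rw [prodInner, prodInner, ← integral_const_mul]
  congr 1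
  ext q
  simp only [Pi.smul_apply, smul_eq_mul]
  ring

end Product

/-! ### The quadratic part of the normal form -/

section Model

variable {m : ℕ}

open Real (fourierChar)
open LineDeriv

/-- The harmonic oscillator in the variable `x_j` on Schwartz functions of `(y, x)`. -/
def oscillatorSnd (ħ : ℝ) (j : Fin m) (ψ : 𝓢(E m × E m, ℂ)) : 𝓢(E m × E m, ℂ) :=
  schwartzOscillator ħ ((0, EuclideanSpace.single j (1 : ℝ)) : E m × E m)
    ((EuclideanSpace.proj j : E m →L[ℝ] ℝ).comp (ContinuousLinearMap.snd ℝ (E m) (E m))) ψ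

lemma modelAction_eq_integral {ħ : ℝ} (hħ : 0 < ħ) (β : Fin m → E m × E m → ℝ)
    (ψ : E m × E m → ℂ) (y x : E m) :
    modelAction β ħ ψ (planckLength ħ • y, planckLength ħ • x) = ∫ p : E m × E m, ∫ q : E m × E m,
      (fourierChar (inner ℝ (y - q.1) p.1 + inner ℝ (x - q.2) p.2) : ℂ) *
        ((∑ j, scaledSymbol ħ (β j) ((1 / 2 : ℝ) • (y + q.1), p.1) *
          ((planckLength ħ : ℂ) ^ 2 * ((1 / 2 * (x j + q.2 j) : ℂ) ^ 2 + (p.2 j : ℂ) ^ 2))) *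
          ψ (planckLength ħ • q)) := by
  have hl := planckLength_pos hħ
  have hc : (planckLength ħ : ℂ) ≠ 0 := by exact_mod_cast hl.ne'
  have hsq : (2 * (Real.pi : ℂ) * ħ) = (planckLength ħ : ℂ) ^ 2 := by
    rw [← Complex.ofReal_pow, planckLength_sq hħ]
    push_cast
    rfl
  have hpt : ∀ p q : E m × E m, Complex.exp (Complex.I * ((pairEE
      ((planckLength ħ • y, planckLength ħ • x) - planckLength ħ • q) (planckLength ħ • p) / ħ : ℝ) : ℂ)) •
      ((∑ j, β j (((1 / 2 : ℝ) • ((planckLength ħ • y, planckLength ħ • x) + planckLength ħ • q)).1,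
        (planckLength ħ • p).1) *
        (((1 / 2 : ℝ) • ((planckLength ħ • y, planckLength ħ • x) + planckLength ħ • q)).2 j ^ 2
          + (planckLength ħ • p).2 j ^ 2) : ℝ) : ℂ) • ψ (planckLength ħ • q)
      = (fourierChar (inner ℝ (y - q.1) p.1 + inner ℝ (x - q.2) p.2) : ℂ) *
        ((∑ j, scaledSymbol ħ (β j) ((1 / 2 : ℝ) • (y + q.1), p.1) *
          ((planckLength ħ : ℂ) ^ 2 * ((1 / 2 * (x j + q.2 j) : ℂ) ^ 2 + (p.2 j : ℂ) ^ 2))) *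
          ψ (planckLength ħ • q)) := by
    intro p q
    rw [← exp_eq_fourierChar hħ, smul_eq_mul, smul_eq_mul, Complex.ofReal_sum]
    congr 1
    · congr 4
      simp only [pairEE, Prod.fst_sub, Prod.snd_sub, Prod.smul_fst, Prod.smul_snd, ← smul_sub,
        inner_smul_left, inner_smul_right, conj_trivial]
      ring
    · congr 1
      refine Finset.sum_congr rfl fun j _ => ?_
      rw [Complex.ofReal_mul, scaledSymbol]
      congr 1
      · congr 2
        simp only [Prod.smul_mk, Prod.smul_fst, Prod.fst_add]
        rw [← smul_add, smul_comm]
      · simp only [Prod.smul_snd, Prod.snd_add, PiLp.smul_apply, PiLp.add_apply, smul_eq_mul]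
        push_cast
        ring
  rw [modelAction, weyl, integral_eq_integral_smul volume hl]
  simp only [fun p : E m × E m => integral_eq_integral_smul (volume : Measure (E m × E m)) hl
    (fun q : E m × E m => Complex.exp (Complex.I * ((pairEE
      ((planckLength ħ • y, planckLength ħ • x) - q) (planckLength ħ • p) / ħ : ℝ) : ℂ)) •
      ((∑ j, β j (((1 / 2 : ℝ) • ((planckLength ħ • y, planckLength ħ • x) + q)).1,
        (planckLength ħ • p).1) *
        (((1 / 2 : ℝ) • ((planckLength ħ • y, planckLength ħ • x) + q)).2 j ^ 2
          + (planckLength ħ • p).2 j ^ 2) : ℝ) : ℂ) • ψ q), hpt]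
  rw [integral_smul, smul_smul, ← mul_pow, ← sq, hsq, Complex.real_smul, Complex.ofReal_pow,
    Complex.ofReal_pow, smul_eq_mul, inv_mul_cancel_left₀ (by positivity)]

lemma schwartzDilate_lineDerivOp {V : Type} [NormedAddCommGroup V] [NormedSpace ℝ V] (c : ℝ)
    (hc : c ≠ 0) (v : V) (ψ : 𝓢(V, ℂ)) :
    ∂_{v} (schwartzDilate c hc ψ) = c • schwartzDilate c hc (∂_{v} ψ) := by
  rw [schwartzDilate, SchwartzMap.lineDerivOp_compCLMOfContinuousLinearEquiv]
  have e : (ContinuousLinearEquiv.smulLeft (Units.mk0 c hc) : V ≃L[ℝ] V) v = c • v := rfl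
  rw [e, lineDerivOp_left_smul, map_smul]
  rfl

/-- The quantization of `∑_j β_j(w) |z_j|²`. -/
lemma modelAction_eq {ħ : ℝ} (hħ : 0 < ħ) {β : Fin m → E m × E m → ℝ}
    (hβ : ∀ j, AllBdd fun w => (β j w : ℂ)) (ψ : 𝓢(E m × E m, ℂ)) (y x : E m) :
    modelAction β ħ ψ (y, x) = ∑ j, weylFun ħ (β j) (sliceFst x (oscillatorSnd ħ j ψ)) y := by
  have hl := planckLength_pos hħ
  set l := planckLength ħ with hldef
  obtain ⟨y, rfl⟩ : ∃ y', y = l • y' := ⟨l⁻¹ • y, (smul_inv_smul₀ hl.ne' y).symm⟩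
  obtain ⟨x, rfl⟩ : ∃ x', x = l • x' := ⟨l⁻¹ • x, (smul_inv_smul₀ hl.ne' x).symm⟩
  choose M hM using fun j => (hβ j).exists_bddDeriv_scaledSymbol ħ
  have hpi : (Real.pi : ℂ) ≠ 0 := by exact_mod_cast Real.pi_ne_zero
  have hsq : (2 * (Real.pi : ℂ) * ħ) = (l : ℂ) ^ 2 := by
    rw [← Complex.ofReal_pow, planckLength_sq hħ]
    push_cast
    rfl
  set ψ' := schwartzDilate l hl.ne' ψ with hψ'
  set e : Fin m → E m × E m := fun j => (0, EuclideanSpace.single j (1 : ℝ)) with he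
  set μ : Fin m → E m × E m → ℂ := fun j q => (1 / 2 * (x j + q.2 j) : ℂ) ^ 2 with hμ
  have hμt : ∀ j, Function.HasTemperateGrowth (μ j) := by
    intro j
    have h1 : Function.HasTemperateGrowth fun q : E m × E m => (q.2 j : ℂ) :=
      (Complex.ofRealCLM.comp ((EuclideanSpace.proj j : E m →L[ℝ] ℝ).comp
        (ContinuousLinearMap.snd ℝ (E m) (E m)))).hasTemperateGrowth
    exact ((Function.HasTemperateGrowth.const (1 / 2 : ℂ)).mul
      ((Function.HasTemperateGrowth.const (x j : ℂ)).add h1)).pow 2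
  set θ : Fin m → 𝓢(E m × E m, ℂ) := fun j => ((l : ℂ) ^ 2) • SchwartzMap.smulLeftCLM ℂ (μ j) ψ'
  set χ : Fin m → 𝓢(E m × E m, ℂ) := fun j =>
    θ j + (-((l : ℂ) ^ 2 / (4 * Real.pi ^ 2))) • ∂_{e j} (∂_{e j} ψ') with hχ
  have hθ : ∀ j q, θ j q = (l : ℂ) ^ 2 * (μ j q * ψ' q) := fun j q => by
    rw [smul_apply, SchwartzMap.smulLeftCLM_apply_apply (hμt j)]
    rfl
  have hder : ∀ j p, prodInner (scaledSymbol ħ (β j)) (χ j) y x p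
      = prodInner (scaledSymbol ħ (β j)) (θ j) y x p
        + (l : ℂ) ^ 2 * (p.2 j : ℂ) ^ 2 * prodInner (scaledSymbol ħ (β j)) ψ' y x p := by
    intro j p
    rw [hχ, prodInner_add (hM j)]
    have h1 : ((-((l : ℂ) ^ 2 / (4 * Real.pi ^ 2))) • ∂_{e j} (∂_{e j} ψ') : 𝓢(E m × E m, ℂ))
        = ((-((l : ℂ) ^ 2 / (4 * Real.pi ^ 2))) • (∂_{e j} (∂_{e j} ψ') : 𝓢(E m × E m, ℂ))
          : E m × E m → ℂ) := rfl
    rw [h1, prodInner_smul, prodInner_lineDerivOp (hM j), prodInner_lineDerivOp (hM j)]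
    have h2 : (inner ℝ (EuclideanSpace.single j (1 : ℝ)) p.2 : ℝ) = p.2 j := by
      rw [EuclideanSpace.inner_single_left, conj_trivial, one_mul]
    rw [h2]
    congr 1
    push_cast
    field_simp
    linear_combination (-4 * (l : ℂ) ^ 2 * (p.2 j : ℂ) ^ 2 *
      prodInner (scaledSymbol ħ (β j)) ψ' y x p) * Complex.I_sq
  have hinner : ∀ p : E m × E m, ∫ q : E m × E m,
      (fourierChar (inner ℝ (y - q.1) p.1 + inner ℝ (x - q.2) p.2) : ℂ) *
        ((∑ j, scaledSymbol ħ (β j) ((1 / 2 : ℝ) • (y + q.1), p.1) *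
          ((l : ℂ) ^ 2 * ((1 / 2 * (x j + q.2 j) : ℂ) ^ 2 + (p.2 j : ℂ) ^ 2))) * ψ (l • q))
      = ∑ j, prodInner (scaledSymbol ħ (β j)) (χ j) y x p := by
    intro p
    rw [Finset.sum_congr rfl fun j _ => hder j p]
    simp only [prodInner, ← integral_const_mul]
    have hi1 := fun j => integrable_prodInner_integrand (hM j) (θ j) y x p
    have hi2 := fun j => (integrable_prodInner_integrand (hM j) ψ' y x p).const_mul
      ((l : ℂ) ^ 2 * (p.2 j : ℂ) ^ 2)
    rw [Finset.sum_congr rfl fun j _ => (integral_add (hi1 j) (hi2 j)).symm]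
    refine Eq.trans ?_ (integral_finsetSum _ fun j _ => (hi1 j).add (hi2 j))
    congr 1
    ext q
    beta_reduce
    rw [Finset.sum_mul, Finset.mul_sum]
    refine Finset.sum_congr rfl fun j _ => ?_
    rw [hθ]
    have h3 : ψ (l • q) = ψ' q := rfl
    rw [h3]
    simp only [hμ]
    ring
  rw [modelAction_eq_integral hħ]
  simp only [← hldef, hinner]
  have hN : Module.finrank ℝ (E m × E m) < Module.finrank ℝ (E m × E m) + 1 := Nat.lt_succ_self _
  rw [integral_finsetSum _ fun j _ => integrable_prodInner (hM j) hN (χ j) y x]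
  refine Finset.sum_congr rfl fun j _ => ?_
  rw [integral_prodInner (hM j) hN, weylFun_eq hħ, ← hldef, inv_smul_smul₀ hl.ne']
  congr 1
  ext y'
  have h4 : (∂_{e j} (∂_{e j} ψ')) (y', x) = (l : ℂ) ^ 2 * (∂_{e j} (∂_{e j} ψ)) (l • (y', x)) := by
    rw [hψ', schwartzDilate_lineDerivOp, lineDerivOp_smul, schwartzDilate_lineDerivOp, smul_smul,
      smul_apply, schwartzDilate_apply, Complex.real_smul]
    push_cast
    ring
  rw [sliceFst_apply, sliceFst_apply, hχ, add_apply, hθ, smul_apply, h4, oscillatorSnd,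
    schwartzOscillator_apply]
  have h5 : ψ' (y', x) = ψ (l • y', l • x) := rfl
  have h6 : μ j (y', x) = (x j : ℂ) ^ 2 := by simp only [hμ]; ring
  have h7 : ((EuclideanSpace.proj j : E m →L[ℝ] ℝ).comp (ContinuousLinearMap.snd ℝ (E m) (E m)))
      (l • y', l • x) = l * x j := rfl
  have h8 : (ħ : ℂ) ^ 2 = (l : ℂ) ^ 2 * (l : ℂ) ^ 2 / (4 * Real.pi ^ 2) := by
    rw [← hsq]
    field_simp
    ring
  rw [h5, h6, h7, h8, smul_eq_mul, Prod.smul_mk, Complex.ofReal_mul]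
  simp only [he]
  ring

end Model

/-! ### Partial integrals of Schwartz functions -/

section PartialIntegral

variable {V W : Type} [NormedAddCommGroup V] [NormedSpace ℝ V] [NormedAddCommGroup W]
  [NormedSpace ℝ W] [FiniteDimensional ℝ W] [MeasurableSpace W] [BorelSpace W]
  {F : Type} [NormedAddCommGroup F] [NormedSpace ℝ F]

omit [FiniteDimensional ℝ W] [MeasurableSpace W] [BorelSpace W] in
lemma exists_norm_apply_mk_le (ψ : 𝓢(V × W, F)) (k N : ℕ) :
    ∃ C, 0 ≤ C ∧ ∀ y x, (1 + ‖y‖) ^ k * ‖ψ (y, x)‖ ≤ C * ((1 + ‖x‖) ^ N)⁻¹ := by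
  obtain ⟨C, hC0, hC⟩ := exists_one_add_norm_pow_mul_norm_iteratedFDeriv_le ψ (k + N) 0
  refine ⟨C, hC0, fun y x => ?_⟩
  rw [← div_eq_mul_inv, le_div_iff₀ (by positivity)]
  have h := hC (y, x)
  rw [norm_iteratedFDeriv_zero, pow_add] at h
  refine le_trans ?_ h
  rw [mul_right_comm]
  gcongr
  · exact norm_fst_le (y, x)
  · exact norm_snd_le (y, x)

lemma integrable_apply_mk (μ : Measure W) [μ.IsAddHaarMeasure] (ψ : 𝓢(V × W, F)) (y : V) :
    Integrable (fun x => ψ (y, x)) μ := by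
  obtain ⟨C, -, hC⟩ := exists_norm_apply_mk_le ψ 0 (Module.finrank ℝ W + 1)
  refine ((integrable_inv_one_add_norm_pow μ (Nat.lt_succ_self _)).const_mul C).mono'
    (ψ.continuous.comp (by fun_prop)).aestronglyMeasurable (Filter.Eventually.of_forall fun x => ?_)
  simpa using hC y x

/-- The derivative of a Schwartz function in the first group of variables. -/
def fderivFst (ψ : 𝓢(V × W, F)) : 𝓢(V × W, V →L[ℝ] F) :=
  SchwartzMap.postcompCLM (𝕜 := ℝ)
    ((ContinuousLinearMap.compL ℝ V (V × W) F).flip (ContinuousLinearMap.inl ℝ V W))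
    (SchwartzMap.fderivCLM ℝ (V × W) F ψ)

omit [FiniteDimensional ℝ W] [MeasurableSpace W] [BorelSpace W] in
lemma hasFDerivAt_apply_mk (ψ : 𝓢(V × W, F)) (y : V) (x : W) :
    HasFDerivAt (fun y => ψ (y, x)) (fderivFst ψ (y, x)) y :=
  (ψ.hasFDerivAt (y, x)).comp y (hasFDerivAt_prodMk_left y x)

lemma hasFDerivAt_integral_apply_mk (μ : Measure W) [μ.IsAddHaarMeasure] (ψ : 𝓢(V × W, F)) (y : V) :
    HasFDerivAt (fun y => ∫ x, ψ (y, x) ∂μ) (∫ x, fderivFst ψ (y, x) ∂μ) y := by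
  obtain ⟨C, -, hC⟩ := exists_norm_apply_mk_le (fderivFst ψ) 0 (Module.finrank ℝ W + 1)
  refine hasFDerivAt_integral_of_dominated_of_fderiv_le (s := Set.univ) Filter.univ_mem
    (Filter.Eventually.of_forall fun y => (integrable_apply_mk μ ψ y).aestronglyMeasurable)
    (integrable_apply_mk μ ψ y) (integrable_apply_mk μ (fderivFst ψ) y).aestronglyMeasurable
    (Filter.Eventually.of_forall fun x y _ => ?_)
    ((integrable_inv_one_add_norm_pow μ (Nat.lt_succ_self (Module.finrank ℝ W))).const_mul C)
    (Filter.Eventually.of_forall fun x y _ => hasFDerivAt_apply_mk ψ y x)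
  simpa using hC y x

lemma contDiff_integral_apply_mk (μ : Measure W) [μ.IsAddHaarMeasure] (n : ℕ) :
    ∀ {F : Type} [NormedAddCommGroup F] [NormedSpace ℝ F] (ψ : 𝓢(V × W, F)),
      ContDiff ℝ n fun y => ∫ x, ψ (y, x) ∂μ := by
  induction n with
  | zero =>
    intro F _ _ ψ
    exact contDiff_zero.2 (continuous_iff_continuousAt.2 fun y =>
      (hasFDerivAt_integral_apply_mk μ ψ y).continuousAt)
  | succ n ih =>
    intro F _ _ ψ
    rw [Nat.cast_succ, contDiff_succ_iff_hasFDerivAt]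
    exact ⟨_, ih (fderivFst ψ), fun y => hasFDerivAt_integral_apply_mk μ ψ y⟩

lemma exists_norm_iteratedFDeriv_integral_le (μ : Measure W) [μ.IsAddHaarMeasure] (k n : ℕ) :
    ∀ {F : Type} [NormedAddCommGroup F] [NormedSpace ℝ F] (ψ : 𝓢(V × W, F)),
      ∃ C, ∀ y, ‖y‖ ^ k * ‖iteratedFDeriv ℝ n (fun y => ∫ x, ψ (y, x) ∂μ) y‖ ≤ C := by
  induction n with
  | zero =>
    intro F _ _ ψ
    obtain ⟨C, hC0, hC⟩ := exists_norm_apply_mk_le ψ k (Module.finrank ℝ W + 1)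
    refine ⟨∫ x, C * ((1 + ‖x‖) ^ (Module.finrank ℝ W + 1))⁻¹ ∂μ, fun y => ?_⟩
    rw [norm_iteratedFDeriv_zero]
    calc ‖y‖ ^ k * ‖∫ x, ψ (y, x) ∂μ‖ ≤ (1 + ‖y‖) ^ k * ∫ x, ‖ψ (y, x)‖ ∂μ := by
          gcongr
          · linarith
          · exact norm_integral_le_integral_norm _
      _ = ∫ x, (1 + ‖y‖) ^ k * ‖ψ (y, x)‖ ∂μ := (integral_const_mul _ _).symm
      _ ≤ _ := integral_mono ((integrable_apply_mk μ ψ y).norm.const_mul _)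
          ((integrable_inv_one_add_norm_pow μ (Nat.lt_succ_self _)).const_mul C) (hC y)
  | succ n ih =>
    intro F _ _ ψ
    obtain ⟨C, hC⟩ := ih (fderivFst ψ)
    refine ⟨C, fun y => ?_⟩
    rw [← norm_iteratedFDeriv_fderiv,
      funext fun y => (hasFDerivAt_integral_apply_mk μ ψ y).fderiv]
    exact hC y

/-- The integral of a Schwartz function over the second group of variables. -/
def partialIntegral (μ : Measure W) [μ.IsAddHaarMeasure] (ψ : 𝓢(V × W, F)) : 𝓢(V, F) where
  toFun y := ∫ x, ψ (y, x) ∂μ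
  smooth' := contDiff_infty.2 fun n => contDiff_integral_apply_mk μ n ψ
  decay' k n := exists_norm_iteratedFDeriv_integral_le μ k n ψ

/-- The function `y ↦ ∫ φ(x) ψ(y, x) dx`. -/
def partialPairing (μ : Measure W) [μ.IsAddHaarMeasure] (φ : 𝓢(W, ℂ)) (ψ : 𝓢(V × W, ℂ)) : 𝓢(V, ℂ) :=
  partialIntegral μ (SchwartzMap.smulLeftCLM ℂ (fun p : V × W => φ p.2) ψ)

lemma partialPairing_apply (μ : Measure W) [μ.IsAddHaarMeasure] (φ : 𝓢(W, ℂ)) (ψ : 𝓢(V × W, ℂ))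
    (y : V) : partialPairing μ φ ψ y = ∫ x, φ x * ψ (y, x) ∂μ := by
  have h : Function.HasTemperateGrowth fun p : V × W => φ p.2 :=
    φ.hasTemperateGrowth.comp (ContinuousLinearMap.snd ℝ V W).hasTemperateGrowth
  change ∫ x, SchwartzMap.smulLeftCLM ℂ (fun p : V × W => φ p.2) ψ (y, x) ∂μ = _
  simp only [SchwartzMap.smulLeftCLM_apply_apply h, smul_eq_mul]

end PartialIntegral

/-! ### The perturbation -/

section Perturbation

variable {m : ℕ}

/-- The symbol of the perturbation on the range of `u ↦ u ⊗ h_n`. -/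
def perturbationSymbol (f : E m × E m → (Fin m → ℝ) → ℝ → ℝ) (ħ : ℝ) (n : Fin m → ℕ)
    (w : E m × E m) : ℝ := f w (oscillatorEigenvalue ħ n) ħ

lemma exists_finset_perturbationSymbol_eq_zero {ħ : ℝ} (hħ : 0 < ħ)
    {f : E m × E m → (Fin m → ℝ) → ℝ → ℝ}
    (hf : ∃ K : Set ((Fin m → ℝ) × ℝ), IsCompact K ∧ ∀ w I ħ, (I, ħ) ∉ K → f w I ħ = 0) :
    ∃ S : Finset (Fin m → ℕ), ∀ n ∉ S, perturbationSymbol f ħ n = 0 := by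
  obtain ⟨K, hK, hf⟩ := hf
  obtain ⟨R, hR⟩ := hK.isBounded.exists_norm_le
  obtain ⟨B, hB⟩ := exists_nat_gt (R / ħ)
  refine ⟨Fintype.piFinset fun _ => Finset.range B, fun n hn => funext fun w => hf _ _ _ fun h => hn ?_⟩
  rw [Fintype.mem_piFinset]
  intro j
  rw [Finset.mem_range]
  have h1 : ħ * (2 * n j + 1) ≤ R := by
    refine (le_abs_self _).trans (le_trans ?_ (hR _ h))
    exact (norm_le_pi_norm (oscillatorEigenvalue ħ n) j).trans (norm_fst_le (oscillatorEigenvalue ħ n, ħ))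
  rw [div_lt_iff₀ hħ] at hB
  have h2 : ħ * (n j : ℝ) < ħ * B := by nlinarith [mul_nonneg hħ.le (Nat.cast_nonneg (α := ℝ) (n j))]
  exact_mod_cast lt_of_mul_lt_mul_left h2 hħ.le

lemma toL2_slice (ψ : 𝓢(E m × E m, ℂ)) (y : E m) :
    toL2 (fun x => ψ (y, x)) = (sliceSnd y ψ).toLp 2 volume := by
  have h : MemLp (fun x => ψ (y, x)) 2 (volume : Measure (E m)) := (sliceSnd y ψ).memLp 2 volume
  rw [toL2, dif_pos h]
  rfl

lemma integrable_weylFun_integrand {ħ : ℝ} {a : E m × E m → ℝ}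
    (ha : AllBdd fun w => (a w : ℂ)) (u : 𝓢(E m, ℂ)) (x ξ : E m) :
    Integrable fun x' => Complex.exp (Complex.I * ((pairE (x - x') ξ / ħ : ℝ) : ℂ)) •
        (a ((1 / 2 : ℝ) • (x + x'), ξ) : ℂ) • u x' := by
  obtain ⟨M, hM⟩ := ha.exists_bddDeriv 0
  have hac : Continuous fun w => (a w : ℂ) := hM.continuous
  have hu := u.continuous
  refine (u.integrable.norm.const_mul M).mono' (Continuous.aestronglyMeasurable ?_)
    (Filter.Eventually.of_forall fun x' => ?_)
  · have h1 : Continuous fun x' : E m => (a ((1 / 2 : ℝ) • (x + x'), ξ) : ℂ) :=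
      hac.comp (by fun_prop)
    unfold pairE
    fun_prop
  · rw [norm_smul, mul_comm Complex.I, Complex.norm_exp_ofReal_mul_I, one_mul, norm_smul]
    gcongr
    exact hM.norm_le _

lemma integrable_weylFun_inner {ħ : ℝ} (hħ : 0 < ħ) {a : E m × E m → ℝ}
    (ha : AllBdd fun w => (a w : ℂ)) (u : 𝓢(E m, ℂ)) (x : E m) :
    Integrable fun ξ => ∫ x', Complex.exp (Complex.I * ((pairE (x - x') ξ / ħ : ℝ) : ℂ)) •
        (a ((1 / 2 : ℝ) • (x + x'), ξ) : ℂ) • u x' := by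
  obtain ⟨M, hM⟩ := ha.exists_bddDeriv_scaledSymbol ħ
  have h := planckLength_pos hħ
  rw [← integrable_comp_smul_iff _ _ h.ne']
  simp only [weylFun_inner_eq hħ]
  exact (integrable_weylInner hM finrank_lt_finrank_prod_add_one
    (schwartzDilate _ h.ne' u) _).const_mul _

/-- The quantization of an operator-valued symbol of finite rank. -/
lemma weyl_eq_sum {F ι : Type} [NormedAddCommGroup F] [NormedSpace ℂ F] [CompleteSpace F] {ħ : ℝ}
    (hħ : 0 < ħ) {A : E m → E m → F → F} {v : E m → F} {S : Finset ι} {a : ι → E m × E m → ℝ}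
    (ha : ∀ n, AllBdd fun w => (a n w : ℂ)) (u : ι → 𝓢(E m, ℂ)) (h : ι → F)
    (hA : ∀ y η y', A y η (v y') = ∑ n ∈ S, (a n (y, η) : ℂ) • u n y' • h n) (y : E m) :
    weyl pairE ħ A v y = ∑ n ∈ S, weylFun ħ (a n) (u n) y • h n := by
  have hin : ∀ η, ∫ y', Complex.exp (Complex.I * ((pairE (y - y') η / ħ : ℝ) : ℂ)) •
        A ((1 / 2 : ℝ) • (y + y')) η (v y')
      = ∑ n ∈ S, (∫ y', Complex.exp (Complex.I * ((pairE (y - y') η / ħ : ℝ) : ℂ)) •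
        (a n ((1 / 2 : ℝ) • (y + y'), η) : ℂ) • u n y') • h n := fun η => by
    simp only [hA, Finset.smul_sum, ← smul_assoc, ← integral_smul_const]
    exact integral_finsetSum S fun n _ =>
      ((integrable_weylFun_integrand (ħ := ħ) (ha n) (u n) y η).smul_const (h n)).congr
        (Filter.Eventually.of_forall fun y' => by simp only [smul_assoc])
  simp only [weylFun, weyl, hin]
  rw [integral_finsetSum S fun n _ => (integrable_weylFun_inner hħ (ha n) _ y).smul_const _,
    Finset.smul_sum]
  refine Finset.sum_congr rfl fun n _ => ?_
  rw [integral_smul_const, smul_assoc]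

lemma perturbationAction_eq {ħ : ℝ} (hħ : 0 < ħ) {f : E m × E m → (Fin m → ℝ) → ℝ → ℝ}
    (hf : ∀ n, AllBdd fun w => (perturbationSymbol f ħ n w : ℂ)) {S : Finset (Fin m → ℕ)}
    (hS : ∀ n ∉ S, perturbationSymbol f ħ n = 0) (ψ : 𝓢(E m × E m, ℂ)) (y : E m) :
    perturbationAction f ħ ψ y = ∑ n ∈ S, weylFun ħ (perturbationSymbol f ħ n)
      (partialPairing volume (hermiteSchwartz hħ n) ψ) y • hermiteProd ħ n := by
  refine weyl_eq_sum hħ hf _ _ (fun y η y' => ?_) y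
  rw [functionalCalculus_oscillator hħ _ S fun n hn => congrFun (hS n hn) _]
  refine Finset.sum_congr rfl fun n _ => ?_
  rw [toL2_slice, inner_hermiteProd_toLp hħ, partialPairing_apply]
  simp only [hermiteSchwartz_apply, sliceSnd_apply, perturbationSymbol]

end Perturbation

/-! ### Tensor products in `L²` -/

section Tensor

variable {m : ℕ}

lemma memLp_tensor (u v : L2 (E m)) :
    MemLp (fun p : E m × E m => u p.1 * v p.2) 2 (volume : Measure (E m × E m)) := by
  have hm : AEStronglyMeasurable (fun p : E m × E m => u p.1 * v p.2)
      (volume : Measure (E m × E m)) :=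
    (Lp.aestronglyMeasurable u).comp_fst.mul (Lp.aestronglyMeasurable v).comp_snd
  refine (memLp_two_iff_integrable_sq_norm hm).2 ?_
  simp only [norm_mul, mul_pow]
  exact ((memLp_two_iff_integrable_sq_norm (Lp.aestronglyMeasurable u)).1 (Lp.memLp u)).mul_prod
    ((memLp_two_iff_integrable_sq_norm (Lp.aestronglyMeasurable v)).1 (Lp.memLp v))

lemma coeFn_tensor (u v : L2 (E m)) :
    tensor u v =ᵐ[volume] fun p : E m × E m => u p.1 * v p.2 := by
  rw [tensor, toL2, dif_pos (memLp_tensor u v)]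
  exact MemLp.coeFn_toLp _

lemma inner_tensor (u v u' v' : L2 (E m)) :
    inner ℂ (tensor u v) (tensor u' v') = inner ℂ u u' * inner ℂ v v' := by
  rw [L2.inner_def, L2.inner_def, L2.inner_def, ← integral_prod_mul]
  refine integral_congr_ae ?_
  filter_upwards [coeFn_tensor u v, coeFn_tensor u' v'] with p h1 h2
  simp only [h1, h2, RCLike.inner_apply, map_mul]
  ring

lemma norm_tensor (u v : L2 (E m)) : ‖tensor u v‖ = ‖u‖ * ‖v‖ := by
  have h := inner_tensor u v u v
  simp only [inner_self_eq_norm_sq_to_K] at h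
  refine (pow_left_inj₀ (norm_nonneg _) (by positivity) two_ne_zero).1 ?_
  rw [mul_pow]
  exact_mod_cast h

lemma ae_fst {P : E m → Prop} (h : ∀ᵐ y, P y) : ∀ᵐ p : E m × E m, P p.1 :=
  Measure.quasiMeasurePreserving_fst.ae h

lemma ae_snd {P : E m → Prop} (h : ∀ᵐ y, P y) : ∀ᵐ p : E m × E m, P p.2 :=
  Measure.quasiMeasurePreserving_snd.ae h

lemma tensor_toLp (u v : 𝓢(E m, ℂ)) :
    tensor (u.toLp 2 volume) (v.toLp 2 volume) = (schwartzTensor u v).toLp 2 volume := by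
  refine eq_toLp_of_ae_eq ?_
  filter_upwards [coeFn_tensor (u.toLp 2 volume) (v.toLp 2 volume),
    ae_fst (u.coeFn_toLp 2 volume), ae_snd (v.coeFn_toLp 2 volume)] with p h1 h2 h3
  rw [h1, h2, h3, schwartzTensor_apply]

/-- The isometry `u ↦ u ⊗ h_n`. -/
def hermiteTensor {ħ : ℝ} (hħ : 0 < ħ) (n : Fin m → ℕ) : L2 (E m) →ₗᵢ[ℂ] L2 (E m × E m) where
  toFun u := tensor u (hermiteProd ħ n)
  map_add' u u' := by
    refine Lp.ext ?_
    filter_upwards [coeFn_tensor (u + u') (hermiteProd ħ n), coeFn_tensor u (hermiteProd ħ n),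
      coeFn_tensor u' (hermiteProd ħ n), ae_fst (Lp.coeFn_add u u'),
      Lp.coeFn_add (tensor u (hermiteProd ħ n)) (tensor u' (hermiteProd ħ n))] with p h1 h2 h3 h4 h5
    rw [h1, h5, Pi.add_apply, h2, h3, h4, Pi.add_apply, add_mul]
  map_smul' c u := by
    refine Lp.ext ?_
    filter_upwards [coeFn_tensor (c • u) (hermiteProd ħ n), coeFn_tensor u (hermiteProd ħ n),
      ae_fst (Lp.coeFn_smul c u), Lp.coeFn_smul c (tensor u (hermiteProd ħ n))] with p h1 h2 h3 h4
    rw [h1, RingHom.id_apply, h4, Pi.smul_apply, h2, h3, Pi.smul_apply, smul_mul_assoc]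
  norm_map' u := by
    change ‖tensor u (hermiteProd ħ n)‖ = ‖u‖
    rw [norm_tensor, norm_hermiteProd hħ, mul_one]

lemma hermiteTensor_apply {ħ : ℝ} (hħ : 0 < ħ) (n : Fin m → ℕ) (u : L2 (E m)) :
    hermiteTensor hħ n u = tensor u (hermiteProd ħ n) := rfl

lemma coeFn_hermiteTensor {ħ : ℝ} (hħ : 0 < ħ) (n : Fin m → ℕ) (u : L2 (E m)) :
    hermiteTensor hħ n u =ᵐ[volume] fun p => u p.1 * (hermiteMulti ħ n p.2 : ℂ) := by
  filter_upwards [coeFn_tensor u (hermiteProd ħ n), ae_snd (coeFn_hermiteProd hħ n)] with p h1 h2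
  rw [hermiteTensor_apply, h1, h2]

lemma inner_hermiteTensor_ae {ħ : ℝ} (hħ : 0 < ħ) (n : Fin m → ℕ) (u : L2 (E m))
    {g : L2 (E m × E m)} {G : E m × E m → ℂ} (hG : g =ᵐ[volume] G) :
    (fun p => inner ℂ (hermiteTensor hħ n u p) (g p)) =ᵐ[volume]
      fun p => (starRingEnd ℂ) (u p.1) * ((hermiteMulti ħ n p.2 : ℂ) * G p) := by
  filter_upwards [coeFn_hermiteTensor hħ n u, hG] with p h1 h2
  rw [h1, h2, RCLike.inner_apply, map_mul, Complex.conj_ofReal]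
  ring

lemma integrable_conj_mul_hermiteMulti_mul {ħ : ℝ} (hħ : 0 < ħ) (n : Fin m → ℕ) (u : L2 (E m))
    {g : L2 (E m × E m)} {G : E m × E m → ℂ} (hG : g =ᵐ[volume] G) :
    Integrable (fun p => (starRingEnd ℂ) (u p.1) * ((hermiteMulti ħ n p.2 : ℂ) * G p))
      ((volume : Measure (E m)).prod (volume : Measure (E m))) :=
  (L2.integrable_inner (𝕜 := ℂ) (hermiteTensor hħ n u) g).congr (inner_hermiteTensor_ae hħ n u hG)

lemma inner_hermiteTensor {ħ : ℝ} (hħ : 0 < ħ) (n : Fin m → ℕ) (u : L2 (E m))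
    {g : L2 (E m × E m)} {G : E m × E m → ℂ} (hG : g =ᵐ[volume] G) :
    inner ℂ (hermiteTensor hħ n u) g
      = ∫ y, (starRingEnd ℂ) (u y) * ∫ x, (hermiteMulti ħ n x : ℂ) * G (y, x) := by
  rw [L2.inner_def, integral_congr_ae (inner_hermiteTensor_ae hħ n u hG)]
  refine (integral_prod _ (integrable_conj_mul_hermiteMulti_mul hħ n u hG)).trans ?_
  simp only [integral_const_mul]

lemma inner_hermiteTensor_symm {ħ : ℝ} (hħ : 0 < ħ) (n : Fin m → ℕ) (u : L2 (E m))
    {g : L2 (E m × E m)} {G : E m × E m → ℂ} (hG : g =ᵐ[volume] G) :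
    inner ℂ (hermiteTensor hħ n u) g
      = ∫ x, (hermiteMulti ħ n x : ℂ) * ∫ y, (starRingEnd ℂ) (u y) * G (y, x) := by
  rw [L2.inner_def, integral_congr_ae (inner_hermiteTensor_ae hħ n u hG)]
  refine (integral_prod_symm _ (integrable_conj_mul_hermiteMulti_mul hħ n u hG)).trans ?_
  simp only [mul_left_comm _ ((hermiteMulti ħ n _ : ℝ) : ℂ), integral_const_mul]

lemma ae_prod_of_ae_ae {P : E m × E m → Prop} (hP : MeasurableSet {p | P p})
    (h : ∀ᵐ y : E m, ∀ᵐ x : E m, P (y, x)) : ∀ᵐ p : E m × E m, P p :=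
  (Measure.ae_prod_iff_ae_ae hP).2 h

lemma eq_zero_of_inner_hermiteTensor_eq_zero {ħ : ℝ} (hħ : 0 < ħ) {g : L2 (E m × E m)}
    (hg : ∀ n u, inner ℂ (hermiteTensor hħ n u) g = 0) : g = 0 := by
  have h1 : ∀ n : Fin m → ℕ, ∀ᵐ y : E m, ∫ x, (hermiteMulti ħ n x : ℂ) * g (y, x) = 0 := by
    intro n
    have key : ∀ s : Set (E m), ∀ hs : MeasurableSet s, ∀ hμ : volume s < ⊤,
        (fun y => (starRingEnd ℂ) (indicatorConstLp 2 hs hμ.ne (1 : ℂ) y) *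
          ∫ x, (hermiteMulti ħ n x : ℂ) * g (y, x)) =ᵐ[volume]
        s.indicator fun y => ∫ x, (hermiteMulti ħ n x : ℂ) * g (y, x) := by
      intro s hs hμ
      filter_upwards [indicatorConstLp_coeFn (p := 2) (hs := hs) (hμs := hμ.ne) (c := (1 : ℂ))]
        with y hy
      rw [hy]
      by_cases h : y ∈ s <;> simp [h]
    refine ae_eq_zero_of_forall_setIntegral_eq_of_sigmaFinite (fun s hs hμ => ?_) fun s hs hμ => ?_
    · rw [← integrable_indicator_iff hs]
      refine Integrable.congr ?_ (key s hs hμ)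
      have h := (integrable_conj_mul_hermiteMulti_mul hħ n (indicatorConstLp 2 hs hμ.ne (1 : ℂ))
        (Filter.EventuallyEq.refl _ (g : E m × E m → ℂ))).integral_prod_left
      simpa only [integral_const_mul] using h
    · rw [← integral_indicator hs, ← integral_congr_ae (key s hs hμ),
        ← inner_hermiteTensor hħ n _ (Filter.EventuallyEq.refl _ (g : E m × E m → ℂ)), hg]
  have h2 : Integrable (fun p => ‖g p‖ ^ 2) ((volume : Measure (E m)).prod (volume : Measure (E m))) :=
    (memLp_two_iff_integrable_sq_norm (Lp.aestronglyMeasurable g)).1 (Lp.memLp g)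
  have hsm := Lp.stronglyMeasurable g
  refine Lp.ext ?_
  have h3 : ∀ᵐ p : E m × E m, g p = 0 := by
    refine ae_prod_of_ae_ae (measurableSet_eq_fun hsm.measurable measurable_const) ?_
    filter_upwards [ae_all_iff.2 h1, h2.prod_right_ae] with y h4 h5
    have hmem : MemLp (fun x => g (y, x)) 2 (volume : Measure (E m)) :=
      (memLp_two_iff_integrable_sq_norm
        (hsm.comp_measurable measurable_prodMk_left).aestronglyMeasurable).2 h5
    have h0 : hmem.toLp = 0 := hermiteProd_total hħ fun n => by
      rw [inner_hermiteProd hħ, ← h4 n]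
      refine integral_congr_ae ?_
      filter_upwards [hmem.coeFn_toLp] with x hx
      rw [hx]
    have h6 := hmem.coeFn_toLp
    rw [h0] at h6
    filter_upwards [h6, Lp.coeFn_zero ℂ 2 (volume : Measure (E m))] with x h7 h8
    rw [← h7, h8, Pi.zero_apply]
  filter_upwards [h3, Lp.coeFn_zero ℂ 2 (volume : Measure (E m × E m))] with p h4 h5
  rw [h4, h5, Pi.zero_apply]

lemma isOrthogonalSum_hermiteTensor {ħ : ℝ} (hħ : 0 < ħ) :
    IsOrthogonalSum (hermiteTensor hħ : (Fin m → ℕ) → _) := by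
  refine ⟨fun n k h u v => ?_, fun g hg => ?_⟩
  · rw [hermiteTensor_apply, hermiteTensor_apply, inner_tensor, inner_hermiteProd_hermiteProd hħ,
      if_neg h, mul_zero]
  · refine eq_zero_of_inner_hermiteTensor_eq_zero hħ fun n u => ?_
    rw [← inner_component_right, hg, inner_zero_right]

lemma component_hermiteTensor_toLp {ħ : ℝ} (hħ : 0 < ħ) (n : Fin m → ℕ) (ψ : 𝓢(E m × E m, ℂ)) :
    component (hermiteTensor hħ) n (ψ.toLp 2 volume)
      = (partialPairing volume (hermiteSchwartz hħ n) ψ).toLp 2 volume := by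
  refine ext_inner_left ℂ fun u => ?_
  rw [inner_component_right, inner_hermiteTensor hħ n u (ψ.coeFn_toLp 2 volume), L2.inner_def]
  refine integral_congr_ae ?_
  filter_upwards [(partialPairing volume (hermiteSchwartz hħ n) ψ).coeFn_toLp 2 volume] with y hy
  rw [hy, RCLike.inner_apply, partialPairing_apply, mul_comm]
  simp only [hermiteSchwartz_apply]

lemma component_oscillatorSnd {ħ : ℝ} (hħ : 0 < ħ) (n : Fin m → ℕ) (j : Fin m)
    (ψ : 𝓢(E m × E m, ℂ)) :
    component (hermiteTensor hħ) n ((oscillatorSnd ħ j ψ).toLp 2 volume)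
      = (oscillatorEigenvalue ħ n j : ℂ) • component (hermiteTensor hħ) n (ψ.toLp 2 volume) := by
  refine ext_inner_left ℂ fun u => ?_
  rw [inner_smul_right, inner_component_right, inner_component_right,
    inner_hermiteTensor hħ n u ((oscillatorSnd ħ j ψ).coeFn_toLp 2 volume),
    inner_hermiteTensor hħ n u (ψ.coeFn_toLp 2 volume), ← integral_const_mul]
  congr 1
  ext y
  have h := integral_hermiteMulti_mul_oscillator hħ n j (sliceSnd y ψ)
  rw [← sliceSnd_schwartzOscillator] at h
  rw [mul_left_comm]
  exact congrArg _ h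

end Tensor

/-! ### Operators in the first variables -/

section Fiberwise

variable {m : ℕ}

lemma weylFun_sliceFst_eq {ħ : ℝ} (hħ : 0 < ħ) {a : E m × E m → ℝ}
    (ha : AllBdd fun w => (a w : ℂ)) (χ : 𝓢(E m × E m, ℂ)) (y x : E m) :
    weylFun ħ a (sliceFst x χ) y = ∫ p, prodInner (scaledSymbol ħ a)
      (schwartzDilate _ (planckLength_pos hħ).ne' χ) ((planckLength ħ)⁻¹ • y)
        ((planckLength ħ)⁻¹ • x) p := by
  obtain ⟨M, hM⟩ := ha.exists_bddDeriv_scaledSymbol ħ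
  rw [integral_prodInner hM (Nat.lt_succ_self _), weylFun_eq hħ]
  congr 1
  ext y'
  rw [sliceFst_apply, sliceFst_apply, schwartzDilate_apply, Prod.smul_mk,
    smul_inv_smul₀ (planckLength_pos hħ).ne']

lemma continuous_weylFun_sliceFst {ħ : ℝ} (hħ : 0 < ħ) {a : E m × E m → ℝ}
    (ha : AllBdd fun w => (a w : ℂ)) (χ : 𝓢(E m × E m, ℂ)) :
    Continuous fun p : E m × E m => weylFun ħ a (sliceFst p.2 χ) p.1 := by
  obtain ⟨M, hM⟩ := ha.exists_bddDeriv_scaledSymbol ħ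
  set χ' := schwartzDilate _ (planckLength_pos hħ).ne' χ
  obtain ⟨C, -, hC⟩ := exists_norm_prodInner_le χ' (Module.finrank ℝ (E m × E m) + 1)
  have hbc := hM.continuous
  have hχ := χ'.continuous
  have h1 : ∀ r, Continuous fun p : E m × E m => prodInner (scaledSymbol ħ a) χ' p.1 p.2 r := by
    intro r
    refine continuous_of_dominated (bound := fun q => M * ‖χ' q‖) (fun p => ?_) (fun p => ?_)
      (χ'.integrable.norm.const_mul M) (Filter.Eventually.of_forall fun q => by fun_prop)
    · exact (integrable_prodInner_integrand hM χ' p.1 p.2 r).aestronglyMeasurable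
    · refine Filter.Eventually.of_forall fun q => ?_
      rw [norm_mul, Circle.norm_coe, one_mul, norm_mul]
      gcongr
      exact hM.norm_le _
  have h2 : Continuous fun p : E m × E m => ∫ r, prodInner (scaledSymbol ħ a) χ' p.1 p.2 r :=
    continuous_of_dominated (fun p => (continuous_prodInner hM χ' p.1 p.2).aestronglyMeasurable)
      (fun p => Filter.Eventually.of_forall fun r => hC M _ hM p.1 p.2 r)
      ((integrable_inv_one_add_norm_pow volume (Nat.lt_succ_self _)).const_mul (C * M))
      (Filter.Eventually.of_forall h1)
  simp only [weylFun_sliceFst_eq hħ ha]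
  exact h2.comp (f := fun p : E m × E m => ((planckLength ħ)⁻¹ • p.1, (planckLength ħ)⁻¹ • p.2))
    (by fun_prop)

lemma norm_sq_L2_eq {V : Type} [MeasureSpace V] {g : L2 V} {G : V → ℂ} (h : g =ᵐ[volume] G) :
    ‖g‖ ^ 2 = ∫ x, ‖G x‖ ^ 2 := by
  have h1 : inner ℂ g g = ((∫ x, ‖G x‖ ^ 2 : ℝ) : ℂ) := by
    rw [L2.inner_def, ← integral_complex_ofReal]
    refine integral_congr_ae ?_
    filter_upwards [h] with x hx
    rw [hx, inner_self_eq_norm_sq_to_K]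
    push_cast
    rfl
  rw [inner_self_eq_norm_sq_to_K] at h1
  exact Complex.ofReal_injective (by rw [Complex.ofReal_pow]; exact h1)

lemma memLp_weylFun_sliceFst {ħ : ℝ} (hħ : 0 < ħ) {a : E m × E m → ℝ}
    (ha : AllBdd fun w => (a w : ℂ)) (χ : 𝓢(E m × E m, ℂ)) :
    MemLp (fun p : E m × E m => weylFun ħ a (sliceFst p.2 χ) p.1) 2
      (volume : Measure (E m × E m)) := by
  have hc := continuous_weylFun_sliceFst hħ ha χ
  have hfib : ∀ x, MemLp (weylFun ħ a (sliceFst x χ)) 2 (volume : Measure (E m)) := fun x =>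
    (memLp_congr_ae (weylCLM_toLp hħ ha (sliceFst x χ))).1 (Lp.memLp _)
  have hχ : Integrable (fun p : E m × E m => ‖χ p‖ ^ 2)
      ((volume : Measure (E m)).prod (volume : Measure (E m))) :=
    (memLp_two_iff_integrable_sq_norm χ.continuous.aestronglyMeasurable).1 (χ.memLp 2 volume)
  refine (memLp_two_iff_integrable_sq_norm hc.aestronglyMeasurable).2 ?_
  have hm : AEStronglyMeasurable (fun p : E m × E m => ‖weylFun ħ a (sliceFst p.2 χ) p.1‖ ^ 2)
      ((volume : Measure (E m)).prod (volume : Measure (E m))) :=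
    (hc.norm.pow 2).aestronglyMeasurable
  refine (integrable_prod_iff' hm).2 ⟨Filter.Eventually.of_forall fun x =>
    (memLp_two_iff_integrable_sq_norm (hfib x).1).1 (hfib x), ?_⟩
  refine (hχ.integral_prod_right.const_mul (‖weylCLM ħ a‖ ^ 2)).mono'
    hm.prod_swap.norm.integral_prod_right' (Filter.Eventually.of_forall fun x => ?_)
  simp only [norm_pow, norm_norm]
  rw [Real.norm_of_nonneg (integral_nonneg fun y => by positivity),
    ← norm_sq_L2_eq (weylCLM_toLp hħ ha (sliceFst x χ))]
  have h := norm_sq_L2_eq ((sliceFst x χ).coeFn_toLp 2 volume)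
  simp only [sliceFst_apply] at h
  rw [← h, ← mul_pow]
  gcongr
  exact (weylCLM ħ a).le_opNorm _

lemma component_weylFun_sliceFst {ħ : ℝ} (hħ : 0 < ħ) {a : E m × E m → ℝ}
    (ha : AllBdd fun w => (a w : ℂ)) (χ : 𝓢(E m × E m, ℂ)) (n : Fin m → ℕ) :
    component (hermiteTensor hħ) n (memLp_weylFun_sliceFst hħ ha χ).toLp
      = weylCLM ħ a (component (hermiteTensor hħ) n (χ.toLp 2 volume)) := by
  have hs : ∀ u v, inner ℂ (weylCLM ħ a u) v = inner ℂ u (weylCLM ħ a v) :=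
    ContinuousLinearMap.isSelfAdjoint_iff_isSymmetric.1 (isSelfAdjoint_weylCLM hħ ha)
  refine ext_inner_left ℂ fun u => ?_
  rw [inner_component_right, inner_hermiteTensor_symm hħ n u (MemLp.coeFn_toLp _), ← hs u,
    inner_component_right,
    inner_hermiteTensor_symm hħ n _ (χ.coeFn_toLp 2 volume)]
  congr 1
  ext x
  congr 1
  have h1 : ∫ y, (starRingEnd ℂ) (u y) * weylFun ħ a (sliceFst x χ) y
      = inner ℂ u (weylCLM ħ a ((sliceFst x χ).toLp 2 volume)) := by
    rw [L2.inner_def]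
    refine integral_congr_ae ?_
    filter_upwards [weylCLM_toLp hħ ha (sliceFst x χ)] with y hy
    rw [hy, RCLike.inner_apply, mul_comm]
  have h2 : ∫ y, (starRingEnd ℂ) (weylCLM ħ a u y) * χ (y, x)
      = inner ℂ (weylCLM ħ a u) ((sliceFst x χ).toLp 2 volume) := by
    rw [L2.inner_def]
    refine integral_congr_ae ?_
    filter_upwards [(sliceFst x χ).coeFn_toLp 2 volume] with y hy
    rw [hy, RCLike.inner_apply, mul_comm, sliceFst_apply]
  rw [h2]
  exact h1.trans (hs u _).symm

end Fiberwise

/-! ### The reduced operators -/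

section Reduced

variable {m : ℕ}

lemma integrable_scaledSymbol_mul_wigner {ħ : ℝ} {a : E m × E m → ℝ}
    (ha : AllBdd fun w => (a w : ℂ)) (u v : 𝓢(E m, ℂ)) :
    Integrable fun w => scaledSymbol ħ a w * wigner u v w := by
  obtain ⟨M, hM⟩ := ha.exists_bddDeriv_scaledSymbol ħ
  exact (integrable_wigner u v).bdd_mul (c := M) hM.continuous.aestronglyMeasurable
    (Filter.Eventually.of_forall fun w => hM.norm_le w)

lemma AllBdd.add_ofReal {a b : E m × E m → ℝ} (ha : AllBdd fun w => (a w : ℂ))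
    (hb : AllBdd fun w => (b w : ℂ)) : AllBdd fun w => ((a w + b w : ℝ) : ℂ) := by
  simp only [Complex.ofReal_add]
  refine ⟨ha.1.add hb.1, fun k => ?_⟩
  obtain ⟨C, hC⟩ := ha.2 k
  obtain ⟨D, hD⟩ := hb.2 k
  refine ⟨C + D, fun w => ?_⟩
  have h1 : ContDiff ℝ k fun w => (a w : ℂ) := ha.1.of_le (mod_cast le_top)
  have h2 : ContDiff ℝ k fun w => (b w : ℂ) := hb.1.of_le (mod_cast le_top)
  rw [fun_iteratedFDeriv_add_apply h1.contDiffAt h2.contDiffAt]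
  exact (norm_add_le _ _).trans (add_le_add (hC w) (hD w))

lemma AllBdd.const_mul_ofReal {a : E m × E m → ℝ} (ha : AllBdd fun w => (a w : ℂ)) (c : ℝ) :
    AllBdd fun w => ((c * a w : ℝ) : ℂ) := by
  have e : (fun w => ((c * a w : ℝ) : ℂ)) = c • fun w => (a w : ℂ) := by
    ext w
    simp
  rw [e]
  refine ⟨contDiff_const.smul ha.1, fun k => ?_⟩
  obtain ⟨C, hC⟩ := ha.2 k
  refine ⟨‖c‖ * C, fun w => ?_⟩
  have h1 : ContDiff ℝ k fun w => (a w : ℂ) := ha.1.of_le (mod_cast le_top)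
  rw [iteratedFDeriv_const_smul_apply h1.contDiffAt, norm_smul]
  gcongr
  exact hC w

lemma allBdd_zero_ofReal : AllBdd fun _ : E m × E m => ((0 : ℝ) : ℂ) := by
  refine ⟨contDiff_const, fun k => ⟨0, fun w => ?_⟩⟩
  simp [iteratedFDeriv_fun_zero]

lemma AllBdd.sum_ofReal {ι : Type} (s : Finset ι) {a : ι → E m × E m → ℝ}
    (ha : ∀ i, AllBdd fun w => (a i w : ℂ)) : AllBdd fun w => ((∑ i ∈ s, a i w : ℝ) : ℂ) := by
  classical
  induction s using Finset.induction_on with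
  | empty => simpa using allBdd_zero_ofReal
  | insert i s hi ih =>
    simp only [Finset.sum_insert hi]
    exact (ha i).add_ofReal ih

lemma weylCLM_add {ħ : ℝ} (hħ : 0 < ħ) {a b : E m × E m → ℝ} (ha : AllBdd fun w => (a w : ℂ))
    (hb : AllBdd fun w => (b w : ℂ)) :
    weylCLM ħ (fun w => a w + b w) = weylCLM ħ a + weylCLM ħ b := by
  refine weylCLM_ext fun u v => ?_
  rw [add_apply, inner_add_right, inner_weylCLM hħ (ha.add_ofReal hb),
    inner_weylCLM hħ ha, inner_weylCLM hħ hb, ← mul_add,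
    ← integral_add (integrable_scaledSymbol_mul_wigner ha _ _)
      (integrable_scaledSymbol_mul_wigner hb _ _)]
  simp only [scaledSymbol, Complex.ofReal_add, add_mul]

lemma weylCLM_const_mul {ħ : ℝ} (hħ : 0 < ħ) {a : E m × E m → ℝ} (ha : AllBdd fun w => (a w : ℂ))
    (c : ℝ) : weylCLM ħ (fun w => c * a w) = (c : ℂ) • weylCLM ħ a := by
  refine weylCLM_ext fun u v => ?_
  rw [smul_apply, inner_smul_right, inner_weylCLM hħ (ha.const_mul_ofReal c), inner_weylCLM hħ ha,
    mul_left_comm, ← integral_const_mul (c : ℂ)]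
  simp only [scaledSymbol, Complex.ofReal_mul, mul_assoc]

lemma weylCLM_zero {ħ : ℝ} (hħ : 0 < ħ) : weylCLM ħ (fun _ : E m × E m => (0 : ℝ)) = 0 := by
  simpa using weylCLM_const_mul hħ (allBdd_zero_ofReal (m := m)) 0

lemma weylCLM_sum {ħ : ℝ} (hħ : 0 < ħ) {ι : Type} (s : Finset ι) {a : ι → E m × E m → ℝ}
    (ha : ∀ i, AllBdd fun w => (a i w : ℂ)) :
    weylCLM ħ (fun w => ∑ i ∈ s, a i w) = ∑ i ∈ s, weylCLM ħ (a i) := by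
  classical
  induction s using Finset.induction_on with
  | empty => simpa using weylCLM_zero hħ
  | insert i s hi ih =>
    simp only [Finset.sum_insert hi]
    rw [weylCLM_add hħ (ha i) (AllBdd.sum_ofReal s ha), ih]

lemma weylCLM_reducedSymbol {ħ : ℝ} (hħ : 0 < ħ) {β : Fin m → E m × E m → ℝ}
    (hβ : ∀ j, AllBdd fun w => (β j w : ℂ)) {f : E m × E m → (Fin m → ℝ) → ℝ → ℝ} {n : Fin m → ℕ}
    (hf : AllBdd fun w => (perturbationSymbol f ħ n w : ℂ)) :
    weylCLM ħ (reducedSymbol β f n ħ) = ∑ j, (oscillatorEigenvalue ħ n j : ℂ) • weylCLM ħ (β j)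
      + weylCLM ħ (perturbationSymbol f ħ n) := by
  have e : reducedSymbol β f n ħ
      = fun w => (∑ j, oscillatorEigenvalue ħ n j * β j w) + perturbationSymbol f ħ n w := by
    ext w
    rw [reducedSymbol, Finset.mul_sum]
    congr 1
    refine Finset.sum_congr rfl fun j _ => ?_
    rw [oscillatorEigenvalue]
    ring
  have h := fun j => (hβ j).const_mul_ofReal (oscillatorEigenvalue ħ n j)
  rw [e, weylCLM_add hħ (AllBdd.sum_ofReal _ h) hf, weylCLM_sum hħ _ h]
  simp only [weylCLM_const_mul hħ (hβ _)]

lemma exists_pos_forall_le {ι : Type} [Finite ι] {g : ι → ℝ} (hg : ∀ i, 0 < g i) :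
    ∃ ε > 0, ∀ i, ε ≤ g i := by
  have h : ∀ᶠ ε in nhdsWithin (0 : ℝ) (Set.Ioi 0), ∀ i, ε ≤ g i :=
    Filter.eventually_all.2 fun i => Filter.mem_of_superset (Ioc_mem_nhdsGT (hg i)) fun ε h => h.2
  obtain ⟨ε, h1, h2⟩ := (h.and self_mem_nhdsWithin).exists
  exact ⟨ε, h2, h1⟩

/-- The reduced operators are bounded from below by constants that tend to infinity. -/
lemma eventually_le_re_inner_reduced {ħ : ℝ} (hħ : 0 < ħ) {β : Fin m → E m × E m → ℝ}
    (hβ : ∀ j, AllBdd fun w => (β j w : ℂ)) {f : E m × E m → (Fin m → ℝ) → ℝ → ℝ}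
    (hf : ∀ n, AllBdd fun w => (perturbationSymbol f ħ n w : ℂ)) {S : Finset (Fin m → ℕ)}
    (hS : ∀ n ∉ S, perturbationSymbol f ħ n = 0) {c : ℝ} (hc : 0 < c)
    (hpos : ∀ j u, c * ‖u‖ ^ 2 ≤ (inner ℂ (weylCLM ħ (β j) u) u).re) (M : ℝ) :
    ∀ᶠ n in Filter.cofinite, ∀ u,
      M * ‖u‖ ^ 2 ≤ (inner ℂ (weylCLM ħ (reducedSymbol β f n ħ) u) u).re := by
  classical
  obtain ⟨B, hB⟩ := exists_nat_gt (M / (ħ * c))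
  rw [div_lt_iff₀ (by positivity)] at hB
  refine (S ∪ Fintype.piFinset fun _ => Finset.range B).finite_toSet.subset fun n hn => ?_
  by_contra hn'
  refine hn fun u => ?_
  simp only [Finset.coe_union, Set.mem_union, Finset.mem_coe, not_or, Fintype.mem_piFinset,
    Finset.mem_range, not_forall, not_lt] at hn'
  obtain ⟨h1, j, hj⟩ := hn'
  have h0 : perturbationSymbol f ħ n = fun _ => 0 := hS n h1
  rw [weylCLM_reducedSymbol hħ hβ (hf n), h0, weylCLM_zero hħ, add_zero,
    sum_apply, sum_inner, Complex.re_sum]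
  simp only [smul_apply, inner_smul_left, Complex.conj_ofReal, Complex.re_ofReal_mul]
  have hl : ∀ j, 0 ≤ oscillatorEigenvalue ħ n j := fun j => by
    rw [oscillatorEigenvalue]
    positivity
  have h2 : oscillatorEigenvalue ħ n j * (inner ℂ (weylCLM ħ (β j) u) u).re
      ≤ ∑ j, oscillatorEigenvalue ħ n j * (inner ℂ (weylCLM ħ (β j) u) u).re :=
    Finset.single_le_sum (f := fun j => oscillatorEigenvalue ħ n j *
      (inner ℂ (weylCLM ħ (β j) u) u).re)
      (fun j _ => mul_nonneg (hl j) (le_trans (by positivity) (hpos j u))) (Finset.mem_univ j)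
  refine le_trans ?_ h2
  have h3 : ħ * B ≤ oscillatorEigenvalue ħ n j := by
    rw [oscillatorEigenvalue]
    have : (B : ℝ) ≤ n j := mod_cast hj
    gcongr
    linarith [Nat.cast_nonneg (α := ℝ) (n j)]
  calc M * ‖u‖ ^ 2 ≤ (B * (ħ * c)) * ‖u‖ ^ 2 := by gcongr
    _ = ħ * B * (c * ‖u‖ ^ 2) := by ring
    _ ≤ _ := mul_le_mul h3 (hpos j u) (by positivity) (hl j)

end Reduced

/-! ### The normal form as an orthogonal sum -/

section NormalForm

variable {m : ℕ} {ħ : ℝ} (hħ : 0 < ħ) {β : Fin m → E m × E m → ℝ}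
  {f : E m × E m → (Fin m → ℝ) → ℝ → ℝ}

/-- The image of a Schwartz function under the normal form. -/
lemma exists_normalForm_image (hβ : ∀ j, AllBdd fun w => (β j w : ℂ))
    (hf : ∀ n, AllBdd fun w => (perturbationSymbol f ħ n w : ℂ)) {S : Finset (Fin m → ℕ)}
    (hS : ∀ n ∉ S, perturbationSymbol f ħ n = 0) (ψ : 𝓢(E m × E m, ℂ)) :
    ∃ Q : L2 (E m × E m), (∀ᵐ y : E m, ∀ᵐ x : E m,
      Q (y, x) = modelAction β ħ ψ (y, x) + perturbationAction f ħ ψ y x) ∧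
      (ψ.toLp 2 volume, Q) ∈ diagonalGraph (hermiteTensor hħ)
        fun n => weylCLM ħ (reducedSymbol β f n ħ) := by
  classical
  set ψn : (Fin m → ℕ) → 𝓢(E m, ℂ) := fun n => partialPairing volume (hermiteSchwartz hħ n) ψ
  set X : Fin m → L2 (E m × E m) := fun j =>
    (memLp_weylFun_sliceFst hħ (hβ j) (oscillatorSnd ħ j ψ)).toLp
  set Y : (Fin m → ℕ) → L2 (E m × E m) := fun n =>
    hermiteTensor hħ n (weylCLM ħ (perturbationSymbol f ħ n) ((ψn n).toLp 2 volume))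
  refine ⟨∑ j, X j + ∑ n ∈ S, Y n, ?_, fun n => ?_⟩
  · have hX : ∀ j, X j =ᵐ[volume] fun p => weylFun ħ (β j) (sliceFst p.2 (oscillatorSnd ħ j ψ)) p.1 :=
      fun j => MemLp.coeFn_toLp _
    have hY : ∀ n, Y n =ᵐ[volume] fun p => weylFun ħ (perturbationSymbol f ħ n) (ψn n) p.1 *
        (hermiteMulti ħ n p.2 : ℂ) := fun n => by
      filter_upwards [coeFn_hermiteTensor hħ n
        (weylCLM ħ (perturbationSymbol f ħ n) ((ψn n).toLp 2 volume)),
        ae_fst (weylCLM_toLp hħ (hf n) (ψn n))] with p h1 h2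
      rw [h1, h2]
    have hQ : ∀ᵐ p : E m × E m, (∑ j, X j + ∑ n ∈ S, Y n : L2 (E m × E m)) p
        = ∑ j, weylFun ħ (β j) (sliceFst p.2 (oscillatorSnd ħ j ψ)) p.1
          + ∑ n ∈ S, weylFun ħ (perturbationSymbol f ħ n) (ψn n) p.1 *
            (hermiteMulti ħ n p.2 : ℂ) := by
      filter_upwards [Lp.coeFn_add (∑ j, X j) (∑ n ∈ S, Y n), Lp.coeFn_finsetSum Finset.univ X,
        Lp.coeFn_finsetSum S Y, ae_all_iff.2 hX, ae_all_iff.2 hY] with p h1 h2 h3 h4 h5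
      rw [h1, Pi.add_apply, h2, h3, Finset.sum_apply, Finset.sum_apply]
      simp only [h4, h5]
    filter_upwards [Measure.ae_ae_of_ae_prod hQ] with y hy
    have hP := perturbationAction_eq hħ hf hS ψ y
    rw [hP]
    filter_upwards [hy, Lp.coeFn_finsetSum S fun n => weylFun ħ (perturbationSymbol f ħ n) (ψn n) y •
        hermiteProd ħ n, ae_all_iff.2 fun n => Lp.coeFn_smul
        (weylFun ħ (perturbationSymbol f ħ n) (ψn n) y) (hermiteProd ħ n),
      ae_all_iff.2 fun n => coeFn_hermiteProd hħ n] with x h1 h2 h3 h4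
    rw [h1, modelAction_eq hħ hβ, h2, Finset.sum_apply]
    simp only [h3, Pi.smul_apply, h4, smul_eq_mul]
  · have hXc : ∀ j, component (hermiteTensor hħ) n (X j) = (oscillatorEigenvalue ħ n j : ℂ) •
        weylCLM ħ (β j) (component (hermiteTensor hħ) n (ψ.toLp 2 volume)) := fun j => by
      rw [component_weylFun_sliceFst hħ (hβ j), component_oscillatorSnd, map_smul]
    have hYc : ∑ k ∈ S, component (hermiteTensor hħ) n (Y k) = weylCLM ħ (perturbationSymbol f ħ n)
        (component (hermiteTensor hħ) n (ψ.toLp 2 volume)) := by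
      rw [component_hermiteTensor_toLp]
      by_cases hn : n ∈ S
      · rw [Finset.sum_eq_single_of_mem n hn fun k _ hk =>
          component_of_ne (isOrthogonalSum_hermiteTensor hħ).orthogonal hk.symm _]
        exact component_self _ _ _
      · have h0 : perturbationSymbol f ħ n = fun _ => 0 := hS n hn
        rw [h0, weylCLM_zero hħ, zero_apply]
        exact Finset.sum_eq_zero fun k hk =>
          component_of_ne (isOrthogonalSum_hermiteTensor hħ).orthogonal
            (fun h : n = k => hn (h ▸ hk)) _
    change component (hermiteTensor hħ) n (∑ j, X j + ∑ n ∈ S, Y n)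
      = weylCLM ħ (reducedSymbol β f n ħ) (component (hermiteTensor hħ) n (ψ.toLp 2 volume))
    rw [map_add, map_sum, map_sum, hYc, weylCLM_reducedSymbol hħ hβ (hf n), add_apply,
      sum_apply]
    simp only [hXc, smul_apply]

lemma eq_of_ae_ae_eq {P Q : L2 (E m × E m)} (h : ∀ᵐ y : E m, ∀ᵐ x : E m, P (y, x) = Q (y, x)) :
    P = Q :=
  Lp.ext (ae_prod_of_ae_ae (measurableSet_eq_fun (Lp.stronglyMeasurable P).measurable
    (Lp.stronglyMeasurable Q).measurable) h)

lemma normalFormGraph_subset (hβ : ∀ j, AllBdd fun w => (β j w : ℂ))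
    (hf : ∀ n, AllBdd fun w => (perturbationSymbol f ħ n w : ℂ)) {S : Finset (Fin m → ℕ)}
    (hS : ∀ n ∉ S, perturbationSymbol f ħ n = 0) :
    normalFormGraph β f ħ ⊆ diagonalGraph (hermiteTensor hħ)
      fun n => weylCLM ħ (reducedSymbol β f n ħ) := by
  rintro ⟨p, q⟩ ⟨ψ, h1, h2⟩
  obtain ⟨Q, hQ, hd⟩ := exists_normalForm_image hħ hβ hf hS ψ
  have e : q = Q := eq_of_ae_ae_eq (by
    filter_upwards [h2, hQ] with y h3 h4
    filter_upwards [h3, h4] with x h5 h6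
    rw [h5, h6])
  have e' : p = ψ.toLp 2 volume := eq_toLp_of_ae_eq h1
  rw [e, e']
  exact hd

lemma mem_normalFormGraph_of_mem_diagonalGraph (hβ : ∀ j, AllBdd fun w => (β j w : ℂ))
    (hf : ∀ n, AllBdd fun w => (perturbationSymbol f ħ n w : ℂ)) {S : Finset (Fin m → ℕ)}
    (hS : ∀ n ∉ S, perturbationSymbol f ħ n = 0) {ψ : 𝓢(E m × E m, ℂ)} {q : L2 (E m × E m)}
    (h : (ψ.toLp 2 volume, q) ∈ diagonalGraph (hermiteTensor hħ)
      fun n => weylCLM ħ (reducedSymbol β f n ħ)) :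
    (ψ.toLp 2 volume, q) ∈ normalFormGraph β f ħ := by
  obtain ⟨Q, hQ, hd⟩ := exists_normalForm_image hħ hβ hf hS ψ
  rw [(isOrthogonalSum_hermiteTensor hħ).eq_of_mem h hd]
  exact ⟨ψ, ψ.coeFn_toLp 2 volume, hQ⟩

lemma hermiteTensor_mem_normalFormGraph (hβ : ∀ j, AllBdd fun w => (β j w : ℂ))
    (hf : ∀ n, AllBdd fun w => (perturbationSymbol f ħ n w : ℂ)) {S : Finset (Fin m → ℕ)}
    (hS : ∀ n ∉ S, perturbationSymbol f ħ n = 0) (n : Fin m → ℕ) (u : 𝓢(E m, ℂ)) :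
    (hermiteTensor hħ n (u.toLp 2 volume),
      hermiteTensor hħ n (weylCLM ħ (reducedSymbol β f n ħ) (u.toLp 2 volume)))
      ∈ normalFormGraph β f ħ := by
  have h := (isOrthogonalSum_hermiteTensor hħ).mk_mem_diagonalGraph
    (fun n => weylCLM ħ (reducedSymbol β f n ħ)) n (u.toLp 2 volume)
  have e : hermiteTensor hħ n (u.toLp 2 volume)
      = (schwartzTensor u (hermiteSchwartz hħ n)).toLp 2 volume := by
    rw [hermiteTensor_apply, hermiteProd_eq hħ, tensor_toLp]
  rw [e] at h ⊢
  exact mem_normalFormGraph_of_mem_diagonalGraph hħ hβ hf hS h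

/-- Separation of variables for the normal form. -/
lemma normalFormGraph_essentiallySelfAdjoint (hβ : ∀ j, AllBdd fun w => (β j w : ℂ))
    (hf : ∀ n, AllBdd fun w => (perturbationSymbol f ħ n w : ℂ)) {S : Finset (Fin m → ℕ)}
    (hS : ∀ n ∉ S, perturbationSymbol f ħ n = 0)
    (hF : ∀ n, AllBdd fun w => (reducedSymbol β f n ħ w : ℂ)) :
    IsEssentiallySelfAdjoint (schwartzClasses (E m × E m)) (normalFormGraph β f ħ) ∧
      (normalForm β f ħ).graph = diagonalGraph (hermiteTensor hħ)
        fun n => weylCLM ħ (reducedSymbol β f n ħ) := by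
  rw [schwartzClasses_eq]
  refine (isOrthogonalSum_hermiteTensor hħ).essentiallySelfAdjoint
    (fun n => isSelfAdjoint_weylCLM hħ (hF n)) _ (normalFormGraph_subset hħ hβ hf hS) ?_
    (D₀ := Set.range fun u : 𝓢(E m, ℂ) => u.toLp 2 volume) denseRange_schwartz_toLp ?_
  · rw [← schwartzClasses_eq]
    ext g
    constructor
    · rintro ⟨p, ⟨ψ, h1, -⟩, rfl⟩
      exact ⟨ψ, h1⟩
    · rintro ⟨ψ, hψ⟩
      obtain ⟨Q, hQ, -⟩ := exists_normalForm_image hħ hβ hf hS ψ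
      exact ⟨(g, Q), ⟨ψ, hψ, hQ⟩, rfl⟩
  · rintro n _ ⟨u, rfl⟩
    exact hermiteTensor_mem_normalFormGraph hħ hβ hf hS n u

lemma tensor_mem_normalFormGraph (hħ : 0 < ħ) (hβ : ∀ j, AllBdd fun w => (β j w : ℂ))
    (hf : ∀ n, AllBdd fun w => (perturbationSymbol f ħ n w : ℂ)) {S : Finset (Fin m → ℕ)}
    (hS : ∀ n ∉ S, perturbationSymbol f ħ n = 0)
    (hF : ∀ n, AllBdd fun w => (reducedSymbol β f n ħ w : ℂ)) (n : Fin m → ℕ)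
    {P : L2 (E m) × L2 (E m)} (hP : P ∈ weylGraph ħ (reducedSymbol β f n ħ)) :
    (tensor P.1 (hermiteProd ħ n), tensor P.2 (hermiteProd ħ n)) ∈ normalFormGraph β f ħ := by
  obtain ⟨u, h1, h2⟩ := hP
  have e1 : P.1 = u.toLp 2 volume := eq_toLp_of_ae_eq h1
  have e2 : P.2 = weylCLM ħ (reducedSymbol β f n ħ) (u.toLp 2 volume) :=
    Lp.ext (h2.trans (weylCLM_toLp hħ (hF n) u).symm)
  rw [e1, e2]
  exact hermiteTensor_mem_normalFormGraph hħ hβ hf hS n u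

end NormalForm

end BirkhoffNF

end

open BirkhoffNF

theorem theorem1p4 (m : ℕ) (ρ : ℝ) (hρ : ρ ∈ Set.Icc (0 : ℝ) 1)
    (β : Fin m → E m × E m → ℝ) (hβ : IsSymbolFamily ρ β)
    (hβ_pos : ∃ c > 0, ∀ j w, c ≤ β j w)
    (f : E m × E m → (Fin m → ℝ) → ℝ → ℝ)
    (hf : ContDiff ℝ ∞ fun s : (E m × E m) × (Fin m → ℝ) × ℝ => f s.1 s.2.1 s.2.2)
    (hf_symb : IsSymbolFamily ρ fun (s : (Fin m → ℝ) × ℝ) (w : E m × E m) => f w s.1 s.2)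
    (hf_supp : ∃ K : Set ((Fin m → ℝ) × ℝ), IsCompact K ∧
      ∀ w I ħ, (I, ħ) ∉ K → f w I ħ = 0) :
    ∃ ħ₀ > 0,
      (∀ n : Fin m → ℕ,
        IsSymbolFamily ρ fun ħ : Set.Ioc (0 : ℝ) ħ₀ => reducedSymbol β f n ħ) ∧
      ∀ ħ ∈ Set.Ioc (0 : ℝ) ħ₀,
        -- the Hermite functions and the oscillators
        (∀ (k : ℕ) (t : ℝ),
          -ħ ^ 2 * iteratedDeriv 2 (hermiteFun ħ k) t + t ^ 2 * hermiteFun ħ k t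
            = ħ * (2 * k + 1) * hermiteFun ħ k t) ∧
        (∀ j : Fin m, IsEssentiallySelfAdjoint (schwartzClasses (E m)) (oscillatorGraph ħ j)) ∧
        HasPurePointSpectrum (oscillator ħ : Fin m → _) ∧
        -- `N_ħ` and the operators `N_ħ⁽ⁿ⁾` with symbols `F⁽ⁿ⁾` are well defined and self-adjoint
        IsEssentiallySelfAdjoint (schwartzClasses (E m × E m)) (normalFormGraph β f ħ) ∧
        (∀ n : Fin m → ℕ, IsEssentiallySelfAdjoint (schwartzClasses (E m))
          (weylGraph ħ (reducedSymbol β f n ħ))) ∧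
        -- `N_ħ (u ⊗ h_n) = N_ħ⁽ⁿ⁾ u ⊗ h_n` for Schwartz functions `u`
        (∀ (n : Fin m → ℕ), ∀ P ∈ weylGraph ħ (reducedSymbol β f n ħ),
          (tensor P.1 (hermiteProd ħ n), tensor P.2 (hermiteProd ħ n))
            ∈ normalFormGraph β f ħ) ∧
        opSpectrum (normalForm β f ħ)
          = ⋃ n : Fin m → ℕ, opSpectrum (weylOperator ħ (reducedSymbol β f n ħ)) ∧
        ∀ μ : ℂ, eigenMultiplicity (normalForm β f ħ) μ
          = ∑' n : Fin m → ℕ, eigenMultiplicity (weylOperator ħ (reducedSymbol β f n ħ)) μ := by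
  have hβb : ∀ j, AllBdd fun w => (β j w : ℂ) := hβ.allBdd hρ.1
  obtain ⟨c, hc, hcβ⟩ := hβ_pos
  choose ħ₁ hħ₁ c' hc' hG using fun j => exists_le_re_inner_weylCLM (hβb j) hc (hcβ j)
  obtain ⟨ħ₀, hħ₀, hle⟩ := exists_pos_forall_le hħ₁
  obtain ⟨ε, hε, hεc⟩ := exists_pos_forall_le hc'
  refine ⟨ħ₀, hħ₀, fun n => isSymbolFamily_reducedSymbol hβ hf_symb n ħ₀, fun ħ hħ => ?_⟩
  have hF : ∀ n, AllBdd fun w => (reducedSymbol β f n ħ w : ℂ) := fun n =>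
    (isSymbolFamily_reducedSymbol hβ hf_symb n ħ₀).allBdd hρ.1 ⟨ħ, hħ⟩
  have hfb : ∀ n, AllBdd fun w => (perturbationSymbol f ħ n w : ℂ) := fun n =>
    hf_symb.allBdd hρ.1 (oscillatorEigenvalue ħ n, ħ)
  obtain ⟨S, hS⟩ := exists_finset_perturbationSymbol_eq_zero hħ.1 hf_supp
  have hN := normalFormGraph_essentiallySelfAdjoint hħ.1 hβb hfb hS hF
  have hlim := eventually_le_re_inner_reduced hħ.1 hβb hfb hS hε fun j u =>
    (mul_le_mul_of_nonneg_right (hεc j) (by positivity)).trans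
      (hG j ħ ⟨hħ.1, hħ.2.trans (hle j)⟩ u)
  have hW := fun n => weylGraph_essentiallySelfAdjoint hħ.1 (hF n)
  exact ⟨iteratedDeriv_two_hermiteFun hħ.1, fun j => (oscillatorGraph_essentiallySelfAdjoint hħ.1 j).1,
    hasPurePointSpectrum_oscillator hħ.1, hN.1, fun n => (hW n).1,
    fun n P hP => tensor_mem_normalFormGraph hħ.1 hβb hfb hS hF n hP,
    (isOrthogonalSum_hermiteTensor hħ.1).opSpectrum_eq hlim hN.2 fun n => (hW n).2,
    (isOrthogonalSum_hermiteTensor hħ.1).eigenMultiplicity_eq hlim hN.2 fun n => (hW n).2⟩
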